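/- **Theorem 2.1 (Detection via global test).** For an integer $n\ge 1$, $p\in(0,1)$, an integer $d\ge 2$ and a real $0<k\le n$, let $\mathcal Q=\mathcal G(n,p)$ be the Erdős–Rényi random graph on $[n]=\{1,\dots,n\}$, and let $\mathcal P=\mathcal G(n,p,d,k)$ be the law of the random graph on $[n]$ drawn as follows. Each vertex joins a community $S$ independently with probability $k/n$; each $i\in S$ receives an independent vector $U_i$, uniform on the unit sphere $\mathbb S^{d-1}\subset\mathbb R^d$; for $i\ne j$ both in $S$ the edge $ij$ is present if and only if $\langle U_i,U_j\rangle\ge\tau(p,d)$, where $\tau(p,d)$ is chosen so that $\mathbb P(\langle U_i,U_j\rangle\ge\tau(p,d))=p$; every other edge is present independently with probability $p$. Write $\mathcal G(n,p,d)=\mathcal G(n,p,d,n)$, let $G_{ij}\in\{0,1\}$ be the indicator of the edge $ij$, and let $$f_{\mathrm{tri}}(G)=\sum_{1\le i<j<\ell\le n}(G_{ij}-p)(G_{j\ell}-p)(G_{i\ell}-p).$$ There is a universal constant $C>0$ such that the following holds. Let $n\to\infty$, and let $k=k(n)\le n$, $p=p(n)$, $d=d(n)$ be such that $k\to\infty$,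 for all sufficiently large $n$ $$\frac1k\le p\le\frac12\qquad\text{and}\qquad \max\{C,(5\log(1/p))^4\}\le d,$$ and $d=o\!\left(\frac{k^6p^3}{n^3}\log^3(1/p)\right)$. Put $\gamma_{\mathrm{tri}}=\frac12\,\mathbb E_{G\sim\mathcal P}[f_{\mathrm{tri}}(G)]$. Then $$\mathbb P_{G\sim\mathcal Q}\big(f_{\mathrm{tri}}(G)>\gamma_{\mathrm{tri}}\big)+\mathbb P_{G\sim\mathcal P}\big(f_{\mathrm{tri}}(G)\le\gamma_{\mathrm{tri}}\big)\longrightarrow 0\qquad(n\to\infty),$$ and, for all sufficiently large $n$, $$\gamma_{\mathrm{tri}}=\frac12\binom n3\left(\frac kn\right)^3\mathbb E_{G\sim\mathcal G(n,p,d)}\big[(G_{12}-p)(G_{23}-p)(G_{13}-p)\big].$$ The error also tends to $0$ when the factor $\frac12$ in the definition of $\gamma_{\mathrm{tri}}$ is replaced with any fixed constant in $(0,1)$. -/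

import Mathlib

open MeasureTheory Filter Topology Asymptotics
open scoped RealInnerProductSpace ENNReal

noncomputable section

namespace LocalGeometry

/-- The unit sphere of `ℝ^d`. -/
abbrev Sph (d : ℕ) : Type := Metric.sphere (0 : EuclideanSpace ℝ (Fin d)) 1

/-- The uniform distribution on the unit sphere of `ℝ^d`: normalized surface measure. -/
def uniformSphere (d : ℕ) : Measure (Sph d) :=
  ((volume : Measure (EuclideanSpace ℝ (Fin d))).toSphere Set.univ)⁻¹ •
    (volume : Measure (EuclideanSpace ℝ (Fin d))).toSphere

/-- `ℙ(⟨U, V⟩ ≥ t)` for independent `U, V` uniform on the unit sphere of `ℝ^d`. -/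
def capProb (d : ℕ) (t : ℝ) : ℝ :=
  ((uniformSphere d).prod (uniformSphere d)).real
    {x | t ≤ ⟪(x.1 : EuclideanSpace ℝ (Fin d)), (x.2 : EuclideanSpace ℝ (Fin d))⟫}

/-- The threshold `τ(p, d)`, as the upper `p`-quantile of `⟨U, V⟩`. It satisfies
`ℙ(⟨U, V⟩ ≥ τ(p, d)) = p` for `d ≥ 2` and `0 < p ≤ 1`: see `capProb_tau`. -/
def tau (p : ℝ) (d : ℕ) : ℝ := sSup {t : ℝ | p ≤ capProb d t}

theorem null_cone_nonneg {d : ℕ} (hd : 2 ≤ d) (u : EuclideanSpace ℝ (Fin d)) (hu : ‖u‖ = 1)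
    {t : ℝ} (ht : 0 ≤ t) :
    (volume : Measure (EuclideanSpace ℝ (Fin d))) {x | ⟪u, x⟫ = t * ‖x‖} = 0 := by
  have huu : ⟪u, u⟫ = 1 := by rw [real_inner_self_eq_norm_sq, hu]; norm_num
  rcases lt_or_ge t 1 with h1 | h1
  · have hconv : Convex ℝ {x : EuclideanSpace ℝ (Fin d) | t * ‖x‖ ≤ ⟪u, x⟫} := by
      intro x hx y hy a b ha hb _
      simp only [Set.mem_ofPred_eq] at hx hy ⊢
      rw [inner_add_right, real_inner_smul_right, real_inner_smul_right]
      have h := norm_add_le (a • x) (b • y)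
      rw [norm_smul, norm_smul, Real.norm_of_nonneg ha, Real.norm_of_nonneg hb] at h
      nlinarith [mul_le_mul_of_nonneg_left h ht, mul_le_mul_of_nonneg_left hx ha,
        mul_le_mul_of_nonneg_left hy hb]
    refine measure_mono_null ?_ (hconv.addHaar_frontier volume)
    intro x hx
    simp only [Set.mem_ofPred_eq] at hx
    rw [frontier_eq_closure_inter_closure]
    refine ⟨subset_closure (by simp [hx]), ?_⟩
    have hlim : Tendsto (fun e : ℝ => x - e • u) (𝓝[>] 0) (𝓝 x) := by
      have : Continuous fun e : ℝ => x - e • u := by fun_prop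
      simpa using (this.tendsto 0).mono_left nhdsWithin_le_nhds
    refine mem_closure_of_tendsto hlim ?_
    filter_upwards [self_mem_nhdsWithin] with e he
    have he : 0 < e := he
    simp only [Set.mem_compl_iff, Set.mem_ofPred_eq, not_le, inner_sub_right,
      real_inner_smul_right, huu, hx]
    have h := norm_sub_norm_le x (e • u)
    rw [norm_smul, hu, Real.norm_of_nonneg he.le] at h
    nlinarith [mul_le_mul_of_nonneg_left h ht]
  · have hne : Submodule.span ℝ {u} ≠ ⊤ := by
      intro h
      have h2 := finrank_span_singleton (K := ℝ) (v := u) (by rintro rfl; simp at hu)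
      rw [h, finrank_top] at h2
      simp at h2
      omega
    refine measure_mono_null ?_ (Measure.addHaar_submodule volume _ hne)
    intro x hx
    simp only [Set.mem_ofPred_eq] at hx
    rw [SetLike.mem_coe, Submodule.mem_span_singleton]
    refine ⟨⟪u, x⟫, ?_⟩
    have h3 : ‖⟪u, x⟫ • u - x‖ ^ 2 ≤ 0 := by
      rw [norm_sub_sq_real, norm_smul, hu, real_inner_smul_left, mul_one, Real.norm_eq_abs, sq_abs]
      rw [hx]
      nlinarith [mul_nonneg (sub_nonneg.2 h1) (sq_nonneg ‖x‖), sq_nonneg ‖x‖]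
    have h4 : ‖⟪u, x⟫ • u - x‖ = 0 := by nlinarith [norm_nonneg (⟪u, x⟫ • u - x)]
    exact sub_eq_zero.1 (norm_eq_zero.1 h4)

theorem null_cone {d : ℕ} (hd : 2 ≤ d) (u : EuclideanSpace ℝ (Fin d)) (hu : ‖u‖ = 1) (t : ℝ) :
    (volume : Measure (EuclideanSpace ℝ (Fin d))) {x | ⟪u, x⟫ = t * ‖x‖} = 0 := by
  rcases le_total 0 t with ht | ht
  · exact null_cone_nonneg hd u hu ht
  · have := null_cone_nonneg hd (-u) (by simpa using hu) (neg_nonneg.2 ht)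
    simpa using this

theorem isProbabilityMeasure_uniformSphere {d : ℕ} (hd : 1 ≤ d) :
    IsProbabilityMeasure (uniformSphere d) := by
  have : NeZero d := ⟨by omega⟩
  refine ⟨?_⟩
  simp only [uniformSphere, Measure.smul_apply, smul_eq_mul]
  exact ENNReal.inv_mul_cancel (Measure.measure_univ_ne_zero.2 (Measure.toSphere_ne_zero _))
    (measure_ne_top _ _)

open Pointwise in
theorem uniformSphere_inner_eq {d : ℕ} (hd : 2 ≤ d) (u : Sph d) (t : ℝ) :
    uniformSphere d {v | ⟪(u : EuclideanSpace ℝ (Fin d)), (v : EuclideanSpace ℝ (Fin d))⟫ = t}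
      = 0 := by
  have hm : MeasurableSet
      {v : Sph d | ⟪(u : EuclideanSpace ℝ (Fin d)), (v : EuclideanSpace ℝ (Fin d))⟫ = t} := by
    apply IsClosed.measurableSet
    exact isClosed_eq (by fun_prop) continuous_const
  simp only [uniformSphere, Measure.smul_apply, smul_eq_mul]
  rw [Measure.toSphere_apply' _ hm]
  have h0 : (volume : Measure (EuclideanSpace ℝ (Fin d))) (Set.Ioo (0 : ℝ) 1 • (Subtype.val ''
      {v : Sph d | ⟪(u : EuclideanSpace ℝ (Fin d)), (v : EuclideanSpace ℝ (Fin d))⟫ = t})) = 0 := by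
    refine measure_mono_null ?_ (null_cone hd u (by simp) t)
    rintro _ ⟨r, hr, _, ⟨v, hv, rfl⟩, rfl⟩
    simp only [Set.mem_ofPred_eq] at hv
    have hv1 : ‖(v : EuclideanSpace ℝ (Fin d))‖ = 1 := by simp
    simp only [Set.mem_ofPred_eq, real_inner_smul_right, hv, norm_smul, hv1,
      Real.norm_of_nonneg hr.1.le]
    ring
  simp [h0]

/-- The threshold `τ(p, d)` does what it is chosen for. -/
theorem capProb_tau {d : ℕ} (hd : 2 ≤ d) {p : ℝ} (hp0 : 0 < p) (hp1 : p ≤ 1) :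
    capProb d (tau p d) = p := by
  have := isProbabilityMeasure_uniformSphere (d := d) (by omega)
  let X : Sph d × Sph d → ℝ := fun x =>
    ⟪(x.1 : EuclideanSpace ℝ (Fin d)), (x.2 : EuclideanSpace ℝ (Fin d))⟫
  have hX : Measurable X := (by fun_prop : Continuous X).measurable
  have hXb : ∀ x, |X x| ≤ 1 := fun x => by
    simpa using abs_real_inner_le_norm (x.1 : EuclideanSpace ℝ (Fin d)) x.2
  set μ := (uniformSphere d).prod (uniformSphere d) with hμ
  have hatom : ∀ t, μ {x | X x = t} = 0 := fun t => by
    have hm : MeasurableSet {x | X x = t} := hX (measurableSet_singleton t)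
    rw [hμ, Measure.measure_prod_null hm]
    exact Eventually.of_forall fun u => uniformSphere_inner_eq hd u t
  set ν := μ.map X with hν
  have : IsProbabilityMeasure ν := Measure.isProbabilityMeasure_map hX.aemeasurable
  have : NullSingletonClass ν := ⟨fun t => by
    rw [hν, Measure.map_apply hX (measurableSet_singleton t)]; exact hatom t⟩
  have hF : ∀ t, capProb d t = 1 - ProbabilityTheory.cdf ν t := fun t => by
    have h1 : capProb d t = ν.real (Set.Ici t) := by
      rw [hν, map_measureReal_apply hX measurableSet_Ici]; rfl
    rw [h1, ProbabilityTheory.cdf_eq_real, ← Set.compl_Iio, probReal_compl_eq_one_sub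
      measurableSet_Iio, measureReal_congr (Iio_ae_eq_Iic (μ := ν))]
  have hcont : Continuous (capProb d) := by
    have : Continuous (ProbabilityTheory.cdf ν) := by
      rw [continuous_iff_continuousAt]
      intro t
      have h1 := (ProbabilityTheory.cdf ν).measure_singleton t
      rw [ProbabilityTheory.measure_cdf, measure_singleton, eq_comm, ENNReal.ofReal_eq_zero] at h1
      have hmono := (ProbabilityTheory.cdf ν).mono
      rw [hmono.continuousAt_iff_leftLim_eq_rightLim, (ProbabilityTheory.cdf ν).rightLim_eq]
      exact le_antisymm (hmono.leftLim_le le_rfl) (by linarith)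
    rw [funext hF]
    fun_prop
  set S := {t : ℝ | p ≤ capProb d t} with hS
  have hne : S.Nonempty := ⟨-1, by
    have : {x : Sph d × Sph d | (-1 : ℝ) ≤ X x} = Set.univ :=
      Set.eq_univ_of_forall fun x => (abs_le.1 (hXb x)).1
    change p ≤ μ.real {x | (-1 : ℝ) ≤ X x}
    rw [this]; simpa using hp1⟩
  have hbdd : BddAbove S := ⟨1, fun t ht => by
    by_contra! h
    have h0 : {x : Sph d × Sph d | t ≤ X x} = ∅ :=
      Set.eq_empty_of_forall_notMem fun x hx => by
        have := (abs_le.1 (hXb x)).2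
        simp only [Set.mem_ofPred_eq] at hx
        linarith
    have : p ≤ μ.real {x | t ≤ X x} := ht
    rw [h0] at this
    simp at this
    linarith⟩
  have hcl : IsClosed S := isClosed_le continuous_const hcont
  refine le_antisymm ?_ (hcl.csSup_mem hne hbdd)
  have hlim : Tendsto (capProb d) (𝓝[>] (sSup S)) (𝓝 (capProb d (sSup S))) :=
    (hcont.tendsto _).mono_left nhdsWithin_le_nhds
  refine le_of_tendsto hlim ?_
  filter_upwards [self_mem_nhdsWithin] with t ht
  by_contra! h
  exact absurd (le_csSup hbdd (show t ∈ S from h.le)) (not_le.2 ht)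

/-- The observed graph, built from a community `S`, latent vectors `U` and a background graph `H`:
inside `S` an edge `ij` is present iff `⟨U i, U j⟩ ≥ τ(p, d)`, every other edge is the one of `H`. -/
def plantedGraph {n d : ℕ} (p : ℝ) (S : Set (Fin n)) (U : Fin n → Sph d)
    (H : SimpleGraph (Fin n)) : SimpleGraph (Fin n) where
  Adj i j := i ≠ j ∧
    ((i ∈ S ∧ j ∈ S ∧
        tau p d ≤ ⟪(U i : EuclideanSpace ℝ (Fin d)), (U j : EuclideanSpace ℝ (Fin d))⟫) ∨
      (¬ (i ∈ S ∧ j ∈ S) ∧ H.Adj i j))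
  symm := ⟨by
    rintro i j ⟨hij, h⟩
    refine ⟨hij.symm, ?_⟩
    rcases h with ⟨hi, hj, h⟩ | ⟨hS, h⟩
    · exact Or.inl ⟨hj, hi, by rwa [real_inner_comm]⟩
    · exact Or.inr ⟨fun hc => hS hc.symm, h.symm⟩⟩
  loopless := ⟨fun _ h => h.1 rfl⟩

/-- The planted graph depends measurably on the community, the latent vectors and the background,
so that the law `plantedModel` below is meaningful. -/
theorem measurable_plantedGraph {n d : ℕ} (p : ℝ) :
    Measurable fun x : Set (Fin n) × (Fin n → Sph d) × SimpleGraph (Fin n) =>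
      plantedGraph p x.1 x.2.1 x.2.2 := by
  rw [SimpleGraph.measurable_iff_adj]
  intro i j
  simp only [plantedGraph]
  have h1 : Measurable fun x : Set (Fin n) × (Fin n → Sph d) × SimpleGraph (Fin n) => tau p d ≤
      ⟪(x.2.1 i : EuclideanSpace ℝ (Fin d)), (x.2.1 j : EuclideanSpace ℝ (Fin d))⟫ := by
    refine measurableSet_setOfPred.1 (measurableSet_le measurable_const ?_)
    fun_prop
  have h2 : ∀ i, Measurable fun x : Set (Fin n) × (Fin n → Sph d) × SimpleGraph (Fin n) => i ∈ x.1 := by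
    intro i; exact (measurable_set_mem i).comp measurable_fst
  have h3 : Measurable fun x : Set (Fin n) × (Fin n → Sph d) × SimpleGraph (Fin n) => x.2.2.Adj i j :=
    (SimpleGraph.measurable_iff_adj.1 measurable_id i j).comp measurable_snd.snd
  have hi := h2 i
  have hj := h2 j
  fun_prop

/-- The null model `𝒬 = 𝒢(n, p)`, the Erdős–Rényi (binomial) random graph. -/
def nullModel (n : ℕ) (p : unitInterval) : Measure (SimpleGraph (Fin n)) :=
  SimpleGraph.binomialRandom (Fin n) p

/-- The planted model `𝒫 = 𝒢(n, p, d, k)`: the community contains each vertex independently with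
probability `k / n` (`projIcc` only turns this number into an element of `[0, 1]`; it changes
nothing when `0 ≤ k ≤ n`), the latent vectors are i.i.d. uniform on the sphere, the background graph
is `𝒢(n, p)`, and the three are independent. -/
def plantedModel (n : ℕ) (p : unitInterval) (d : ℕ) (k : ℝ) : Measure (SimpleGraph (Fin n)) :=
  ((ProbabilityTheory.setBernoulli (Set.univ : Set (Fin n))
        (Set.projIcc (0 : ℝ) 1 zero_le_one (k / n))).prod
      ((Measure.pi fun _ : Fin n => uniformSphere d).prod (nullModel n p))).map
    fun x => plantedGraph (p : ℝ) x.1 x.2.1 x.2.2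

/-- The planted model is a probability measure. -/
theorem isProbabilityMeasure_plantedModel (n : ℕ) (p : unitInterval) {d : ℕ} (hd : 1 ≤ d) (k : ℝ) :
    IsProbabilityMeasure (plantedModel n p d k) := by
  have := isProbabilityMeasure_uniformSphere hd
  unfold plantedModel nullModel
  exact Measure.isProbabilityMeasure_map (measurable_plantedGraph _).aemeasurable

/-- The full model `𝒢(n, p, d)`, in which `k = n`. -/
def fullModel (n : ℕ) (p : unitInterval) (d : ℕ) : Measure (SimpleGraph (Fin n)) :=
  plantedModel n p d n

open Classical in
/-- The centered edge indicator `G_{ij} - p`. -/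
def centeredEdge {n : ℕ} (p : ℝ) (G : SimpleGraph (Fin n)) (i j : Fin n) : ℝ :=
  (if G.Adj i j then 1 else 0) - p

/-- The signed triangle `(G_{ij} - p) (G_{jl} - p) (G_{il} - p)`. -/
def signedTriangle {n : ℕ} (p : ℝ) (G : SimpleGraph (Fin n)) (i j l : Fin n) : ℝ :=
  centeredEdge p G i j * centeredEdge p G j l * centeredEdge p G i l

/-- The global signed triangle count `f_tri`. -/
def fTri {n : ℕ} (p : ℝ) (G : SimpleGraph (Fin n)) : ℝ :=
  ∑ i : Fin n, ∑ j ∈ Finset.Ioi i, ∑ l ∈ Finset.Ioi j, signedTriangle p G i j l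

/-- The mean of the global signed triangle count under the planted model. -/
def plantedMean (n : ℕ) (p : unitInterval) (d : ℕ) (k : ℝ) : ℝ :=
  ∫ G, fTri (p : ℝ) G ∂plantedModel n p d k

/-- The sum of the type I and the type II error of the test that rejects the null model
when `f_tri > γ`. -/
def testingError (n : ℕ) (p : unitInterval) (d : ℕ) (k γ : ℝ) : ℝ :=
  (nullModel n p).real {G | fTri (p : ℝ) G > γ} +
    (plantedModel n p d k).real {G | fTri (p : ℝ) G ≤ γ}

end LocalGeometry

end

/-!
The proof is a second moment argument: Chebyshev's inequality for `fTri` under both models, the null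
model being the planted model with an empty community. Write `q = k / n` and `μ = triMean p d` for
the mean of a signed triangle whose three vertices all belong to the community.

*Moments.* Given the community and the latent vectors the edges are independent, so the mean of a
product of centered edges is a product of community indicators and of values of the kernel
`capKernel p d u v = 1[⟨u, v⟩ ≥ τ] - p`. This kernel has mean zero in each variable, and by rotation
invariance the conditional mean of a triangle of kernels given one of its vectors is the constant
`μ`. Hence `fTri` has planted mean `C(n, 3) q³ μ`. Two signed triangles with disjoint vertex sets are
uncorrelated, those sharing a single vertex have covariance at most `q⁵ μ²`, the second moment of a single
one is at most `p³ + q³ μ`, and for two triangles with a common edge one needs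
`∫ capKernel² capCodegree² ≤ 5 p μ`, where `capCodegree u v` is the integral of
`capKernel u w * capKernel v w` over `w`. Summing over pairs of triples gives `variance_fTri_le`.

*Slices of the sphere.* Both estimates on `μ` rest on the decomposition `uniformSphere_succ`: a
uniform point of the sphere of `ℝ^(m+1)` is `(z, ω) / √(1 + z²)` with `ω` uniform on the sphere of
`ℝ^m` and an independent slope `z` of density proportional to `(1 + z²)^(-(m+1)/2)`. Points with
slopes `z` and `z'` satisfy `⟨u, u'⟩ ≥ τ` exactly when `⟨ω, ω'⟩ ≥ τ √(1 + z²) √(1 + z'²) - z z'`. For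
`z'` in the cap this threshold decreases in `z`, because `z ↦ √(1 + z²)` is a contraction; for `z`
and `z'` both in the cap it is at most `τ`, and at most `τ - (1 - τ) ζ²` when both are at least `ζ`.
So the codegree is an increasing function of the slope, nonnegative on the cap, of mean zero and
bounded by `p`; these properties alone give the bound `5 p μ` (`integral_sq_mul_sq_le`).

*Size of `μ`.* Let `ζ` be the slope exceeded with probability `p / 2`. Pairs of neighbours with
slopes beyond `ζ` are joined through a threshold lowered by at least `ζ² / 2`, and Mills-type
estimates for the slope density turn this into a relative gain of order `d ζ³` in the probability of
an edge. As `d ζ²` is at least of order `log (1 / p)`, this gives `μ² ≥ c p⁶ log³(1 / p) / d`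
(`le_mul_triMean_sq`).

*Conclusion.* The two previous points bound the testing error by a multiple of `1 / k + √x + x` with
`x = n³ p³ / (k⁶ μ²)`, the `noiseRatio`, and `x` is at most a constant times the ratio
`d / (k⁶ p³ n⁻³ log³(1 / p))`, which tends to zero by assumption.
-/

namespace LocalGeometry

/-! ### Slices of the surface measure of the sphere -/

/-- Integration in polar coordinates. -/
theorem lintegral_eq_lintegral_toSphere {E : Type*} [NormedAddCommGroup E] [NormedSpace ℝ E]
    [Nontrivial E] [FiniteDimensional ℝ E] [MeasurableSpace E] [BorelSpace E] (μ : Measure E)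
    [μ.IsAddHaarMeasure] {f : E → ℝ≥0∞} (hf : Measurable f) :
    ∫⁻ x, f x ∂μ = ∫⁻ u : Metric.sphere (0 : E) 1,
      (∫⁻ r : ℝ in Set.Ioi 0, ENNReal.ofReal (r ^ (Module.finrank ℝ E - 1)) * f (r • (u : E)))
        ∂μ.toSphere := by
  have hm : Measurable fun q : Metric.sphere (0 : E) 1 × Set.Ioi (0 : ℝ) =>
      f ((q.2 : ℝ) • (q.1 : E)) := by
    apply hf.comp
    fun_prop
  calc ∫⁻ x, f x ∂μ = ∫⁻ x : ({(0)}ᶜ : Set E), f x ∂(μ.comap (↑)) := by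
        rw [lintegral_subtype_comap (measurableSet_singleton _).compl f,
          restrict_compl_singleton]
    _ = ∫⁻ q, f ((q.2 : ℝ) • (q.1 : E))
          ∂μ.toSphere.prod (.volumeIoiPow (Module.finrank ℝ E - 1)) := by
        rw [← μ.measurePreserving_homeomorphUnitSphereProd.lintegral_comp hm]
        refine lintegral_congr fun x => ?_
        congr 1
        have hx : ‖(x : E)‖ ≠ 0 := norm_ne_zero_iff.2 x.2
        simp [smul_smul, hx]
    _ = _ := by
        rw [lintegral_prod _ hm.aemeasurable]
        refine lintegral_congr fun u => ?_
        have hm' : Measurable fun r : Set.Ioi (0 : ℝ) => f ((r : ℝ) • (u : E)) := by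
          apply hf.comp
          fun_prop
        rw [Measure.volumeIoiPow, lintegral_withDensity_eq_lintegral_mul _ (by fun_prop) hm',
          ← lintegral_subtype_comap measurableSet_Ioi]
        rfl

/-- The vector of `ℝ^(m+1)` with first coordinate `a` and remaining coordinates `y`. -/
noncomputable def consVec {m : ℕ} (a : ℝ) (y : EuclideanSpace ℝ (Fin m)) :
    EuclideanSpace ℝ (Fin (m + 1)) :=
  WithLp.toLp 2 (Fin.cons a y.ofLp : Fin (m + 1) → ℝ)

theorem inner_consVec {m : ℕ} (a b : ℝ) (x y : EuclideanSpace ℝ (Fin m)) :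
    ⟪consVec a x, consVec b y⟫ = a * b + ⟪x, y⟫ := by
  simp [consVec, PiLp.inner_apply, Fin.sum_univ_succ, mul_comm]

theorem smul_consVec {m : ℕ} (c a : ℝ) (x : EuclideanSpace ℝ (Fin m)) :
    c • consVec a x = consVec (c * a) (c • x) := by
  ext i
  refine Fin.cases ?_ (fun j => ?_) i <;> simp [consVec]

theorem norm_consVec {m : ℕ} (a : ℝ) (x : EuclideanSpace ℝ (Fin m)) :
    ‖consVec a x‖ = √(a ^ 2 + ‖x‖ ^ 2) := by
  rw [← Real.sqrt_sq (norm_nonneg (consVec a x)), ← real_inner_self_eq_norm_sq, inner_consVec,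
    real_inner_self_eq_norm_sq]
  ring_nf

theorem continuous_consVec {m : ℕ} :
    Continuous fun q : ℝ × EuclideanSpace ℝ (Fin m) => consVec q.1 q.2 := by
  unfold consVec
  refine (PiLp.continuous_toLp 2 _).comp ?_
  refine continuous_pi fun i => ?_
  refine Fin.cases ?_ (fun j => ?_) i
  · simpa using continuous_fst
  · simp only [Fin.cons_succ]; fun_prop

theorem measurable_consVec {m : ℕ} :
    Measurable fun q : ℝ × EuclideanSpace ℝ (Fin m) => consVec q.1 q.2 :=
  continuous_consVec.measurable

theorem lintegral_consVec {m : ℕ} {f : EuclideanSpace ℝ (Fin (m + 1)) → ℝ≥0∞} (hf : Measurable f) :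
    ∫⁻ x, f x = ∫⁻ y : EuclideanSpace ℝ (Fin m), ∫⁻ a : ℝ, f (consVec a y) := by
  rw [← (PiLp.volume_preserving_toLp (Fin (m + 1))).lintegral_comp hf]
  rw [← ((volume_preserving_piFinSuccAbove (fun _ : Fin (m + 1) => ℝ) 0).symm _).lintegral_comp
    (by fun_prop)]
  rw [← (PiLp.volume_preserving_toLp (Fin m)).lintegral_comp
    (f := fun y => ∫⁻ a : ℝ, f (consVec a y))]
  · rw [Measure.volume_eq_prod, lintegral_prod_symm]
    · refine lintegral_congr fun y => lintegral_congr fun a => ?_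
      simp [consVec, MeasurableEquiv.piFinSuccAbove, Fin.insertNthEquiv]
    · refine Measurable.aemeasurable ?_
      fun_prop
  · refine Measurable.lintegral_prod_left'
      (f := fun q : ℝ × EuclideanSpace ℝ (Fin m) => f (consVec q.1 q.2)) ?_
    exact hf.comp measurable_consVec

theorem lintegral_eq_mul_lintegral_comp_mul {r : ℝ} (hr : 0 < r) {f : ℝ → ℝ≥0∞}
    (hf : Measurable f) : ∫⁻ a, f a = ENNReal.ofReal r * ∫⁻ z, f (r * z) := by
  conv_lhs => rw [← Real.smul_map_volume_mul_left hr.ne']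
  rw [lintegral_smul_measure, lintegral_map hf (by fun_prop), abs_of_pos hr, smul_eq_mul]

/-- The length of `(z, ω)` for a unit vector `ω`. -/
noncomputable def slopeNorm (z : ℝ) : ℝ := √(1 + z ^ 2)

theorem one_le_slopeNorm (z : ℝ) : 1 ≤ slopeNorm z := by
  rw [slopeNorm, Real.one_le_sqrt]; nlinarith [sq_nonneg z]

theorem slopeNorm_pos (z : ℝ) : 0 < slopeNorm z := one_pos.trans_le (one_le_slopeNorm z)

theorem slopeNorm_sq (z : ℝ) : slopeNorm z ^ 2 = 1 + z ^ 2 :=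
  Real.sq_sqrt (by positivity)

@[fun_prop]
theorem continuous_slopeNorm : Continuous slopeNorm := by unfold slopeNorm; fun_prop

@[fun_prop]
theorem measurable_slopeNorm : Measurable slopeNorm := continuous_slopeNorm.measurable

theorem norm_consVec_sphere {m : ℕ} (z : ℝ) (w : Sph m) :
    ‖consVec z (w : EuclideanSpace ℝ (Fin m))‖ = slopeNorm z := by
  rw [norm_consVec, slopeNorm]
  simp [add_comm]

/-- The point `(z, ω) / √(1 + z²)` of the sphere of `ℝ^(m+1)`: the unit vector whose first
coordinate is `z` times the length of its remaining coordinates, which have direction `ω`. -/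
noncomputable def sphLift {m : ℕ} (q : ℝ × Sph m) : Sph (m + 1) :=
  ⟨(slopeNorm q.1)⁻¹ • consVec q.1 (q.2 : EuclideanSpace ℝ (Fin m)), by
    simp [norm_smul, norm_consVec_sphere, abs_of_pos (slopeNorm_pos q.1), (slopeNorm_pos q.1).ne']⟩

theorem measurable_sphLift {m : ℕ} : Measurable (sphLift (m := m)) := by
  refine Measurable.subtype_mk ?_
  have h := (measurable_consVec (m := m)).comp
    (measurable_fst.prodMk (measurable_subtype_coe.comp measurable_snd) :
      Measurable fun q : ℝ × Sph m => (q.1, (q.2 : EuclideanSpace ℝ (Fin m))))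
  have h2 : Measurable fun q : ℝ × Sph m => (slopeNorm q.1)⁻¹ := by fun_prop
  exact h2.smul h

/-- The density of the slope `z`, up to normalization. -/
noncomputable def slopeDensity (m : ℕ) (z : ℝ) : ℝ := (slopeNorm z)⁻¹ ^ (m + 1)

/-- The unnormalized law of the slope `z = a / √(1 - a²)` of a coordinate `a` of a uniform point
of the sphere of `ℝ^(m+1)`. -/
noncomputable def slopeWeight (m : ℕ) : Measure ℝ :=
  (volume : Measure ℝ).withDensity fun z => ENNReal.ofReal (slopeDensity m z)

theorem measurable_slopeDensity (m : ℕ) : Measurable (slopeDensity m) := by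
  unfold slopeDensity; fun_prop

theorem setLIntegral_Iio_pow (m : ℕ) {b : ℝ} (hb : 0 < b) :
    ∫⁻ r : ℝ in Set.Ioi 0, ENNReal.ofReal (r ^ m) * (Set.Iio b).indicator 1 r =
      ENNReal.ofReal (b ^ (m + 1) / (m + 1)) := by
  have h := Measure.volumeIoiPow_apply_Iio m ⟨b, hb⟩
  rw [← h, Measure.volumeIoiPow, withDensity_apply _ measurableSet_Iio,
    setLIntegral_subtype measurableSet_Ioi _ fun a : ℝ ↦ .ofReal (a ^ m),
    Set.image_subtype_val_Ioi_Iio]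
  rw [← Set.Ioi_inter_Iio, Set.inter_comm, ← setLIntegral_indicator measurableSet_Iio]
  refine lintegral_congr fun r => ?_
  by_cases hr : r ∈ Set.Iio b <;> simp [hr]

open Pointwise in
theorem smul_mem_Ioo_smul_image_iff {E : Type*} [NormedAddCommGroup E] [NormedSpace ℝ E]
    {A : Set (Metric.sphere (0 : E) 1)} {r : ℝ} (hr : 0 < r) (u : Metric.sphere (0 : E) 1) :
    r • (u : E) ∈ Set.Ioo (0 : ℝ) 1 • (Subtype.val '' A) ↔ r < 1 ∧ u ∈ A := by
  constructor
  · rintro ⟨t, ht, _, ⟨v, hv, rfl⟩, h⟩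
    have h : t • (v : E) = r • (u : E) := h
    have h1 : t = r := by
      have := congrArg norm h
      simpa [norm_smul, abs_of_pos hr, abs_of_pos ht.1] using this
    subst h1
    have : v = u := Subtype.ext (smul_right_injective E hr.ne' h)
    exact ⟨ht.2, this ▸ hv⟩
  · rintro ⟨h1, h2⟩
    exact ⟨r, ⟨hr, h1⟩, _, ⟨u, h2, rfl⟩, rfl⟩

open Pointwise in
theorem measurableSet_Ioo_smul_image {E : Type*} [NormedAddCommGroup E] [NormedSpace ℝ E]
    [MeasurableSpace E] [BorelSpace E]
    {A : Set (Metric.sphere (0 : E) 1)} (hA : MeasurableSet A) :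
    MeasurableSet (Set.Ioo (0 : ℝ) 1 • (Subtype.val '' A) : Set E) := by
  have h0 : Subtype.val '' Set.Iio (⟨1, Set.mem_Ioi.2 one_pos⟩ : Set.Ioi (0 : ℝ)) = Set.Ioo 0 1 :=
    Set.image_subtype_val_Ioi_Iio _
  have h : (Set.Ioo (0 : ℝ) 1 • (Subtype.val '' A) : Set E) =
      (↑) '' (homeomorphUnitSphereProd E ⁻¹' (A ×ˢ Set.Iio ⟨1, Set.mem_Ioi.2 one_pos⟩)) := by
    rw [← Set.image2_smul, Set.image2_image_right, ← Homeomorph.image_symm, Set.image_image,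
      ← h0, Set.image2_image_left, Set.image2_swap, ← Set.image_prod]
    rfl
  rw [h]
  refine (MeasurableEmbedding.subtype_coe (measurableSet_singleton _).compl).measurableSet_image.2 ?_
  exact (homeomorphUnitSphereProd E).measurable (hA.prod measurableSet_Iio)

open Pointwise in
/-- The surface measure of the sphere of `ℝ^(m+1)` is the image under `sphLift` of the product of the
slope weight and the surface measure of the sphere of `ℝ^m`: both sides, evaluated at `A`, compute the
volume of the cone over `A`, in polar coordinates with respect to the last `m` coordinates. -/
theorem toSphere_succ {m : ℕ} (hm : 1 ≤ m) :
    (volume : Measure (EuclideanSpace ℝ (Fin (m + 1)))).toSphere =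
      ((slopeWeight m).prod (volume : Measure (EuclideanSpace ℝ (Fin m))).toSphere).map sphLift := by
  have : NeZero m := ⟨by omega⟩
  ext A hA
  rw [Measure.toSphere_apply' _ hA, Measure.map_apply measurable_sphLift hA]
  set C : Set (EuclideanSpace ℝ (Fin (m + 1))) := Set.Ioo (0 : ℝ) 1 • (Subtype.val '' A) with hC
  have hCm : MeasurableSet C := measurableSet_Ioo_smul_image hA
  have hind : Measurable (C.indicator (1 : EuclideanSpace ℝ (Fin (m + 1)) → ℝ≥0∞)) :=
    measurable_one.indicator hCm
  have hAm : Measurable (A.indicator (1 : Sph (m + 1) → ℝ≥0∞)) := measurable_one.indicator hA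
  have hcone : ∀ (w : Sph m) (r : ℝ), 0 < r → ∀ z,
      C.indicator (1 : EuclideanSpace ℝ (Fin (m + 1)) → ℝ≥0∞) (consVec (r * z) (r • w.1)) =
      A.indicator 1 (sphLift (z, w)) * (Set.Iio (slopeNorm z)⁻¹).indicator 1 r := by
    intro w r hr z
    have h1 : consVec (r * z) (r • w.1) = (r * slopeNorm z) • (sphLift (z, w)).1 := by
      rw [← smul_consVec, sphLift, smul_smul, mul_assoc, mul_inv_cancel₀ (slopeNorm_pos z).ne',
        mul_one]
    have h2 := smul_mem_Ioo_smul_image_iff (A := A) (mul_pos hr (slopeNorm_pos z)) (sphLift (z, w))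
    rw [← h1, ← hC, ← lt_inv_mul_iff₀' (slopeNorm_pos z), mul_one] at h2
    by_cases h3 : sphLift (z, w) ∈ A <;> by_cases h4 : r < (slopeNorm z)⁻¹ <;>
      simp [Set.indicator, h2, h3, h4]
  have hmeas : Measurable fun q : ℝ × Sph m => A.indicator (1 : Sph (m + 1) → ℝ≥0∞) (sphLift q) :=
    hAm.comp measurable_sphLift
  have key : volume C = ∫⁻ w, ∫⁻ z, A.indicator (1 : Sph (m + 1) → ℝ≥0∞) (sphLift (z, w)) *
      ENNReal.ofReal ((slopeNorm z)⁻¹ ^ (m + 1) / (m + 1))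
        ∂(volume : Measure ℝ) ∂(volume : Measure (EuclideanSpace ℝ (Fin m))).toSphere := by
    rw [← lintegral_indicator_one hCm, lintegral_consVec hind,
      lintegral_eq_lintegral_toSphere volume]
    · refine lintegral_congr fun w => ?_
      rw [finrank_euclideanSpace_fin]
      calc ∫⁻ r : ℝ in Set.Ioi 0, ENNReal.ofReal (r ^ (m - 1)) *
            ∫⁻ a, C.indicator (1 : EuclideanSpace ℝ (Fin (m + 1)) → ℝ≥0∞) (consVec a (r • w.1))
          = ∫⁻ r : ℝ in Set.Ioi 0, ∫⁻ z, ENNReal.ofReal (r ^ m) *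
            (A.indicator 1 (sphLift (z, w)) * (Set.Iio (slopeNorm z)⁻¹).indicator 1 r) := by
            refine setLIntegral_congr_fun measurableSet_Ioi fun r hr => ?_
            have hr : 0 < r := hr
            have h5 : Measurable fun a : ℝ =>
                C.indicator (1 : EuclideanSpace ℝ (Fin (m + 1)) → ℝ≥0∞) (consVec a (r • w.1)) :=
              hind.comp (measurable_consVec.comp (measurable_id.prodMk measurable_const))
            beta_reduce
            rw [lintegral_eq_mul_lintegral_comp_mul hr h5, ← mul_assoc,
              ← ENNReal.ofReal_mul (by positivity), ← pow_succ, Nat.sub_add_cancel hm,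
              ← lintegral_const_mul]
            · exact lintegral_congr fun z => by rw [hcone w r hr z]
            · exact h5.comp (by fun_prop)
        _ = ∫⁻ z, ∫⁻ r : ℝ in Set.Ioi 0, ENNReal.ofReal (r ^ m) *
            (A.indicator 1 (sphLift (z, w)) * (Set.Iio (slopeNorm z)⁻¹).indicator 1 r) := by
            rw [lintegral_lintegral_swap]
            refine Measurable.aemeasurable ?_
            have h6 : Measurable fun q : ℝ × ℝ =>
                (Set.Iio (slopeNorm q.2)⁻¹).indicator (1 : ℝ → ℝ≥0∞) q.1 := by
              have : MeasurableSet {q : ℝ × ℝ | q.1 < (slopeNorm q.2)⁻¹} :=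
                measurableSet_lt (by fun_prop) (by fun_prop)
              exact measurable_one.indicator this
            have h7 : Measurable fun q : ℝ × ℝ =>
                A.indicator (1 : Sph (m + 1) → ℝ≥0∞) (sphLift (q.2, w)) :=
              hmeas.comp (by fun_prop : Measurable fun q : ℝ × ℝ => (q.2, w))
            have h8 : Measurable fun q : ℝ × ℝ => ENNReal.ofReal (q.1 ^ m) := by fun_prop
            exact h8.mul (h7.mul h6)
        _ = _ := by
            refine lintegral_congr fun z => ?_
            rw [← setLIntegral_Iio_pow m (inv_pos.2 (slopeNorm_pos z)), ← lintegral_const_mul']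
            · exact lintegral_congr fun r => by ring
            · by_cases h3 : sphLift (z, w) ∈ A <;> simp [Set.indicator, h3]
    · refine Measurable.lintegral_prod_left'
        (f := fun q : ℝ × EuclideanSpace ℝ (Fin m) => C.indicator 1 (consVec q.1 q.2)) ?_
      exact hind.comp measurable_consVec
  have key2 : ((slopeWeight m).prod (volume : Measure (EuclideanSpace ℝ (Fin m))).toSphere)
      (sphLift ⁻¹' A) = ∫⁻ w, ∫⁻ z, ENNReal.ofReal ((slopeNorm z)⁻¹ ^ (m + 1)) *
        A.indicator (1 : Sph (m + 1) → ℝ≥0∞) (sphLift (z, w))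
        ∂(volume : Measure ℝ) ∂(volume : Measure (EuclideanSpace ℝ (Fin m))).toSphere := by
    rw [← lintegral_indicator_one (measurable_sphLift hA), slopeWeight, lintegral_prod_symm]
    · refine lintegral_congr fun w => ?_
      rw [lintegral_withDensity_eq_lintegral_mul]
      · rfl
      · exact (measurable_slopeDensity m).ennreal_ofReal
      · exact hmeas.comp (by fun_prop : Measurable fun z : ℝ => (z, w))
    · exact hmeas.aemeasurable
  rw [key2, key, finrank_euclideanSpace_fin, ← lintegral_const_mul']
  · refine lintegral_congr fun w => ?_
    rw [← lintegral_const_mul' _ _ (by simp)]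
    refine lintegral_congr fun z => ?_
    rw [ENNReal.ofReal_div_of_pos (by positivity), mul_left_comm, mul_comm]
    congr 1
    have : ENNReal.ofReal ((m : ℝ) + 1) = ((m + 1 : ℕ) : ℝ≥0∞) := by
      rw [← ENNReal.ofReal_natCast]; push_cast; rfl
    rw [this, ENNReal.mul_div_cancel (by simp) (by simp)]
  · simp

/-! ### Slicing the uniform distribution on the sphere -/

/-- The law of the slope `z = a / √(1 - a²)` of a coordinate `a` of a uniform point of the sphere of
`ℝ^(m+1)`: the probability measure with density proportional to `(1 + z²)^(-(m+1)/2)`. -/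
noncomputable def slopeLaw (m : ℕ) : Measure ℝ := (slopeWeight m Set.univ)⁻¹ • slopeWeight m

instance (m : ℕ) : SFinite (slopeWeight m) := by unfold slopeWeight; infer_instance

instance (m : ℕ) : SFinite (slopeLaw m) := by unfold slopeLaw; infer_instance

theorem toSphere_univ_ne_zero {m : ℕ} (hm : 1 ≤ m) :
    (volume : Measure (EuclideanSpace ℝ (Fin m))).toSphere Set.univ ≠ 0 := by
  have : NeZero m := ⟨by omega⟩
  exact Measure.measure_univ_ne_zero.2 (Measure.toSphere_ne_zero _)

theorem toSphere_univ_succ {m : ℕ} (hm : 1 ≤ m) :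
    (volume : Measure (EuclideanSpace ℝ (Fin (m + 1)))).toSphere Set.univ =
      slopeWeight m Set.univ * (volume : Measure (EuclideanSpace ℝ (Fin m))).toSphere Set.univ := by
  rw [toSphere_succ hm, Measure.map_apply measurable_sphLift .univ, Set.preimage_univ,
    ← Set.univ_prod_univ, Measure.prod_prod]

theorem slopeWeight_univ_ne_zero {m : ℕ} (hm : 1 ≤ m) : slopeWeight m Set.univ ≠ 0 := by
  intro h
  have := toSphere_univ_succ hm
  rw [h, zero_mul] at this
  exact toSphere_univ_ne_zero (by omega) this

theorem slopeWeight_univ_ne_top {m : ℕ} (hm : 1 ≤ m) : slopeWeight m Set.univ ≠ ⊤ := by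
  intro h
  have := toSphere_univ_succ hm
  rw [h, ENNReal.top_mul (toSphere_univ_ne_zero hm)] at this
  exact measure_ne_top _ _ this

theorem isProbabilityMeasure_slopeLaw {m : ℕ} (hm : 1 ≤ m) : IsProbabilityMeasure (slopeLaw m) := by
  refine ⟨?_⟩
  rw [slopeLaw, Measure.smul_apply, smul_eq_mul]
  exact ENNReal.inv_mul_cancel (slopeWeight_univ_ne_zero hm) (slopeWeight_univ_ne_top hm)

/-- A uniform point of the sphere of `ℝ^(m+1)` is a random slope together with an independent
uniform direction in `ℝ^m`. -/
theorem uniformSphere_succ {m : ℕ} (hm : 1 ≤ m) :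
    uniformSphere (m + 1) = ((slopeLaw m).prod (uniformSphere m)).map sphLift := by
  have h0 := slopeWeight_univ_ne_zero hm
  have h1 := toSphere_univ_ne_zero hm
  rw [uniformSphere, toSphere_univ_succ hm, toSphere_succ hm, slopeLaw, uniformSphere,
    Measure.prod_smul_left, Measure.prod_smul_right, Measure.map_smul, Measure.map_smul, smul_smul,
    ENNReal.mul_inv (Or.inl h0) (Or.inr h1)]

/-- The action of a linear isometry on the sphere. -/
noncomputable def sphRot {d : ℕ} (R : EuclideanSpace ℝ (Fin d) ≃ₗᵢ[ℝ] EuclideanSpace ℝ (Fin d)) :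
    Sph d ≃ₜ Sph d where
  toFun u := ⟨R u, by simp⟩
  invFun u := ⟨R.symm u, by simp⟩
  left_inv u := by simp
  right_inv u := by simp
  continuous_toFun := by fun_prop
  continuous_invFun := by fun_prop

@[simp]
theorem coe_sphRot {d : ℕ} (R : EuclideanSpace ℝ (Fin d) ≃ₗᵢ[ℝ] EuclideanSpace ℝ (Fin d))
    (u : Sph d) : (sphRot R u : EuclideanSpace ℝ (Fin d)) = R u := rfl

open Pointwise in
theorem measurePreserving_sphRot {d : ℕ}
    (R : EuclideanSpace ℝ (Fin d) ≃ₗᵢ[ℝ] EuclideanSpace ℝ (Fin d)) :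
    MeasurePreserving (sphRot R) (uniformSphere d) (uniformSphere d) := by
  refine ⟨(sphRot R).measurable, ?_⟩
  rw [uniformSphere, Measure.map_smul]
  congr 1
  ext A hA
  have hRA : MeasurableSet (sphRot R ⁻¹' A) := (sphRot R).measurable hA
  rw [Measure.map_apply (sphRot R).measurable hA, Measure.toSphere_apply' _ hA,
    Measure.toSphere_apply' _ hRA]
  congr 1
  rw [← R.measurePreserving.measure_preimage (measurableSet_Ioo_smul_image hA).nullMeasurableSet]
  congr 1
  ext x
  constructor
  · rintro ⟨r, hr, _, ⟨u, hu, rfl⟩, rfl⟩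
    exact ⟨r, hr, _, ⟨sphRot R u, hu, rfl⟩, by simp⟩
  · rintro ⟨r, hr, _, ⟨u, hu, rfl⟩, h⟩
    have h : r • (u : EuclideanSpace ℝ (Fin d)) = R x := h
    refine ⟨r, hr, _, ⟨(sphRot R).symm u, by simpa using hu, rfl⟩, ?_⟩
    have : x = R.symm (r • (u : EuclideanSpace ℝ (Fin d))) := by rw [h]; simp
    rw [this, map_smul]
    rfl

theorem exists_sphRot_eq {d : ℕ} (u v : Sph d) : ∃ R, sphRot R u = v :=
  ⟨Submodule.reflection (ℝ ∙ ((u : EuclideanSpace ℝ (Fin d)) - v))ᗮ, Subtype.ext <| by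
    rw [coe_sphRot]
    exact Submodule.reflection_sub (by simp)⟩

theorem integral_sphRot {d : ℕ} (R : EuclideanSpace ℝ (Fin d) ≃ₗᵢ[ℝ] EuclideanSpace ℝ (Fin d))
    (f : Sph d → ℝ) : ∫ v, f (sphRot R v) ∂uniformSphere d = ∫ v, f v ∂uniformSphere d :=
  (measurePreserving_sphRot R).integral_comp (sphRot R).measurableEmbedding f

/-- The first basis vector, as a point of the sphere. -/
noncomputable def sphNorth (m : ℕ) : Sph (m + 1) := ⟨consVec 1 0, by simp [norm_consVec]⟩

theorem inner_sphNorth_sphLift {m : ℕ} (z : ℝ) (w : Sph m) :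
    ⟪(sphNorth m : EuclideanSpace ℝ (Fin (m + 1))), (sphLift (z, w)).1⟫ = z / slopeNorm z := by
  simp only [sphNorth, sphLift]
  rw [real_inner_smul_right, inner_consVec]
  simp; field_simp

theorem inner_sphLift_sphLift {m : ℕ} (z z' : ℝ) (w w' : Sph m) :
    ⟪(sphLift (z, w)).1, (sphLift (z', w')).1⟫ =
      (z * z' + ⟪(w : EuclideanSpace ℝ (Fin m)), (w' : EuclideanSpace ℝ (Fin m))⟫) /
        (slopeNorm z * slopeNorm z') := by
  simp only [sphLift]
  rw [real_inner_smul_right, real_inner_smul_left, inner_consVec]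
  field_simp

/-! ### The spherical cap kernel -/

/-- The spherical cap `{v | ⟨u, v⟩ ≥ t}`. -/
def sphCap {d : ℕ} (t : ℝ) (u : Sph d) : Set (Sph d) :=
  {v | t ≤ ⟪(u : EuclideanSpace ℝ (Fin d)), (v : EuclideanSpace ℝ (Fin d))⟫}

theorem mem_sphCap_comm {d : ℕ} {t : ℝ} {u v : Sph d} : v ∈ sphCap t u ↔ u ∈ sphCap t v := by
  simp only [sphCap, Set.mem_ofPred_eq]
  rw [real_inner_comm]

theorem measurableSet_sphCap_prod {d : ℕ} (t : ℝ) :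
    MeasurableSet {q : Sph d × Sph d | q.2 ∈ sphCap t q.1} := by
  have h : Continuous fun q : Sph d × Sph d =>
      ⟪(q.1 : EuclideanSpace ℝ (Fin d)), (q.2 : EuclideanSpace ℝ (Fin d))⟫ := by fun_prop
  exact measurableSet_le measurable_const h.measurable

theorem measurableSet_sphCap {d : ℕ} (t : ℝ) (u : Sph d) : MeasurableSet (sphCap t u) :=
  measurable_prodMk_left (measurableSet_sphCap_prod t)

theorem mem_sphCap_sphRot {d : ℕ} {t : ℝ} {u v : Sph d}
    (R : EuclideanSpace ℝ (Fin d) ≃ₗᵢ[ℝ] EuclideanSpace ℝ (Fin d)) :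
    sphRot R v ∈ sphCap t (sphRot R u) ↔ v ∈ sphCap t u := by
  simp [sphCap]

theorem measureReal_prod_eq_integral {α β : Type*} [MeasurableSpace α] [MeasurableSpace β]
    (μ : Measure α) (ν : Measure β) [IsFiniteMeasure μ] [IsFiniteMeasure ν] {s : Set (α × β)}
    (hs : MeasurableSet s) :
    (μ.prod ν).real s = ∫ x, ν.real (Prod.mk x ⁻¹' s) ∂μ := by
  rw [measureReal_def, Measure.prod_apply hs, integral_eq_lintegral_of_nonneg_ae]
  · congr 1
    refine lintegral_congr fun x => ?_
    rw [ofReal_measureReal]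
  · exact Eventually.of_forall fun x => measureReal_nonneg
  · exact ((measurable_measure_prodMk_left hs).ennreal_toReal).aestronglyMeasurable

/-- By rotation invariance, all caps of height `t` have the same measure. -/
theorem measureReal_sphCap {d : ℕ} (hd : 1 ≤ d) (t : ℝ) (u : Sph d) :
    (uniformSphere d).real (sphCap t u) = capProb d t := by
  have := isProbabilityMeasure_uniformSphere hd
  have h1 : ∀ v, (uniformSphere d).real (sphCap t v) = (uniformSphere d).real (sphCap t u) := by
    intro v
    obtain ⟨R, rfl⟩ := exists_sphRot_eq u v
    rw [← (measurePreserving_sphRot R).measureReal_preimage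
      (measurableSet_sphCap _ _).nullMeasurableSet]
    congr 1
    ext w
    exact mem_sphCap_sphRot R
  refine Eq.trans ?_ (measureReal_prod_eq_integral _ _ (measurableSet_sphCap_prod t)).symm
  symm
  calc _ = ∫ v : Sph d, (uniformSphere d).real (sphCap t u) ∂uniformSphere d :=
        integral_congr_ae (Eventually.of_forall h1)
    _ = _ := by simp

/-- The slopes of the points of a cap of height `t` around the first basis vector. -/
def slopeCap (t : ℝ) : Set ℝ := {z | t * slopeNorm z ≤ z}

theorem measurableSet_slopeCap (t : ℝ) : MeasurableSet (slopeCap t) :=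
  measurableSet_le (by fun_prop) measurable_id

theorem sphLift_mem_sphCap_sphNorth {m : ℕ} {t z : ℝ} {w : Sph m} :
    sphLift (z, w) ∈ sphCap t (sphNorth m) ↔ z ∈ slopeCap t := by
  simp only [sphCap, slopeCap, Set.mem_ofPred_eq]
  rw [inner_sphNorth_sphLift, le_div_iff₀ (slopeNorm_pos z)]

theorem sphLift_mem_sphCap_sphLift {m : ℕ} {t z z' : ℝ} {w w' : Sph m} :
    sphLift (z', w') ∈ sphCap t (sphLift (z, w)) ↔
      w' ∈ sphCap (t * slopeNorm z * slopeNorm z' - z * z') w := by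
  simp only [sphCap, Set.mem_ofPred_eq]
  rw [inner_sphLift_sphLift, le_div_iff₀ (mul_pos (slopeNorm_pos z) (slopeNorm_pos z')),
    sub_le_iff_le_add', mul_assoc]

theorem measureReal_uniformSphere_succ {m : ℕ} (hm : 1 ≤ m) {A : Set (Sph (m + 1))}
    (hA : MeasurableSet A) :
    (uniformSphere (m + 1)).real A =
      ∫ z, (uniformSphere m).real {w | sphLift (z, w) ∈ A} ∂slopeLaw m := by
  have := isProbabilityMeasure_uniformSphere hm
  have := isProbabilityMeasure_slopeLaw hm
  rw [uniformSphere_succ hm, map_measureReal_apply measurable_sphLift hA,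
    measureReal_prod_eq_integral _ _ (measurable_sphLift hA)]
  rfl

theorem capProb_succ {m : ℕ} (hm : 1 ≤ m) (t : ℝ) :
    capProb (m + 1) t = (slopeLaw m).real (slopeCap t) := by
  have := isProbabilityMeasure_uniformSphere hm
  rw [← measureReal_sphCap (by omega) t (sphNorth m),
    measureReal_uniformSphere_succ hm (measurableSet_sphCap _ _),
    ← integral_indicator_one (measurableSet_slopeCap t)]
  refine integral_congr_ae (Eventually.of_forall fun z => ?_)
  simp only [sphLift_mem_sphCap_sphNorth]
  by_cases h : z ∈ slopeCap t <;> simp [h]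

theorem capProb_antitone (d : ℕ) (hd : 1 ≤ d) : Antitone (capProb d) := by
  have := isProbabilityMeasure_uniformSphere hd
  intro s t hst
  exact measureReal_mono fun q hq => le_trans hst hq

theorem capProb_nonneg (d : ℕ) (t : ℝ) : 0 ≤ capProb d t := measureReal_nonneg

theorem capProb_le_one (d : ℕ) (hd : 1 ≤ d) (t : ℝ) : capProb d t ≤ 1 := by
  have := isProbabilityMeasure_uniformSphere hd
  exact measureReal_le_one

/-- Cap probabilities of nonnegative heights decrease with the dimension: the projection of a unit
vector to a hyperplane has length at most `1`. -/
theorem capProb_succ_le {m : ℕ} (hm : 1 ≤ m) {t : ℝ} (ht : 0 ≤ t) :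
    capProb (m + 1) t ≤ capProb m t := by
  have := isProbabilityMeasure_uniformSphere hm
  have := isProbabilityMeasure_slopeLaw hm
  have : NeZero m := ⟨by omega⟩
  obtain ⟨w⟩ : Nonempty (Sph m) := by
    by_contra h
    rw [not_nonempty_iff] at h
    have := isProbabilityMeasure_uniformSphere hm
    exact (IsProbabilityMeasure.ne_zero (uniformSphere m)) (Measure.eq_zero_of_isEmpty _)
  rw [← measureReal_sphCap (by omega) t (sphLift (0, w)),
    measureReal_uniformSphere_succ hm (measurableSet_sphCap _ _)]
  simp only [sphLift_mem_sphCap_sphLift]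
  calc _ ≤ ∫ z : ℝ, capProb m t ∂slopeLaw m := by
        refine integral_mono_of_nonneg (Eventually.of_forall fun z => measureReal_nonneg)
          (integrable_const _) (Eventually.of_forall fun z => ?_)
        change (uniformSphere m).real (sphCap _ w) ≤ _
        rw [measureReal_sphCap hm]
        refine capProb_antitone m hm ?_
        have h0 : slopeNorm 0 = 1 := by simp [slopeNorm]
        rw [h0]
        nlinarith [one_le_slopeNorm z]
    _ = _ := by simp

/-- The centered edge indicator `1[⟨u, v⟩ ≥ τ(p, d)] - p` of two latent vectors. -/
noncomputable def capKernel (p : ℝ) (d : ℕ) (u v : Sph d) : ℝ :=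
  (sphCap (tau p d) u).indicator 1 v - p

/-- The average of `capKernel u w * capKernel v w` over a uniform `w`. -/
noncomputable def capCodegree (p : ℝ) (d : ℕ) (u v : Sph d) : ℝ :=
  ∫ w, capKernel p d u w * capKernel p d v w ∂uniformSphere d

/-- The mean of a signed triangle of three independent latent vectors. -/
noncomputable def triMean (p : ℝ) (d : ℕ) : ℝ :=
  ∫ u, ∫ v, capKernel p d u v * capCodegree p d u v ∂uniformSphere d ∂uniformSphere d

theorem capKernel_comm (p : ℝ) (d : ℕ) (u v : Sph d) : capKernel p d u v = capKernel p d v u := by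
  unfold capKernel
  by_cases h : v ∈ sphCap (tau p d) u
  · simp [h, mem_sphCap_comm.1 h]
  · simp [h, mt mem_sphCap_comm.2 h]

theorem measurable_capKernel (p : ℝ) (d : ℕ) :
    Measurable fun q : Sph d × Sph d => capKernel p d q.1 q.2 :=
  (measurable_one.indicator (measurableSet_sphCap_prod (tau p d))).sub_const p

@[fun_prop]
theorem measurable_capKernel_comp {α : Type*} [MeasurableSpace α] {p : ℝ} {d : ℕ}
    {f g : α → Sph d} (hf : Measurable f) (hg : Measurable g) :
    Measurable fun a => capKernel p d (f a) (g a) := by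
  have h := (measurable_capKernel p d).comp (hf.prodMk hg)
  exact h

theorem abs_capKernel_le {p : ℝ} (hp0 : 0 ≤ p) (hp1 : p ≤ 1) (d : ℕ) (u v : Sph d) :
    |capKernel p d u v| ≤ 1 := by
  unfold capKernel
  rw [abs_le]
  by_cases h : v ∈ sphCap (tau p d) u <;> simp [h] <;> constructor <;> linarith

theorem capKernel_sphRot {p : ℝ} {d : ℕ} (u v : Sph d)
    (R : EuclideanSpace ℝ (Fin d) ≃ₗᵢ[ℝ] EuclideanSpace ℝ (Fin d)) :
    capKernel p d (sphRot R u) (sphRot R v) = capKernel p d u v := by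
  unfold capKernel
  by_cases h : v ∈ sphCap (tau p d) u
  · rw [Set.indicator_of_mem h, Set.indicator_of_mem ((mem_sphCap_sphRot R).2 h)]; rfl
  · rw [Set.indicator_of_notMem h, Set.indicator_of_notMem (mt (mem_sphCap_sphRot R).1 h)]

theorem capCodegree_sphRot {p : ℝ} {d : ℕ} (u v : Sph d)
    (R : EuclideanSpace ℝ (Fin d) ≃ₗᵢ[ℝ] EuclideanSpace ℝ (Fin d)) :
    capCodegree p d (sphRot R u) (sphRot R v) = capCodegree p d u v := by
  unfold capCodegree
  rw [← integral_sphRot R]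
  simp only [capKernel_sphRot]

theorem measurable_capCodegree (p : ℝ) {d : ℕ} (hd : 1 ≤ d) :
    Measurable fun q : Sph d × Sph d => capCodegree p d q.1 q.2 := by
  have := isProbabilityMeasure_uniformSphere hd
  have h : Measurable fun x : (Sph d × Sph d) × Sph d =>
      capKernel p d x.1.1 x.2 * capKernel p d x.1.2 x.2 := by fun_prop
  exact (h.stronglyMeasurable.integral_prod_right' (ν := uniformSphere d)).measurable

theorem measurable_capCodegree_comp {α : Type*} [MeasurableSpace α] {p : ℝ} {d : ℕ} (hd : 1 ≤ d)
    {f g : α → Sph d} (hf : Measurable f) (hg : Measurable g) :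
    Measurable fun a => capCodegree p d (f a) (g a) := by
  have h := (measurable_capCodegree p hd).comp (hf.prodMk hg)
  exact h

theorem integrable_capKernel {p : ℝ} {d : ℕ} (hd : 1 ≤ d) (hp0 : 0 ≤ p) (hp1 : p ≤ 1) (u : Sph d) :
    Integrable (capKernel p d u) (uniformSphere d) := by
  have := isProbabilityMeasure_uniformSphere hd
  refine Integrable.of_bound (C := 1) ?_ (Eventually.of_forall fun v => ?_)
  · exact (measurable_capKernel_comp measurable_const measurable_id).aestronglyMeasurable
  · exact abs_capKernel_le hp0 hp1 d u v

theorem integral_capKernel {p : ℝ} {d : ℕ} (hd : 2 ≤ d) (hp0 : 0 < p) (hp1 : p ≤ 1) (u : Sph d) :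
    ∫ v, capKernel p d u v ∂uniformSphere d = 0 := by
  have := isProbabilityMeasure_uniformSphere (d := d) (by omega)
  have hm := measurableSet_sphCap (tau p d) u
  unfold capKernel
  rw [integral_sub, integral_indicator_one hm, measureReal_sphCap (by omega),
    capProb_tau hd hp0 hp1]
  · simp
  · exact (integrable_const (1 : ℝ)).indicator hm
  · exact integrable_const _

/-- The codegree kernel is the probability of a common neighbour, minus `p²`. -/
theorem capCodegree_eq {p : ℝ} {d : ℕ} (hd : 2 ≤ d) (hp0 : 0 < p) (hp1 : p ≤ 1) (u v : Sph d) :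
    capCodegree p d u v =
      (uniformSphere d).real (sphCap (tau p d) u ∩ sphCap (tau p d) v) - p ^ 2 := by
  have := isProbabilityMeasure_uniformSphere (d := d) (by omega)
  have hu := measurableSet_sphCap (tau p d) u
  have hv := measurableSet_sphCap (tau p d) v
  have h1 : ∀ w, capKernel p d u w * capKernel p d v w =
      ((sphCap (tau p d) u ∩ sphCap (tau p d) v).indicator 1 w - p ^ 2) -
        (p * capKernel p d u w + p * capKernel p d v w) := by
    intro w
    unfold capKernel
    by_cases h : w ∈ sphCap (tau p d) u <;> by_cases h' : w ∈ sphCap (tau p d) v <;>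
      simp [h, h'] <;> ring
  have i1 := (integrable_capKernel (by omega) hp0.le hp1 u (d := d)).const_mul p
  have i2 := (integrable_capKernel (by omega) hp0.le hp1 v (d := d)).const_mul p
  have i3 : Integrable ((sphCap (tau p d) u ∩ sphCap (tau p d) v).indicator (1 : Sph d → ℝ))
    (uniformSphere d) := (integrable_const (1 : ℝ)).indicator (hu.inter hv)
  have i4 : Integrable (fun w => (sphCap (tau p d) u ∩ sphCap (tau p d) v).indicator 1 w - p ^ 2)
    (uniformSphere d) := i3.sub (integrable_const _)
  have i5 : Integrable (fun w => p * capKernel p d u w + p * capKernel p d v w)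
    (uniformSphere d) := i1.add i2
  unfold capCodegree
  simp_rw [h1]
  rw [integral_sub i4 i5, integral_add i1 i2,
    integral_const_mul, integral_const_mul, integral_capKernel hd hp0 hp1,
    integral_capKernel hd hp0 hp1, integral_sub i3 (integrable_const _),
    integral_indicator_one (hu.inter hv)]
  simp

theorem abs_capCodegree_le {p : ℝ} {d : ℕ} (hd : 2 ≤ d) (hp0 : 0 < p) (hp1 : p ≤ 1) (u v : Sph d) :
    |capCodegree p d u v| ≤ p := by
  have := isProbabilityMeasure_uniformSphere (d := d) (by omega)
  rw [capCodegree_eq hd hp0 hp1]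
  have h0 : 0 ≤ (uniformSphere d).real (sphCap (tau p d) u ∩ sphCap (tau p d) v) :=
    measureReal_nonneg
  have h1 : (uniformSphere d).real (sphCap (tau p d) u ∩ sphCap (tau p d) v) ≤ p := by
    refine (measureReal_mono Set.inter_subset_left).trans_eq ?_
    rw [measureReal_sphCap (by omega), capProb_tau hd hp0 hp1]
  rw [abs_le]
  constructor <;> nlinarith

theorem integral_capCodegree {p : ℝ} {d : ℕ} (hd : 2 ≤ d) (hp0 : 0 < p) (hp1 : p ≤ 1) (u : Sph d) :
    ∫ v, capCodegree p d u v ∂uniformSphere d = 0 := by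
  have := isProbabilityMeasure_uniformSphere (d := d) (by omega)
  unfold capCodegree
  rw [integral_integral_swap]
  · refine integral_eq_zero_of_ae (Eventually.of_forall fun w => ?_)
    simp_rw [capKernel_comm p d _ w]
    rw [integral_const_mul, integral_capKernel hd hp0 hp1, mul_zero]
    rfl
  · refine Integrable.of_bound (C := 1) ?_ (Eventually.of_forall fun v => ?_)
    · refine Measurable.aestronglyMeasurable ?_
      unfold Function.uncurry
      fun_prop
    · simp only [Function.uncurry, norm_mul, Real.norm_eq_abs]
      exact mul_le_one₀ (abs_capKernel_le hp0.le hp1 d _ _) (abs_nonneg _)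
        (abs_capKernel_le hp0.le hp1 d _ _)

/-- The codegree of the first basis vector and a point of slope `z`: slicing once more, a common
neighbour has a slope `z'` in the cap and its direction is within a cap of an explicit height. -/
noncomputable def slopeCodegree (p : ℝ) (m : ℕ) (z : ℝ) : ℝ :=
  ∫ z' in slopeCap (tau p (m + 1)),
    capProb m (tau p (m + 1) * slopeNorm z * slopeNorm z' - z * z') ∂slopeLaw m - p ^ 2

theorem capKernel_sphNorth_sphLift {m : ℕ} (p : ℝ) (z : ℝ) (w : Sph m) :
    capKernel p (m + 1) (sphNorth m) (sphLift (z, w)) =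
      (slopeCap (tau p (m + 1))).indicator 1 z - p := by
  unfold capKernel
  by_cases h : z ∈ slopeCap (tau p (m + 1))
  · simp [h, sphLift_mem_sphCap_sphNorth.2 h]
  · simp [h, mt sphLift_mem_sphCap_sphNorth.1 h]

theorem capCodegree_sphNorth_sphLift {m : ℕ} (hm : 1 ≤ m) {p : ℝ} (hp0 : 0 < p) (hp1 : p ≤ 1)
    (z : ℝ) (w : Sph m) :
    capCodegree p (m + 1) (sphNorth m) (sphLift (z, w)) = slopeCodegree p m z := by
  rw [capCodegree_eq (by omega) hp0 hp1, slopeCodegree, measureReal_uniformSphere_succ hm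
    ((measurableSet_sphCap _ _).inter (measurableSet_sphCap _ _)),
    ← integral_indicator (measurableSet_slopeCap _)]
  congr 1
  refine integral_congr_ae (Eventually.of_forall fun z' => ?_)
  simp only [Set.mem_inter_iff, sphLift_mem_sphCap_sphNorth, sphLift_mem_sphCap_sphLift]
  by_cases h : z' ∈ slopeCap (tau p (m + 1))
  · simp only [h, true_and, Set.indicator_of_mem]
    exact measureReal_sphCap hm _ _
  · simp [h]

/-- Averages over a uniform `v` of a function of the edge and codegree kernels at `(u, v)` do not
depend on `u`, and they are averages over the slope of `v` relative to `u`. -/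
theorem integral_capKernel_capCodegree {m : ℕ} (hm : 1 ≤ m) {p : ℝ} (hp0 : 0 < p) (hp1 : p ≤ 1)
    {F : ℝ × ℝ → ℝ} (hF : Measurable F) (u : Sph (m + 1)) :
    ∫ v, F (capKernel p (m + 1) u v, capCodegree p (m + 1) u v) ∂uniformSphere (m + 1) =
      ∫ z, F ((slopeCap (tau p (m + 1))).indicator 1 z - p, slopeCodegree p m z) ∂slopeLaw m := by
  have := isProbabilityMeasure_uniformSphere hm
  have := isProbabilityMeasure_slopeLaw hm
  obtain ⟨R, rfl⟩ := exists_sphRot_eq (sphNorth m) u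
  rw [← integral_sphRot R]
  simp only [capKernel_sphRot, capCodegree_sphRot]
  rw [uniformSphere_succ hm, integral_map measurable_sphLift.aemeasurable]
  · have : ∀ q : ℝ × Sph m, F (capKernel p (m + 1) (sphNorth m) (sphLift q),
        capCodegree p (m + 1) (sphNorth m) (sphLift q)) =
        F ((slopeCap (tau p (m + 1))).indicator 1 q.1 - p, slopeCodegree p m q.1) := by
      rintro ⟨z, w⟩
      rw [capKernel_sphNorth_sphLift, capCodegree_sphNorth_sphLift hm hp0 hp1]
    simp_rw [this]
    rw [integral_fun_fst (μ := slopeLaw m) (ν := uniformSphere m)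
      (f := fun z => F ((slopeCap (tau p (m + 1))).indicator 1 z - p, slopeCodegree p m z))]
    simp
  · refine (hF.comp (Measurable.prodMk ?_ ?_)).aestronglyMeasurable
    · exact measurable_capKernel_comp measurable_const measurable_id
    · exact measurable_capCodegree_comp (by omega) measurable_const measurable_id

theorem measurable_slopeCodegree {m : ℕ} (hm : 1 ≤ m) (p : ℝ) : Measurable (slopeCodegree p m) := by
  have := isProbabilityMeasure_slopeLaw hm
  refine Measurable.sub_const ?_ _
  have h : Measurable fun x : ℝ × ℝ =>
      capProb m (tau p (m + 1) * slopeNorm x.1 * slopeNorm x.2 - x.1 * x.2) :=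
    (capProb_antitone m hm).measurable.comp (by fun_prop)
  exact (h.stronglyMeasurable.integral_prod_right'
    (ν := (slopeLaw m).restrict (slopeCap (tau p (m + 1))))).measurable

/-- The mean of a signed triangle is the same conditionally on each of its latent vectors. -/
theorem integral_capKernel_mul_capCodegree {d : ℕ} (hd : 2 ≤ d) {p : ℝ} (hp0 : 0 < p) (hp1 : p ≤ 1)
    (u : Sph d) :
    ∫ v, capKernel p d u v * capCodegree p d u v ∂uniformSphere d = triMean p d := by
  have := isProbabilityMeasure_uniformSphere (d := d) (by omega)
  obtain ⟨m, rfl⟩ : ∃ m, d = m + 1 := ⟨d - 1, by omega⟩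
  have h := integral_capKernel_capCodegree (m := m) (by omega) hp0 hp1
    (F := fun q => q.1 * q.2) (by fun_prop)
  unfold triMean
  simp only [h]
  simp

/-! ### Monotonicity of the codegree -/

theorem slopeNorm_sub_le (x y : ℝ) : |slopeNorm x - slopeNorm y| ≤ |x - y| := by
  have hx := slopeNorm_pos x
  have hy := slopeNorm_pos y
  refine abs_le_of_sq_le_sq' ?_ (abs_nonneg _) |> abs_le.2
  rw [sq_abs]
  have h1 : (1 + x * y) ≤ slopeNorm x * slopeNorm y := by
    refine le_of_sq_le_sq ?_ (by positivity)
    rw [mul_pow, slopeNorm_sq, slopeNorm_sq]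
    nlinarith [sq_nonneg (x - y)]
  nlinarith [slopeNorm_sq x, slopeNorm_sq y]

/-- The height of the cap through which a point of slope `z` in the cap and a point of another slope see
each other decreases with that other slope. -/
theorem threshold_antitone {t z z₁ z₂ : ℝ} (ht : 0 ≤ t) (hz : z ∈ slopeCap t) (h : z₁ ≤ z₂) :
    t * slopeNorm z₂ * slopeNorm z - z₂ * z ≤ t * slopeNorm z₁ * slopeNorm z - z₁ * z := by
  have hz : t * slopeNorm z ≤ z := hz
  have h1 : slopeNorm z₂ - slopeNorm z₁ ≤ z₂ - z₁ := by
    have := (abs_le.1 (slopeNorm_sub_le z₂ z₁)).2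
    rwa [abs_of_nonneg (by linarith)] at this
  have h2 := mul_le_mul_of_nonneg_left h1 (mul_nonneg ht (slopeNorm_pos z).le)
  have h3 := mul_le_mul_of_nonneg_right hz (sub_nonneg.2 h)
  nlinarith

theorem threshold_diag (t z : ℝ) :
    t * slopeNorm z * slopeNorm z - z * z = t - (1 - t) * z ^ 2 := by
  have := slopeNorm_sq z
  rw [mul_assoc, ← sq, this]; ring

/-- Two points of a cap see each other through a threshold at most `t`. -/
theorem threshold_le {t z z' : ℝ} (ht : 0 ≤ t) (ht1 : t ≤ 1) (hz : z ∈ slopeCap t)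
    (hz' : z' ∈ slopeCap t) : t * slopeNorm z * slopeNorm z' - z * z' ≤ t := by
  wlog h : z ≤ z' generalizing z z'
  · have := this hz' hz (le_of_not_ge h)
    linarith [mul_right_comm t (slopeNorm z) (slopeNorm z'), mul_comm z z']
  have h1 := threshold_antitone ht hz h
  rw [threshold_diag] at h1
  nlinarith [mul_nonneg (sub_nonneg.2 ht1) (sq_nonneg z), mul_right_comm t (slopeNorm z) (slopeNorm z')]

theorem slopeCap_mem_of_le {t z z' : ℝ} (ht : 0 ≤ t) (ht1 : t ≤ 1) (hz : z ∈ slopeCap t)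
    (h : z ≤ z') : z' ∈ slopeCap t := by
  have hz : t * slopeNorm z ≤ z := hz
  change t * slopeNorm z' ≤ z'
  have h1 : slopeNorm z' - slopeNorm z ≤ z' - z := by
    have := (abs_le.1 (slopeNorm_sub_le z' z)).2
    rwa [abs_of_nonneg (by linarith)] at this
  nlinarith [mul_le_mul_of_nonneg_left h1 ht, mul_nonneg (sub_nonneg.2 ht1) (sub_nonneg.2 h)]

theorem half_le_capProb_zero {d : ℕ} (hd : 1 ≤ d) : 1 / 2 ≤ capProb d 0 := by
  have := isProbabilityMeasure_uniformSphere hd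
  obtain ⟨m, rfl⟩ : ∃ m, d = m + 1 := ⟨d - 1, by omega⟩
  set u := sphNorth m
  have h1 : (uniformSphere (m + 1)).real (sphCap 0 u)ᶜ ≤ (uniformSphere (m + 1)).real (sphCap 0 u) := by
    rw [← (measurePreserving_sphRot (LinearIsometryEquiv.neg ℝ)).measureReal_preimage
      (measurableSet_sphCap 0 u).nullMeasurableSet]
    refine measureReal_mono fun v hv => ?_
    simp only [sphCap, Set.mem_compl_iff, Set.mem_ofPred_eq, not_le, Set.mem_preimage, coe_sphRot] at hv ⊢
    simp
    exact hv.le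
  rw [probReal_compl_eq_one_sub (measurableSet_sphCap 0 u), measureReal_sphCap hd] at h1
  linarith

/-- In dimension at least `2` a cap of height `1` is a null set. -/
theorem capProb_one {d : ℕ} (hd : 2 ≤ d) : capProb d 1 = 0 := by
  obtain ⟨m, rfl⟩ : ∃ m, d = m + 1 := ⟨d - 1, by omega⟩
  rw [capProb_succ (by omega)]
  have : slopeCap 1 = ∅ := by
    refine Set.eq_empty_of_forall_notMem fun z hz => ?_
    have hz : 1 * slopeNorm z ≤ z := hz
    nlinarith [slopeNorm_sq z, one_le_slopeNorm z]
  simp [this]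

theorem tau_lt_one {d : ℕ} (hd : 2 ≤ d) {p : ℝ} (hp0 : 0 < p) (hp1 : p ≤ 1) : tau p d < 1 := by
  by_contra! h
  have h1 := capProb_antitone d (by omega) h
  rw [capProb_tau hd hp0 hp1, capProb_one hd] at h1
  linarith

theorem tau_nonneg {d : ℕ} (hd : 2 ≤ d) {p : ℝ} (hp0 : 0 < p) (hp : p ≤ 1 / 2) : 0 ≤ tau p d := by
  by_contra! h
  refine notMem_of_csSup_lt h ⟨1, ?_⟩ (hp.trans (half_le_capProb_zero (by omega)))
  intro t ht
  by_contra! h1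
  have h2 := capProb_antitone d (by omega) h1.le
  rw [capProb_one hd] at h2
  have : p ≤ capProb d t := ht
  linarith

theorem tau_antitone {d : ℕ} (hd : 2 ≤ d) {p q : ℝ} (hp0 : 0 < p) (hpq : p ≤ q) (hq : q ≤ 1) :
    tau q d ≤ tau p d := by
  by_contra! h
  have h1 := capProb_antitone d (by omega) h.le
  rw [capProb_tau hd hp0 (hpq.trans hq), capProb_tau hd (hp0.trans_le hpq) hq] at h1
  obtain rfl : p = q := le_antisymm hpq h1
  exact lt_irrefl _ h

/-- A threshold at most `τ(p, m + 1)` is exceeded with probability at least `p` in dimension `m`. -/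
theorem le_capProb_of_le_tau {m : ℕ} (hm : 1 ≤ m) {p : ℝ} (hp0 : 0 < p) (hp : p ≤ 1 / 2) {t : ℝ}
    (ht : t ≤ tau p (m + 1)) : p ≤ capProb m t :=
  calc p = capProb (m + 1) (tau p (m + 1)) :=
        (capProb_tau (by omega) hp0 (by linarith)).symm
    _ ≤ capProb m (tau p (m + 1)) := capProb_succ_le hm (tau_nonneg (by omega) hp0 hp)
    _ ≤ capProb m t := capProb_antitone m hm ht

theorem integrable_capProb_comp {m : ℕ} (hm : 1 ≤ m) {f : ℝ → ℝ} (hf : Measurable f)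
    (μ : Measure ℝ) [IsFiniteMeasure μ] : Integrable (fun z => capProb m (f z)) μ := by
  refine Integrable.of_bound (C := 1) ?_ (Eventually.of_forall fun z => ?_)
  · exact ((capProb_antitone m hm).measurable.comp hf).aestronglyMeasurable
  · rw [Real.norm_of_nonneg (capProb_nonneg m _)]
    exact capProb_le_one m hm _

theorem measureReal_slopeCap_tau {m : ℕ} (hm : 1 ≤ m) {p : ℝ} (hp0 : 0 < p) (hp1 : p ≤ 1) :
    (slopeLaw m).real (slopeCap (tau p (m + 1))) = p := by
  rw [← capProb_succ hm, capProb_tau (by omega) hp0 hp1]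

theorem slopeCodegree_nonneg {m : ℕ} (hm : 1 ≤ m) {p : ℝ} (hp0 : 0 < p) (hp : p ≤ 1 / 2) {z : ℝ}
    (hz : z ∈ slopeCap (tau p (m + 1))) : 0 ≤ slopeCodegree p m z := by
  have := isProbabilityMeasure_slopeLaw hm
  have h0 := tau_nonneg (d := m + 1) (by omega) hp0 hp
  have h1 := (tau_lt_one (d := m + 1) (by omega) hp0 (by linarith)).le
  have h : ∫ z' in slopeCap (tau p (m + 1)), p ∂slopeLaw m ≤
      ∫ z' in slopeCap (tau p (m + 1)),
        capProb m (tau p (m + 1) * slopeNorm z * slopeNorm z' - z * z') ∂slopeLaw m := by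
    refine setIntegral_mono_on (integrable_const _) (integrable_capProb_comp hm (by fun_prop) _)
      (measurableSet_slopeCap _) fun z' hz' => ?_
    exact le_capProb_of_le_tau hm hp0 hp (threshold_le h0 h1 hz hz')
  rw [setIntegral_const, measureReal_slopeCap_tau hm hp0 (by linarith), smul_eq_mul] at h
  rw [slopeCodegree]
  linarith [sq p]

theorem slopeCodegree_monotone {m : ℕ} (hm : 1 ≤ m) {p : ℝ} (hp0 : 0 < p) (hp : p ≤ 1 / 2) :
    Monotone (slopeCodegree p m) := by
  have := isProbabilityMeasure_slopeLaw hm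
  intro z₁ z₂ h
  have h0 := tau_nonneg (d := m + 1) (by omega) hp0 hp
  refine sub_le_sub_right ?_ _
  refine setIntegral_mono_on (integrable_capProb_comp hm (by fun_prop) _)
    (integrable_capProb_comp hm (by fun_prop) _) (measurableSet_slopeCap _) fun z' hz' => ?_
  exact capProb_antitone m hm (threshold_antitone h0 hz' h)

theorem abs_slopeCodegree_le {m : ℕ} (hm : 1 ≤ m) {p : ℝ} (hp0 : 0 < p) (hp1 : p ≤ 1) (z : ℝ) :
    |slopeCodegree p m z| ≤ p := by
  have := isProbabilityMeasure_uniformSphere hm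
  obtain ⟨w⟩ : Nonempty (Sph m) := (uniformSphere m).nonempty_of_neZero
  rw [← capCodegree_sphNorth_sphLift hm hp0 hp1 z w]
  exact abs_capCodegree_le (by omega) hp0 hp1 _ _

/-- If `H` has mean zero, is nonnegative on a set `Z` of measure `p`, where it exceeds its values off
`Z`, and is bounded by `p`, then its second moment is controlled by its integral over `Z`: the
positive part of `H` off `Z` is at most the average of `H` over `Z`, and `∫ |H| = 2 ∫ H⁺`. -/
theorem integral_sq_mul_sq_le {α : Type*} [MeasurableSpace α] (ν : Measure α)
    [IsProbabilityMeasure ν] {Z : Set α} (hZ : MeasurableSet Z) {H : α → ℝ} (hH : Measurable H)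
    {p : ℝ} (hp0 : 0 < p) (hp1 : p ≤ 1) (hνZ : ν.real Z = p) (hb : ∀ z, |H z| ≤ p)
    (h0 : ∫ z, H z ∂ν = 0) (hpos : ∀ z ∈ Z, 0 ≤ H z) (hle : ∀ z ∉ Z, ∀ z' ∈ Z, H z ≤ H z') :
    ∫ z, (Z.indicator 1 z - p) ^ 2 * H z ^ 2 ∂ν ≤ 5 * p * ∫ z, (Z.indicator 1 z - p) * H z ∂ν := by
  have hHi : Integrable H ν :=
    Integrable.of_bound hH.aestronglyMeasurable p (Eventually.of_forall hb)
  have hind : ∀ z, Z.indicator (1 : α → ℝ) z * H z = Z.indicator H z := fun z => by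
    by_cases h : z ∈ Z <;> simp [h]
  set M := ∫ z in Z, H z ∂ν with hM
  have hM1 : ∫ z, (Z.indicator 1 z - p) * H z ∂ν = M := by
    simp_rw [sub_mul, hind]
    rw [integral_sub (hHi.indicator hZ) (hHi.const_mul p), integral_indicator hZ,
      integral_const_mul, h0, mul_zero, sub_zero]
  have hM0 : 0 ≤ M := setIntegral_nonneg hZ hpos
  have hoff : ∀ z ∉ Z, H z ≤ M / p := fun z hz => by
    rw [le_div_iff₀ hp0]
    have h : ∫ z' in Z, H z ∂ν ≤ M :=
      setIntegral_mono_on (integrable_const _) hHi.integrableOn hZ (hle z hz)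
    rwa [setIntegral_const, hνZ, smul_eq_mul, mul_comm] at h
  -- pointwise, `|H| ≤ 2 H⁺ - H` and `H⁺ ≤ M / p + 1_Z H`
  have hpt : ∀ z, |H z| ≤ 2 * (M / p) + 2 * Z.indicator H z - H z := fun z => by
    have hMp : 0 ≤ M / p := by positivity
    by_cases h : z ∈ Z
    · rw [Set.indicator_of_mem h, abs_of_nonneg (hpos z h)]; linarith [hpos z h]
    · rw [Set.indicator_of_notMem h, abs_le]
      constructor <;> linarith [hoff z h]
  have hpt2 : ∀ z, (Z.indicator 1 z - p) ^ 2 * H z ^ 2 ≤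
      p ^ 3 * (2 * (M / p) + 2 * Z.indicator H z - H z) + p * Z.indicator H z := fun z => by
    have h1 : H z ^ 2 ≤ p * |H z| := by
      rw [← sq_abs, sq]; exact mul_le_mul_of_nonneg_right (hb z) (abs_nonneg _)
    have h2 := mul_le_mul_of_nonneg_left (hpt z) (by positivity : 0 ≤ p ^ 3)
    by_cases h : z ∈ Z
    · rw [abs_of_nonneg (hpos z h)] at h1
      have h3 : (1 - p) ^ 2 ≤ 1 := by nlinarith
      have h4 := mul_le_mul h3 h1 (sq_nonneg _) zero_le_one
      have h5 : 0 ≤ p ^ 3 * |H z| := by positivity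
      simp only [Set.indicator_of_mem h, Pi.one_apply] at h2 ⊢
      linarith
    · have h4 := mul_le_mul_of_nonneg_left h1 (sq_nonneg p)
      simp only [Set.indicator_of_notMem h] at h2 ⊢
      nlinarith
  rw [hM1]
  have hind' := hHi.indicator hZ
  have i1 : Integrable (fun z => 2 * (M / p) + 2 * Z.indicator H z) ν :=
    (integrable_const _).add (hind'.const_mul 2)
  have i2 : Integrable (fun z => 2 * (M / p) + 2 * Z.indicator H z - H z) ν := i1.sub hHi
  calc _ ≤ ∫ z, (p ^ 3 * (2 * (M / p) + 2 * Z.indicator H z - H z) + p * Z.indicator H z) ∂ν :=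
        integral_mono_of_nonneg (Eventually.of_forall fun z => by positivity)
          ((i2.const_mul _).add (hind'.const_mul p)) (Eventually.of_forall hpt2)
    _ = p ^ 3 * (2 * (M / p) + 2 * M) + p * M := by
        rw [integral_add (i2.const_mul _) (hind'.const_mul p), integral_const_mul,
          integral_const_mul, integral_sub i1 hHi, integral_add (integrable_const _)
          (hind'.const_mul 2), integral_const_mul, integral_const_mul, integral_indicator hZ, h0]
        simp [hM]
    _ ≤ 5 * p * M := by
        have : p ^ 3 * (2 * (M / p) + 2 * M) = p * M * (2 * p + 2 * p ^ 2) := by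
          field_simp
        rw [this]
        have h1 : 0 ≤ p * M := by positivity
        have h2 : 2 * p + 2 * p ^ 2 ≤ 4 := by nlinarith
        linarith [mul_le_mul_of_nonneg_left h2 h1]

/-- The second moment of the codegree, weighted by the squared edge kernel. -/
theorem integral_capKernel_sq_mul_capCodegree_sq_le {d : ℕ} (hd : 2 ≤ d) {p : ℝ} (hp0 : 0 < p)
    (hp : p ≤ 1 / 2) (u : Sph d) :
    ∫ v, capKernel p d u v ^ 2 * capCodegree p d u v ^ 2 ∂uniformSphere d ≤ 5 * p * triMean p d := by
  obtain ⟨m, rfl⟩ : ∃ m, d = m + 1 := ⟨d - 1, by omega⟩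
  have hm : 1 ≤ m := by omega
  have hp1 : p ≤ 1 := by linarith
  have := isProbabilityMeasure_slopeLaw hm
  rw [← integral_capKernel_mul_capCodegree hd hp0 hp1 u,
    integral_capKernel_capCodegree hm hp0 hp1 (F := fun q => q.1 ^ 2 * q.2 ^ 2) (by fun_prop) u,
    integral_capKernel_capCodegree hm hp0 hp1 (F := fun q => q.1 * q.2) (by fun_prop) u]
  have h0 := tau_nonneg hd hp0 hp
  have h1 := (tau_lt_one hd hp0 hp1).le
  refine integral_sq_mul_sq_le _ (measurableSet_slopeCap _) (measurable_slopeCodegree hm p) hp0 hp1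
    (measureReal_slopeCap_tau hm hp0 hp1) (abs_slopeCodegree_le hm hp0 hp1) ?_
    (fun z hz => slopeCodegree_nonneg hm hp0 hp hz) (fun z hz z' hz' => ?_)
  · have h := integral_capKernel_capCodegree hm hp0 hp1 (F := fun q => q.2) (by fun_prop) u
    rw [integral_capCodegree hd hp0 hp1] at h
    exact h.symm
  · refine slopeCodegree_monotone hm hp0 hp ?_
    by_contra! h
    exact hz (slopeCap_mem_of_le h0 h1 hz' h.le)

/-! ### Estimates for the slope density -/

/-- The normalizing constant of the slope density. -/
noncomputable def slopeMass (m : ℕ) : ℝ := (slopeWeight m Set.univ).toReal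

theorem slopeDensity_pos (m : ℕ) (z : ℝ) : 0 < slopeDensity m z :=
  pow_pos (inv_pos.2 (slopeNorm_pos z)) _

theorem slopeDensity_le_one (m : ℕ) (z : ℝ) : slopeDensity m z ≤ 1 :=
  pow_le_one₀ (inv_pos.2 (slopeNorm_pos z)).le (inv_le_one_of_one_le₀ (one_le_slopeNorm z))

theorem integrable_slopeDensity {m : ℕ} (hm : 1 ≤ m) : Integrable (slopeDensity m) := by
  refine ⟨(measurable_slopeDensity m).aestronglyMeasurable, ?_⟩
  rw [hasFiniteIntegral_iff_ofReal (Eventually.of_forall fun z => (slopeDensity_pos m z).le)]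
  have h := slopeWeight_univ_ne_top hm
  rw [slopeWeight, withDensity_apply _ .univ, Measure.restrict_univ] at h
  exact lt_top_iff_ne_top.2 h

theorem slopeMass_eq {m : ℕ} : slopeMass m = ∫ z, slopeDensity m z := by
  rw [integral_eq_lintegral_of_nonneg_ae (Eventually.of_forall fun z => (slopeDensity_pos m z).le)
    (measurable_slopeDensity m).aestronglyMeasurable, slopeMass, slopeWeight,
    withDensity_apply _ .univ, Measure.restrict_univ]

theorem slopeMass_pos {m : ℕ} (hm : 1 ≤ m) : 0 < slopeMass m :=
  ENNReal.toReal_pos (slopeWeight_univ_ne_zero hm) (slopeWeight_univ_ne_top hm)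

theorem measureReal_slopeLaw_mul {m : ℕ} (hm : 1 ≤ m) {A : Set ℝ} (hA : MeasurableSet A) :
    (slopeLaw m).real A * slopeMass m = ∫ z in A, slopeDensity m z := by
  rw [integral_eq_lintegral_of_nonneg_ae (Eventually.of_forall fun z => (slopeDensity_pos m z).le)
    (measurable_slopeDensity m).aestronglyMeasurable, slopeMass, measureReal_def, slopeLaw,
    Measure.smul_apply, smul_eq_mul, ENNReal.toReal_mul, ENNReal.toReal_inv, mul_right_comm,
    inv_mul_cancel₀ (show (slopeWeight m Set.univ).toReal ≠ 0 from (slopeMass_pos hm).ne'), one_mul]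
  rw [slopeWeight, withDensity_apply _ hA]

theorem exp_le_slopeDensity (m : ℕ) (z : ℝ) :
    Real.exp (-((m + 1 : ℕ) * z ^ 2 / 2)) ≤ slopeDensity m z := by
  have h : Real.exp (-(z ^ 2 / 2)) ≤ (slopeNorm z)⁻¹ := by
    rw [Real.exp_neg]
    refine inv_anti₀ (slopeNorm_pos z) ?_
    rw [slopeNorm, Real.sqrt_le_left (Real.exp_pos _).le, ← Real.exp_nat_mul]
    have := Real.add_one_le_exp (z ^ 2)
    push_cast
    rw [show (2 : ℝ) * (z ^ 2 / 2) = z ^ 2 by ring]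
    linarith
  calc _ = Real.exp (-(z ^ 2 / 2)) ^ (m + 1) := by
        rw [← Real.exp_nat_mul]; congr 1; ring
    _ ≤ _ := pow_le_pow_left₀ (Real.exp_pos _).le h _

theorem slopeDensity_le_of_abs_le {m : ℕ} {x z : ℝ} (h : |z| ≤ x) :
    slopeDensity m x ≤ slopeDensity m z := by
  refine pow_le_pow_left₀ (inv_pos.2 (slopeNorm_pos x)).le ?_ _
  refine inv_anti₀ (slopeNorm_pos z) (Real.sqrt_le_sqrt ?_)
  have := pow_le_pow_left₀ (abs_nonneg z) h 2
  rw [sq_abs] at this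
  linarith

theorem le_measureReal_slopeLaw_Ico {m : ℕ} (hm : 1 ≤ m) {a b c : ℝ} (hab : a ≤ b)
    (h : ∀ z ∈ Set.Ico a b, c ≤ slopeDensity m z) :
    (b - a) * c ≤ (slopeLaw m).real (Set.Ico a b) * slopeMass m := by
  rw [measureReal_slopeLaw_mul hm measurableSet_Ico]
  have h1 : ∫ z in Set.Ico a b, c ≤ ∫ z in Set.Ico a b, slopeDensity m z :=
    setIntegral_mono_on (integrable_const _) (integrable_slopeDensity hm).integrableOn
      measurableSet_Ico h
  rwa [setIntegral_const, smul_eq_mul, Real.volume_real_Ico_of_le hab] at h1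

theorem inv_sqrt_le_slopeMass {m : ℕ} (hm : 1 ≤ m) : (√((m + 1 : ℕ) : ℝ))⁻¹ ≤ slopeMass m := by
  have := isProbabilityMeasure_slopeLaw hm
  set d : ℝ := ((m + 1 : ℕ) : ℝ) with hd
  have hd0 : 0 < d := by positivity
  set x := (√d)⁻¹ with hx
  have hx0 : 0 < x := by positivity
  have hx2 : d * x ^ 2 = 1 := by
    rw [hx, inv_pow, Real.sq_sqrt hd0.le, mul_inv_cancel₀ hd0.ne']
  have h := le_measureReal_slopeLaw_Ico hm (a := -x) (b := x) (c := 1 / 2) (by linarith) ?_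
  · have h2 : (slopeLaw m).real (Set.Ico (-x) x) * slopeMass m ≤ 1 * slopeMass m :=
      mul_le_mul_of_nonneg_right measureReal_le_one (slopeMass_pos hm).le
    linarith
  · intro z hz
    have h1 : slopeDensity m x ≤ slopeDensity m z :=
      slopeDensity_le_of_abs_le (abs_le.2 ⟨hz.1, hz.2.le⟩)
    refine le_trans ?_ ((exp_le_slopeDensity m x).trans h1)
    rw [← hd, hx2]
    have := Real.add_one_le_exp (-(1 / 2 : ℝ))
    linarith

theorem slopeMass_le {m : ℕ} (hm : 1 ≤ m) :
    slopeMass m ≤ Real.pi * √2 * (√((m + 1 : ℕ) : ℝ))⁻¹ := by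
  set d : ℝ := ((m + 1 : ℕ) : ℝ) with hd
  have hd2 : 2 ≤ d := by rw [hd]; exact_mod_cast (by omega : 2 ≤ m + 1)
  set c := √d / √2 with hc
  have hc0 : 0 < c := by positivity
  have hc2 : c ^ 2 = d / 2 := by
    rw [hc, div_pow, Real.sq_sqrt (by linarith), Real.sq_sqrt (by norm_num)]
  have hpt : ∀ z, slopeDensity m z ≤ (1 + (c * z) ^ 2)⁻¹ := fun z => by
    have h1 : 1 + (c * z) ^ 2 ≤ slopeNorm z ^ (m + 1) := by
      have h2 := one_add_mul_self_le_rpow_one_add (s := z ^ 2) (by nlinarith [sq_nonneg z])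
        (p := d / 2) (by linarith)
      rw [mul_pow, hc2]
      refine h2.trans_eq ?_
      rw [slopeNorm, Real.sqrt_eq_rpow, ← Real.rpow_natCast _ (m + 1),
        ← Real.rpow_mul (by positivity), ← hd]
      congr 1
      ring
    rw [slopeDensity, inv_pow]
    exact inv_anti₀ (by positivity) h1
  rw [slopeMass_eq]
  calc ∫ z, slopeDensity m z ≤ ∫ z : ℝ, (1 + (c * z) ^ 2)⁻¹ :=
        integral_mono (integrable_slopeDensity hm)
          (integrable_inv_one_add_sq.comp_mul_left' hc0.ne') hpt
    _ = Real.pi * √2 * (√d)⁻¹ := by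
        rw [Measure.integral_comp_mul_left (fun z : ℝ => (1 + z ^ 2)⁻¹), integral_univ_inv_one_add_sq,
          abs_of_pos (by positivity), hc, smul_eq_mul]
        field_simp

theorem hasDerivAt_inv_slopeNorm_pow (j : ℕ) (z : ℝ) :
    HasDerivAt (fun z => -((slopeNorm z)⁻¹ ^ (j + 1)) / (j + 1)) (z * (slopeNorm z)⁻¹ ^ (j + 3)) z := by
  have h1 : HasDerivAt (fun z : ℝ => 1 + z ^ 2) (2 * z) z := by
    simpa using (hasDerivAt_pow 2 z).const_add 1
  have h2 : HasDerivAt slopeNorm (2 * z / (2 * slopeNorm z)) z := h1.sqrt (by positivity)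
  have h0 := (slopeNorm_pos z).ne'
  have h3 := (((h2.inv h0).pow (j + 1)).neg).div_const ((j : ℝ) + 1)
  refine h3.congr_deriv ?_
  have : (j : ℝ) + 1 ≠ 0 := by positivity
  simp only [Pi.inv_apply, Nat.add_sub_cancel, Nat.cast_add, Nat.cast_one, inv_pow]
  field_simp
  ring

/-- An upper bound for the tails of the slope, of the order of the density over the slope. -/
theorem measureReal_slopeLaw_Ici_le {j : ℕ} {x : ℝ} (hx : 0 < x) :
    (slopeLaw (j + 2)).real (Set.Ici x) * slopeMass (j + 2) ≤
      (slopeNorm x)⁻¹ ^ (j + 1) / ((j + 1) * x) := by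
  have hpos : ∀ z ∈ Set.Ioi x, 0 ≤ z * (slopeNorm z)⁻¹ ^ (j + 3) := fun z hz =>
    mul_nonneg (hx.trans hz).le (pow_pos (inv_pos.2 (slopeNorm_pos z)) _).le
  have hlim : Tendsto (fun z => -((slopeNorm z)⁻¹ ^ (j + 1)) / ((j : ℝ) + 1)) atTop (𝓝 0) := by
    have h1 : Tendsto slopeNorm atTop atTop := by
      refine tendsto_atTop_mono (fun z => ?_) tendsto_id
      refine Real.le_sqrt_of_sq_le ?_
      simp
    have h2 := ((tendsto_inv_atTop_zero.comp h1).pow (j + 1)).neg.div_const ((j : ℝ) + 1)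
    simpa using h2
  have hd := fun z (_ : z ∈ Set.Ici x) => hasDerivAt_inv_slopeNorm_pow j z
  have h1 := integral_Ioi_of_hasDerivAt_of_nonneg' hd hpos hlim
  have h2 := integrableOn_Ioi_deriv_of_nonneg' hd hpos hlim
  rw [measureReal_slopeLaw_mul (by omega) measurableSet_Ici, integral_Ici_eq_integral_Ioi]
  calc ∫ z in Set.Ioi x, slopeDensity (j + 2) z
      ≤ ∫ z in Set.Ioi x, x⁻¹ * (z * (slopeNorm z)⁻¹ ^ (j + 3)) := by
        refine setIntegral_mono_on (integrable_slopeDensity (by omega)).integrableOn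
          (h2.const_mul _) measurableSet_Ioi fun z hz => ?_
        have hz : x < z := hz
        rw [← mul_assoc, slopeDensity]
        refine le_mul_of_one_le_left (pow_pos (inv_pos.2 (slopeNorm_pos z)) _).le ?_
        rw [inv_mul_eq_div, one_le_div hx]
        exact hz.le
    _ = _ := by
        rw [integral_const_mul, h1]
        field_simp
        ring

/-- A lower bound for the tails of the slope. -/
theorem exp_le_measureReal_slopeLaw_Ici {m : ℕ} (hm : 1 ≤ m) {x : ℝ} (hx : 0 ≤ x) :
    Real.exp (-((m + 1 : ℕ) * x ^ 2)) / 13 ≤ (slopeLaw m).real (Set.Ici x) := by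
  have := isProbabilityMeasure_slopeLaw hm
  have hZ := slopeMass_le hm
  set d : ℝ := ((m + 1 : ℕ) : ℝ) with hd
  have hd0 : 0 < d := by positivity
  set e := (√d)⁻¹ with he
  have he0 : 0 < e := by positivity
  have he2 : d * e ^ 2 = 1 := by
    rw [he, inv_pow, Real.sq_sqrt hd0.le, mul_inv_cancel₀ hd0.ne']
  have h := le_measureReal_slopeLaw_Ico hm (a := x) (b := x + e)
    (c := Real.exp (-(d * x ^ 2)) * Real.exp (-1)) (by linarith) ?_
  · have hmono : (slopeLaw m).real (Set.Ico x (x + e)) ≤ (slopeLaw m).real (Set.Ici x) :=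
      measureReal_mono Set.Ico_subset_Ici_self
    have hP : 0 ≤ (slopeLaw m).real (Set.Ico x (x + e)) := measureReal_nonneg
    have h1 := h.trans (mul_le_mul_of_nonneg_left hZ hP)
    rw [add_sub_cancel_left] at h1
    have h2 : Real.exp (-(d * x ^ 2)) * Real.exp (-1) ≤
        (slopeLaw m).real (Set.Ico x (x + e)) * (Real.pi * √2) := by
      refine le_of_mul_le_mul_left ?_ he0
      calc _ ≤ _ := h1
        _ = _ := by ring
    have h3 : Real.pi * √2 * Real.exp 1 ≤ 13 := by
      have a1 := Real.pi_lt_d2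
      have a2 := Real.exp_one_lt_d9
      have a3 : √2 ≤ 1.4143 := by
        rw [Real.sqrt_le_left (by norm_num)]; norm_num
      have a4 : Real.pi * √2 ≤ 3.15 * 1.4143 :=
        mul_le_mul a1.le a3 (Real.sqrt_nonneg _) (by norm_num)
      calc _ ≤ 3.15 * 1.4143 * 2.7182818286 :=
            mul_le_mul a4 a2.le (Real.exp_pos _).le (by norm_num)
        _ ≤ 13 := by norm_num
    rw [div_le_iff₀ (by norm_num)]
    rw [Real.exp_neg 1, ← div_eq_mul_inv, div_le_iff₀ (Real.exp_pos 1)] at h2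
    calc _ ≤ _ := h2
      _ = (slopeLaw m).real (Set.Ico x (x + e)) * (Real.pi * √2 * Real.exp 1) := by ring
      _ ≤ _ := mul_le_mul hmono h3 (by positivity) measureReal_nonneg
  · intro z hz
    have hz0 : 0 ≤ z := hx.trans hz.1
    refine le_trans ?_ (exp_le_slopeDensity m z)
    rw [← Real.exp_add, ← hd, Real.exp_le_exp]
    have h1 : z ^ 2 ≤ (x + e) ^ 2 := pow_le_pow_left₀ hz0 hz.2.le 2
    have h2 := mul_le_mul_of_nonneg_left h1 hd0.le
    nlinarith [mul_nonneg hd0.le (sq_nonneg (x - e))]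

theorem slopeCap_zero : slopeCap 0 = Set.Ici 0 := by
  ext z; simp [slopeCap]

/-- The slope concentrates on scale `1 / √(m + 1)` at most. -/
theorem half_sub_le_measureReal_slopeLaw_Ici {m : ℕ} (hm : 1 ≤ m) {x : ℝ} (hx : 0 ≤ x) :
    1 / 2 - x * √((m + 1 : ℕ) : ℝ) ≤ (slopeLaw m).real (Set.Ici x) := by
  have := isProbabilityMeasure_slopeLaw hm
  have h1 := half_le_capProb_zero (d := m + 1) (by omega)
  rw [capProb_succ hm, slopeCap_zero, ← Set.Ico_union_Ici_eq_Ici hx] at h1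
  have h2 := h1.trans (measureReal_union_le _ _)
  have h3 : (slopeLaw m).real (Set.Ico 0 x) * slopeMass m ≤ x := by
    rw [measureReal_slopeLaw_mul hm measurableSet_Ico]
    calc _ ≤ ∫ z in Set.Ico 0 x, (1 : ℝ) :=
          setIntegral_mono_on (integrable_slopeDensity hm).integrableOn (integrable_const _)
            measurableSet_Ico fun z _ => slopeDensity_le_one m z
      _ = x := by simp [hx]
  have h4 := mul_le_mul_of_nonneg_left (inv_sqrt_le_slopeMass hm)
    (measureReal_nonneg (μ := slopeLaw m) (s := Set.Ico 0 x))
  have h5 := h4.trans h3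
  rw [← div_eq_mul_inv, div_le_iff₀ (by positivity)] at h5
  linarith

/-- The smallest slope of the points of a cap of height `t`. -/
noncomputable def capSlope (t : ℝ) : ℝ := t / √(1 - t ^ 2)

theorem capSlope_nonneg {t : ℝ} (ht : 0 ≤ t) : 0 ≤ capSlope t := by
  unfold capSlope; positivity

theorem mul_slopeNorm_capSlope {t : ℝ} (ht : 0 ≤ t) (ht1 : t < 1) :
    t * slopeNorm (capSlope t) = capSlope t := by
  have h : 0 < 1 - t ^ 2 := by nlinarith
  have h1 : slopeNorm (capSlope t) = (√(1 - t ^ 2))⁻¹ := by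
    rw [slopeNorm, capSlope, div_pow, Real.sq_sqrt h.le, ← Real.sqrt_inv]
    congr 1
    field_simp
    ring
  rw [h1, capSlope, div_eq_mul_inv]

theorem le_capSlope {t : ℝ} (ht : 0 ≤ t) (ht1 : t < 1) : t ≤ capSlope t := by
  have := mul_slopeNorm_capSlope ht ht1
  nlinarith [one_le_slopeNorm (capSlope t)]

theorem slopeCap_eq_Ici {t : ℝ} (ht : 0 ≤ t) (ht1 : t < 1) :
    slopeCap t = Set.Ici (capSlope t) := by
  have h0 := mul_slopeNorm_capSlope ht ht1
  ext z
  constructor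
  · intro hz
    by_contra! h
    have hz : t * slopeNorm z ≤ z := hz
    have h : z < capSlope t := by simpa using h
    have h1 : slopeNorm (capSlope t) - slopeNorm z ≤ capSlope t - z := by
      have := (abs_le.1 (slopeNorm_sub_le (capSlope t) z)).2
      rwa [abs_of_nonneg (by linarith)] at this
    nlinarith [mul_le_mul_of_nonneg_left h1 ht, mul_pos (sub_pos.2 ht1) (sub_pos.2 h)]
  · intro hz
    exact slopeCap_mem_of_le ht ht1.le (z := capSlope t) h0.le hz

theorem capSlope_mono {s t : ℝ} (hs : 0 ≤ s) (hst : s ≤ t) (ht1 : t < 1) :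
    capSlope s ≤ capSlope t := by
  have h : capSlope t ∈ slopeCap s := by
    have h1 := mul_slopeNorm_capSlope (hs.trans hst) ht1
    change s * _ ≤ _
    nlinarith [mul_le_mul_of_nonneg_right hst (slopeNorm_pos (capSlope t)).le]
  rwa [slopeCap_eq_Ici hs (hst.trans_lt ht1)] at h

/-- Lowering the height of a cap by `δ` moves its smallest slope by at least `δ`, because
`z ↦ z / √(1 + z²)` is a contraction. -/
theorem Ico_subset_slopeCap_sub {t δ : ℝ} (ht : 0 ≤ t) (ht1 : t < 1) :
    Set.Ico (capSlope t - δ) (capSlope t) ⊆ slopeCap (t - δ) := by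
  intro z hz
  have h0 := mul_slopeNorm_capSlope ht ht1
  set ζ := capSlope t
  have hζ0 : 0 ≤ ζ := capSlope_nonneg ht
  have hz1 := slopeNorm_pos z
  change (t - δ) * slopeNorm z ≤ z
  obtain ⟨h1, h2⟩ := hz
  rcases le_or_gt 0 z with hz0 | hz0
  · have h3 : slopeNorm z ≤ slopeNorm ζ := Real.sqrt_le_sqrt (by nlinarith)
    have h4 : 0 ≤ δ := by linarith
    nlinarith [mul_le_mul_of_nonneg_left h3 ht, mul_le_mul_of_nonneg_left (one_le_slopeNorm z) h4]
  · have h3 : t ≤ ζ := le_capSlope ht ht1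
    have h4 : t - δ ≤ z := by linarith
    nlinarith [mul_le_mul_of_nonneg_right h4 hz1.le, one_le_slopeNorm z]

/-! ### The lower bound for the mean of a signed triangle -/

theorem measureReal_slopeLaw_Ici_capSlope_tau {m : ℕ} (hm : 1 ≤ m) {q : ℝ} (hq0 : 0 < q)
    (hq : q ≤ 1 / 2) : (slopeLaw m).real (Set.Ici (capSlope (tau q (m + 1)))) = q := by
  rw [← slopeCap_eq_Ici (tau_nonneg (by omega) hq0 hq) (tau_lt_one (by omega) hq0 (by linarith)),
    measureReal_slopeCap_tau hm hq0 (by linarith)]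

/-- The quantiles of the slope are at most `1 / 2` when the level is not too small: the tail beyond `1 / 2`
has mass at most `exp (-(d - 2) / 10)`, which is less than `p / 2`. -/
theorem capSlope_tau_le_half {d : ℕ} (hd : 20 ≤ d) {p : ℝ} (hp0 : 0 < p) (hp : p ≤ 1 / 2)
    (hL : Real.log (1 / p) ≤ d / 40) : capSlope (tau (p / 2) d) ≤ 1 / 2 := by
  obtain ⟨j, rfl⟩ : ∃ j, d = j + 2 + 1 := ⟨d - 3, by omega⟩
  have := isProbabilityMeasure_slopeLaw (m := j + 2) (by omega)
  have hj : (17 : ℝ) ≤ j := by exact_mod_cast (by omega : 17 ≤ j)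
  by_contra! hlt
  have h1 := measureReal_slopeLaw_Ici_capSlope_tau (m := j + 2) (by omega) (q := p / 2)
    (by linarith) (by linarith)
  have h2 : p / 2 ≤ (slopeLaw (j + 2)).real (Set.Ici (1 / 2)) := by
    rw [← h1]
    exact measureReal_mono (Set.Ici_subset_Ici.2 hlt.le)
  have h3 := measureReal_slopeLaw_Ici_le (j := j) (x := 1 / 2) (by norm_num)
  have hmass := inv_sqrt_le_slopeMass (m := j + 2) (by omega)
  have h4 : p / 2 * (√((j + 2 + 1 : ℕ) : ℝ))⁻¹ ≤
      (slopeNorm (1 / 2))⁻¹ ^ (j + 1) / ((j + 1) * (1 / 2)) :=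
    le_trans (mul_le_mul h2 hmass (by positivity) measureReal_nonneg) h3
  -- `√(4 / 5) ≤ exp (-1 / 10)`, from `4 / 5 ≤ exp (-1 / 5)`
  have h5 : (slopeNorm (1 / 2))⁻¹ ≤ Real.exp (-(1 / 10)) := by
    refine le_of_sq_le_sq ?_ (Real.exp_pos _).le
    rw [inv_pow, slopeNorm_sq, ← Real.exp_nat_mul]
    have := Real.add_one_le_exp (((2 : ℕ) : ℝ) * -(1 / 10))
    norm_num at this ⊢
    linarith
  have h6 : √((j + 2 + 1 : ℕ) : ℝ) ≤ (j + 1) * (1 / 2) := by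
    rw [Real.sqrt_le_left (by positivity)]
    push_cast
    nlinarith
  have h7 : p / 2 ≤ Real.exp (-(1 / 10)) ^ (j + 1) := by
    rw [← div_eq_mul_inv, div_le_div_iff₀ (by positivity) (by positivity)] at h4
    have h8 := pow_le_pow_left₀ (inv_pos.2 (slopeNorm_pos (1 / 2))).le h5 (j + 1)
    have h9 : 0 < ((j : ℝ) + 1) * (1 / 2) := by positivity
    have h10 := mul_le_mul h8 h6 (Real.sqrt_nonneg _) (by positivity)
    exact le_of_mul_le_mul_right (h4.trans h10) h9
  have hp_eq : p = Real.exp (-Real.log (1 / p)) := by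
    rw [one_div, Real.log_inv, neg_neg, Real.exp_log hp0]
  have h11 : Real.exp (-((j + 2 + 1 : ℕ) / 40 : ℝ) - 1) ≤ p / 2 := by
    have a1 : Real.exp (-((j + 2 + 1 : ℕ) / 40 : ℝ)) ≤ p := by
      rw [hp_eq, Real.exp_le_exp]; linarith
    have a2 : Real.exp (-1) ≤ 1 / 2 := by
      rw [Real.exp_neg, ← one_div]
      exact one_div_le_one_div_of_le (by norm_num) (by linarith [Real.add_one_le_exp (1 : ℝ)])
    rw [sub_eq_add_neg, Real.exp_add]
    calc _ ≤ p * (1 / 2) := mul_le_mul a1 a2 (Real.exp_pos _).le hp0.le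
      _ = _ := by ring
  have h12 := h11.trans h7
  rw [← Real.exp_nat_mul, Real.exp_le_exp] at h12
  push_cast at h12
  linarith

/-- In dimension `d - 1`, lowering the threshold `τ(p, d)` by half the square of the slope `ζ` that is
exceeded with probability `p / 2` makes the probability of an edge at least `(1 + d ζ³ / 10) p`. -/
theorem capProb_tau_sub_ge {m : ℕ} (hm : 19 ≤ m) {p : ℝ} (hp0 : 0 < p) (hp : p ≤ 1 / 2)
    {ζ : ℝ} (hζ : ζ = capSlope (tau (p / 2) (m + 1))) (hζ0 : 0 < ζ) (hζ1 : ζ ≤ 1 / 2) :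
    p + (m + 1 : ℕ) * ζ ^ 3 * p / 10 ≤ capProb m (tau p (m + 1) - ζ ^ 2 / 2) := by
  obtain ⟨j, rfl⟩ : ∃ j, m = j + 2 + 1 := ⟨m - 3, by omega⟩
  have := isProbabilityMeasure_slopeLaw (m := j + 2) (by omega)
  have hj : (16 : ℝ) ≤ j := by exact_mod_cast (by omega : 16 ≤ j)
  set d := j + 2 + 1 + 1 with hd
  have hτ0 : 0 ≤ tau p d := tau_nonneg (by omega) hp0 hp
  have hτ1 : tau p d < 1 := tau_lt_one (by omega) hp0 (by linarith)
  have hσ0 : 0 ≤ tau (p / 2) d := tau_nonneg (by omega) (by linarith) (by linarith)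
  have hσ1 : tau (p / 2) d < 1 := tau_lt_one (by omega) (by linarith) (by linarith)
  have hτσ : tau p d ≤ tau (p / 2) d := tau_antitone (by omega) (by linarith) (by linarith) (by linarith)
  have hξζ : capSlope (tau p d) ≤ ζ := by rw [hζ]; exact capSlope_mono hτ0 hτσ hσ1
  have hξ0 : 0 ≤ capSlope (tau p d) := capSlope_nonneg hτ0
  set ξ := capSlope (tau p d) with hξ
  set δ := ζ ^ 2 / 2 with hδ
  have hδ0 : 0 ≤ δ := by positivity
  have hδζ : δ ≤ ζ := by nlinarith
  have hmass := slopeMass_pos (m := j + 2) (by omega)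
  -- the mass gained, through the minimum of the density on `[ξ - δ, ξ)`
  have h1 := le_measureReal_slopeLaw_Ico (m := j + 2) (by omega) (a := ξ - δ) (b := ξ)
    (c := slopeDensity (j + 2) ζ) (by linarith) (fun z hz => slopeDensity_le_of_abs_le
      (abs_le.2 ⟨by linarith [hz.1], by linarith [hz.2]⟩))
  -- the density at `ζ` is large because the tail beyond `ζ` has mass at least `p / 2`
  have h2 := measureReal_slopeLaw_Ici_le (j := j) hζ0
  have h3 : p / 2 ≤ (slopeLaw (j + 2)).real (Set.Ici ζ) := by
    rw [hζ, ← slopeCap_eq_Ici hσ0 hσ1, ← capProb_succ (by omega)]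
    refine le_trans ?_ (capProb_succ_le (by omega) hσ0)
    rw [capProb_tau (by omega) (by linarith) (by linarith)]
  have h4 : p / 2 * slopeMass (j + 2) ≤ (slopeNorm ζ)⁻¹ ^ (j + 1) / ((j + 1) * ζ) :=
    (mul_le_mul_of_nonneg_right h3 hmass.le).trans h2
  rw [le_div_iff₀ (by positivity)] at h4
  have h5 : 4 / 5 * (slopeNorm ζ)⁻¹ ^ (j + 1) ≤ slopeDensity (j + 2) ζ := by
    have a1 : 4 / 5 ≤ (slopeNorm ζ)⁻¹ ^ 2 := by
      rw [inv_pow, slopeNorm_sq]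
      rw [show (4 / 5 : ℝ) = (5 / 4)⁻¹ by norm_num]
      exact inv_anti₀ (by positivity) (by nlinarith)
    rw [slopeDensity, show j + 2 + 1 = 2 + (j + 1) by ring, pow_add _ 2]
    exact mul_le_mul_of_nonneg_right a1 (pow_pos (inv_pos.2 (slopeNorm_pos ζ)) _).le
  have h6 : (d : ℝ) * ζ ^ 3 * p / 10 ≤ (slopeLaw (j + 2)).real (Set.Ico (ξ - δ) ξ) := by
    refine le_of_mul_le_mul_right (le_trans ?_ h1) hmass
    have hdj : (d : ℝ) / 2 ≤ j + 1 := by rw [hd]; push_cast; linarith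
    calc (d : ℝ) * ζ ^ 3 * p / 10 * slopeMass (j + 2)
        = δ * (4 / 5) * (p / 2 * slopeMass (j + 2) * ((d / 2) * ζ)) := by rw [hδ]; ring
      _ ≤ δ * (4 / 5) * (p / 2 * slopeMass (j + 2) * ((j + 1) * ζ)) := by gcongr
      _ ≤ δ * (4 / 5) * (slopeNorm ζ)⁻¹ ^ (j + 1) :=
          mul_le_mul_of_nonneg_left h4 (by positivity)
      _ = δ * (4 / 5 * (slopeNorm ζ)⁻¹ ^ (j + 1)) := by ring
      _ ≤ δ * slopeDensity (j + 2) ζ := mul_le_mul_of_nonneg_left h5 hδ0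
      _ = _ := by ring
  have h7 : p ≤ (slopeLaw (j + 2)).real (Set.Ici ξ) := by
    rw [hξ, ← slopeCap_eq_Ici hτ0 hτ1, ← capProb_succ (by omega)]
    exact le_capProb_of_le_tau (by omega) hp0 hp le_rfl
  rw [capProb_succ (by omega)]
  calc _ ≤ (slopeLaw (j + 2)).real (Set.Ici ξ) + (slopeLaw (j + 2)).real (Set.Ico (ξ - δ) ξ) :=
        add_le_add h7 h6
    _ = (slopeLaw (j + 2)).real (Set.Ici ξ ∪ Set.Ico (ξ - δ) ξ) := by
        refine (measureReal_union ?_ measurableSet_Ico).symm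
        rw [Set.disjoint_left]
        intro z hz hz'
        exact absurd hz'.2 (not_lt.2 hz)
    _ ≤ _ := by
        refine measureReal_mono (Set.union_subset ?_ (Ico_subset_slopeCap_sub hτ0 hτ1))
        rw [hξ, ← slopeCap_eq_Ici hτ0 hτ1]
        intro z hz
        have hz : tau p d * slopeNorm z ≤ z := hz
        change (tau p d - δ) * slopeNorm z ≤ z
        nlinarith [mul_nonneg hδ0 (slopeNorm_pos z).le]

/-- A lower bound for the mean of a signed triangle through the slope `ζ` that is exceeded with
probability `p / 2`: two neighbours of a vertex whose slopes exceed `ζ` are joined through the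
threshold `τ - (1 - τ) ζ²` instead of `τ`. -/
theorem le_triMean_of_capSlope {d : ℕ} (hd : 20 ≤ d) {p : ℝ} (hp0 : 0 < p) (hp : p ≤ 1 / 2)
    {ζ : ℝ} (hζ : ζ = capSlope (tau (p / 2) d)) (hζ0 : 0 < ζ) (hζ1 : ζ ≤ 1 / 2) :
    p ^ 3 * (d * ζ ^ 3) / 40 ≤ triMean p d := by
  obtain ⟨m, rfl⟩ : ∃ m, d = m + 1 := ⟨d - 1, by omega⟩
  have hm : 1 ≤ m := by omega
  have := isProbabilityMeasure_slopeLaw hm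
  have hp1 : p ≤ 1 := by linarith
  have hτ0 : 0 ≤ tau p (m + 1) := tau_nonneg (by omega) hp0 hp
  have hτ1 : tau p (m + 1) < 1 := tau_lt_one (by omega) hp0 hp1
  have hσ1 : tau (p / 2) (m + 1) < 1 := tau_lt_one (by omega) (by linarith) (by linarith)
  have hτσ : tau p (m + 1) ≤ tau (p / 2) (m + 1) :=
    tau_antitone (by omega) (by linarith) (by linarith) hp1
  have hνζ : (slopeLaw m).real (Set.Ici ζ) = p / 2 := by
    rw [hζ]; exact measureReal_slopeLaw_Ici_capSlope_tau hm (by linarith) (by linarith)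
  set τ := tau p (m + 1) with hτ
  set Z := slopeCap τ with hZ
  have hξζ : capSlope τ ≤ ζ := by rw [hζ]; exact capSlope_mono hτ0 hτσ hσ1
  have hτζ : τ ≤ ζ := (le_capSlope hτ0 hτ1).trans hξζ
  have hIci : Set.Ici ζ ⊆ Z := by
    rw [hZ, slopeCap_eq_Ici hτ0 hτ1]; exact Set.Ici_subset_Ici.2 hξζ
  have hζZ : ζ ∈ Z := hIci Set.self_mem_Ici
  set g := (m + 1 : ℕ) * ζ ^ 3 * p / 10 with hg
  have hg0 : 0 ≤ g := by positivity
  have hgain := capProb_tau_sub_ge (m := m) (by omega) hp0 hp hζ hζ0 hζ1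
  have hpt : ∀ z ∈ Set.Ici ζ, ∀ z' ∈ Set.Ici ζ,
      p + g ≤ capProb m (τ * slopeNorm z * slopeNorm z' - z * z') := by
    intro z hz z' hz'
    refine hgain.trans (capProb_antitone m hm ?_)
    have h1 := threshold_antitone hτ0 (hIci hz') (Set.mem_Ici.1 hz)
    have h2 := threshold_antitone hτ0 hζZ (Set.mem_Ici.1 hz')
    have h3 := threshold_diag τ ζ
    have h4 : τ * slopeNorm ζ * slopeNorm z' - ζ * z' = τ * slopeNorm z' * slopeNorm ζ - z' * ζ := by
      ring
    nlinarith [sq_nonneg ζ, mul_le_mul_of_nonneg_right (hτζ.trans hζ1) (sq_nonneg ζ)]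
  have hind : Integrable (fun z => g * (Set.Ici ζ).indicator (1 : ℝ → ℝ) z)
      ((slopeLaw m).restrict Z) :=
    ((integrable_const (1 : ℝ)).indicator measurableSet_Ici).const_mul g
  have hcod : ∀ z ∈ Set.Ici ζ, g * (p / 2) ≤ slopeCodegree p m z := by
    intro z hz
    have h : ∫ z' in Z, (p + g * (Set.Ici ζ).indicator 1 z') ∂slopeLaw m ≤
        ∫ z' in Z, capProb m (τ * slopeNorm z * slopeNorm z' - z * z') ∂slopeLaw m := by
      refine setIntegral_mono_on ?_ (integrable_capProb_comp hm (by fun_prop) _)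
        (measurableSet_slopeCap _) fun z' hz' => ?_
      · exact (integrable_const _).add hind
      · by_cases h : z' ∈ Set.Ici ζ
        · simpa [h] using hpt z hz z' h
        · simp only [h, not_false_eq_true, Set.indicator_of_notMem, mul_zero, add_zero]
          exact le_capProb_of_le_tau hm hp0 hp (threshold_le hτ0 hτ1.le (hIci hz) hz')
    rw [integral_add (integrable_const _) hind, integral_const_mul,
      setIntegral_const, measureReal_slopeCap_tau hm hp0 hp1, integral_indicator_one measurableSet_Ici,
      measureReal_restrict_apply measurableSet_Ici, Set.inter_eq_left.2 hIci, hνζ, smul_eq_mul] at h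
    rw [slopeCodegree]
    linarith [sq p]
  have hHi : Integrable (slopeCodegree p m) (slopeLaw m) :=
    Integrable.of_bound (measurable_slopeCodegree hm p).aestronglyMeasurable p
      (Eventually.of_forall (abs_slopeCodegree_le hm hp0 hp1))
  have h0 : ∫ z, slopeCodegree p m z ∂slopeLaw m = 0 := by
    have h := integral_capKernel_capCodegree hm hp0 hp1 (F := fun q => q.2) (by fun_prop) (sphNorth m)
    rw [integral_capCodegree (by omega) hp0 hp1] at h
    exact h.symm
  have hM : triMean p (m + 1) = ∫ z in Z, slopeCodegree p m z ∂slopeLaw m := by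
    rw [← integral_capKernel_mul_capCodegree (by omega) hp0 hp1 (sphNorth m),
      integral_capKernel_capCodegree hm hp0 hp1 (F := fun q => q.1 * q.2) (by fun_prop)]
    have hind : ∀ z, Z.indicator (1 : ℝ → ℝ) z * slopeCodegree p m z =
        Z.indicator (slopeCodegree p m) z := fun z => by by_cases h : z ∈ Z <;> simp [h]
    simp_rw [sub_mul]
    simp_rw [← hτ, ← hZ, hind]
    rw [integral_sub (hHi.indicator (measurableSet_slopeCap _)) (hHi.const_mul p),
      integral_indicator (measurableSet_slopeCap _), integral_const_mul, h0, mul_zero, sub_zero]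
  have h : ∫ z in Set.Ici ζ, g * (p / 2) ∂slopeLaw m ≤ ∫ z in Z, slopeCodegree p m z ∂slopeLaw m := by
    calc _ ≤ ∫ z in Set.Ici ζ, slopeCodegree p m z ∂slopeLaw m :=
          setIntegral_mono_on (integrable_const _) hHi.integrableOn measurableSet_Ici hcod
      _ ≤ _ := by
          refine setIntegral_mono_set hHi.integrableOn ?_ (LE.le.eventuallyLE hIci)
          filter_upwards [ae_restrict_mem (measurableSet_slopeCap τ)] with z hz
          exact slopeCodegree_nonneg hm hp0 hp hz
  rw [setIntegral_const, hνζ, smul_eq_mul] at h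
  rw [hM]
  refine le_trans (le_of_eq ?_) h
  rw [hg]; ring

/-- The mean of a signed triangle is at least of the order `p³ log(1/p)^(3/2) / √d`. -/
theorem le_mul_triMean_sq {d : ℕ} (hd : 20 ≤ d) {p : ℝ} (hp0 : 0 < p) (hp : p ≤ 1 / 2)
    (hL : (5 * Real.log (1 / p)) ^ 4 ≤ d) :
    0 < triMean p d ∧
      p ^ 6 * Real.log (1 / p) ^ 3 / (1600 * 64 ^ 3) ≤ d * triMean p d ^ 2 := by
  have hd0 : (20 : ℝ) ≤ d := by exact_mod_cast hd
  set L := Real.log (1 / p) with hLdef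
  have hL0 : 0 ≤ L := Real.log_nonneg (by rw [le_div_iff₀ hp0]; linarith)
  have hLd : L ≤ d / 40 := by
    by_contra! h
    have h1 : (d : ℝ) / 8 ≤ 5 * L := by linarith
    have h2 := (pow_le_pow_left₀ (by positivity) h1 4).trans hL
    have h3 : (20 : ℝ) ^ 3 ≤ (d : ℝ) ^ 3 := pow_le_pow_left₀ (by norm_num) hd0 3
    nlinarith
  obtain ⟨m, rfl⟩ : ∃ m, d = m + 1 := ⟨d - 1, by omega⟩
  have hm : 1 ≤ m := by omega
  have hζ1 := capSlope_tau_le_half hd hp0 hp hLd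
  have hνζ := measureReal_slopeLaw_Ici_capSlope_tau hm (q := p / 2) (by linarith) (by linarith)
  have hζ0' : 0 ≤ capSlope (tau (p / 2) (m + 1)) :=
    capSlope_nonneg (tau_nonneg (by omega) (by linarith) (by linarith))
  set ζ := capSlope (tau (p / 2) (m + 1)) with hζ
  set d : ℝ := ((m + 1 : ℕ) : ℝ) with hdd
  -- `d ζ²` is bounded below by a constant and by `L - 2`, hence by a multiple of `L`
  have h1 := half_sub_le_measureReal_slopeLaw_Ici hm hζ0'
  rw [hνζ, ← hdd] at h1
  have h2 : 1 / 4 ≤ ζ * √d := by linarith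
  have hζ0 : 0 < ζ := by
    refine lt_of_le_of_ne hζ0' fun h => ?_
    rw [← h] at h2; norm_num at h2
  have h3 : 1 / 16 ≤ d * ζ ^ 2 := by
    have := pow_le_pow_left₀ (by norm_num) h2 2
    rw [mul_pow, Real.sq_sqrt (by linarith)] at this
    linarith
  have h4 : L - 2 ≤ d * ζ ^ 2 := by
    have a1 := exp_le_measureReal_slopeLaw_Ici hm hζ0'
    rw [hνζ, ← hdd] at a1
    have a2 : p = Real.exp (-L) := by
      rw [hLdef, one_div, Real.log_inv, neg_neg, Real.exp_log hp0]
    have a3 : (7 : ℝ) ≤ Real.exp 2 := by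
      have := Real.exp_one_gt_d9
      rw [show (2 : ℝ) = 1 + 1 by norm_num, Real.exp_add]
      nlinarith
    have a4 : Real.exp (-(d * ζ ^ 2)) ≤ Real.exp (2 - L) := by
      rw [sub_eq_add_neg, Real.exp_add, ← a2]
      nlinarith
    rw [Real.exp_le_exp] at a4
    linarith
  have h5 : L / 64 ≤ d * ζ ^ 2 := by
    rcases le_total L 4 with h | h <;> linarith
  have h6 := le_triMean_of_capSlope hd hp0 hp hζ hζ0 hζ1
  rw [← hdd] at h6
  have h7 : 0 < p ^ 3 * (d * ζ ^ 3) / 40 := by positivity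
  refine ⟨h7.trans_le h6, ?_⟩
  have h8 := pow_le_pow_left₀ h7.le h6 2
  have h9 := pow_le_pow_left₀ (by positivity) h5 3
  calc p ^ 6 * L ^ 3 / (1600 * 64 ^ 3) = p ^ 6 * (L / 64) ^ 3 / 1600 := by ring
    _ ≤ p ^ 6 * (d * ζ ^ 2) ^ 3 / 1600 := by gcongr
    _ = d * (p ^ 3 * (d * ζ ^ 3) / 40) ^ 2 := by ring
    _ ≤ _ := mul_le_mul_of_nonneg_left h8 (by positivity)

open ProbabilityTheory

/-! ### Independence of the edges and of the community memberships -/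

/-- The memberships of distinct elements in a binomial random set are independent. -/
theorem integral_setBernoulli_prod {ι : Type*} [Fintype ι] (u : Set ι) (q : unitInterval)
    {A : Finset ι} (hA : ∀ i ∈ A, i ∈ u) (f : ι → Prop → ℝ) :
    ∫ S, ∏ i ∈ A, f i (i ∈ S) ∂setBernoulli u q =
      ∏ i ∈ A, ((q : ℝ) * f i True + (1 - q) * f i False) := by
  classical
  have hm : ∀ g : Prop → ℝ, Measurable g := fun g => measurable_of_countable g
  have hmeas : Measurable fun x : ι → Prop => ∏ i, if i ∈ A then f i (x i) else 1 := by
    refine Finset.measurable_prod _ fun i _ => ?_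
    by_cases h : i ∈ A <;> simp only [h, if_true, if_false]
    · exact (hm _).comp (measurable_pi_apply i)
    · exact measurable_const
  have hmeas' : Measurable fun S : Set ι => ∏ i, if i ∈ A then f i (i ∈ S) else 1 := by
    refine Finset.measurable_prod _ fun i _ => ?_
    by_cases h : i ∈ A <;> simp only [h, if_true, if_false]
    · exact (hm _).comp (measurable_set_mem i)
    · exact measurable_const
  have h1 : ∀ S : Set ι, ∏ i ∈ A, f i (i ∈ S) = ∏ i, if i ∈ A then f i (i ∈ S) else 1 := by
    intro S
    rw [Finset.prod_ite, Finset.prod_const_one, mul_one]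
    congr 1
    ext; simp
  simp_rw [h1]
  rw [setBernoulli_eq_map, integral_map (by fun_prop) hmeas'.aestronglyMeasurable,
    Measure.infinitePi_eq_pi]
  simp only [Set.mem_ofPred_eq]
  rw [integral_fintype_prod_eq_prod (fun i (x : Prop) => if i ∈ A then f i x else 1)]
  rw [← Finset.prod_subset (Finset.subset_univ A)]
  · refine Finset.prod_congr rfl fun i hi => ?_
    have hiu : (i ∈ u) = True := by simp [hA i hi]
    simp only [hi, if_true, hiu]
    rw [integral_add_measure, integral_smul_nnreal_measure, integral_smul_nnreal_measure,
      integral_dirac, integral_dirac]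
    · rfl
    · exact (integrable_dirac (by simp)).smul_measure_nnreal
    · exact (integrable_dirac (by simp)).smul_measure_nnreal
  · intro i _ hi
    simp only [hi, if_false]
    simp

/-- The centered indicator that a pair of vertices is an edge. -/
noncomputable def edgeVar {n : ℕ} (p : ℝ) (G : SimpleGraph (Fin n)) (e : Sym2 (Fin n)) : ℝ :=
  G.edgeSet.indicator 1 e - p

theorem centeredEdge_eq_edgeVar {n : ℕ} (p : ℝ) (G : SimpleGraph (Fin n)) (i j : Fin n) :
    centeredEdge p G i j = edgeVar p G s(i, j) := by
  by_cases h : G.Adj i j <;> simp [centeredEdge, edgeVar, Set.indicator, h]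

theorem measurable_edgeVar {n : ℕ} (p : ℝ) (e : Sym2 (Fin n)) :
    Measurable fun G : SimpleGraph (Fin n) => edgeVar p G e := by
  classical
  have h : (fun G : SimpleGraph (Fin n) => edgeVar p G e) =
      (fun P : Prop => (if P then (1 : ℝ) else 0) - p) ∘ fun G : SimpleGraph (Fin n) =>
        e ∈ G.edgeSet := by
    ext G; simp [edgeVar, Set.indicator]
  rw [h]
  exact (measurable_of_countable _).comp
    ((measurable_set_mem e).comp SimpleGraph.measurable_edgeSet)

theorem abs_edgeVar_le {n : ℕ} {p : ℝ} (hp0 : 0 ≤ p) (hp1 : p ≤ 1) (G : SimpleGraph (Fin n))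
    (e : Sym2 (Fin n)) : |edgeVar p G e| ≤ 1 := by
  unfold edgeVar
  rw [abs_le]
  by_cases h : e ∈ G.edgeSet <;> simp [h] <;> constructor <;> linarith

theorem edgeVar_sq {n : ℕ} (p : ℝ) (G : SimpleGraph (Fin n)) (e : Sym2 (Fin n)) :
    edgeVar p G e ^ 2 = p * (1 - p) + (1 - 2 * p) * edgeVar p G e := by
  unfold edgeVar
  by_cases h : e ∈ G.edgeSet <;> simp [h] <;> ring

theorem integral_nullModel_prod {n : ℕ} (p : unitInterval) {E : Finset (Sym2 (Fin n))}
    (hE : ∀ e ∈ E, ¬ e.IsDiag) (f : Sym2 (Fin n) → Prop → ℝ) :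
    ∫ H, ∏ e ∈ E, f e (e ∈ H.edgeSet) ∂nullModel n p =
      ∏ e ∈ E, ((p : ℝ) * f e True + (1 - p) * f e False) := by
  have hm : ∀ g : Prop → ℝ, Measurable g := fun g => measurable_of_countable g
  have hmeas : Measurable fun H : SimpleGraph (Fin n) => ∏ e ∈ E, f e (e ∈ H.edgeSet) :=
    Finset.measurable_prod _ fun e _ =>
      (hm _).comp ((measurable_set_mem e).comp SimpleGraph.measurable_edgeSet)
  rw [nullModel, SimpleGraph.binomialRandom_eq_map,
    integral_map SimpleGraph.measurable_fromEdgeSet.aemeasurable hmeas.aestronglyMeasurable,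
    ← integral_setBernoulli_prod Sym2.diagSetᶜ p (fun e he => by simpa using hE e he) f]
  refine integral_congr_ae (Eventually.of_forall fun S => Finset.prod_congr rfl fun e he => ?_)
  simp [hE e he]

/-- The indicator that a vertex belongs to the community. -/
noncomputable def memVar {n : ℕ} (S : Set (Fin n)) (i : Fin n) : ℝ := S.indicator 1 i

theorem memVar_mul_self {n : ℕ} (S : Set (Fin n)) (i : Fin n) :
    memVar S i * memVar S i = memVar S i := by
  unfold memVar
  by_cases h : i ∈ S <;> simp [h]

theorem integral_prod_memVar {n : ℕ} (q : unitInterval) (A : Finset (Fin n)) :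
    ∫ S, ∏ i ∈ A, memVar S i ∂setBernoulli Set.univ q = (q : ℝ) ^ A.card := by
  classical
  have h := integral_setBernoulli_prod Set.univ q (A := A) (by simp) (fun _ P => if P then 1 else 0)
  simp only [if_true, if_false, mul_one, mul_zero, add_zero, Finset.prod_const] at h
  rw [← h]
  refine integral_congr_ae (Eventually.of_forall fun S => Finset.prod_congr rfl fun i _ => ?_)
  simp [memVar, Set.indicator]

/-- The conditional mean of the centered indicator of a pair of vertices, given the community and the
latent vectors. -/
noncomputable def condEdge {n d : ℕ} (p : ℝ) (S : Set (Fin n)) (U : Fin n → Sph d) :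
    Sym2 (Fin n) → ℝ :=
  Sym2.lift ⟨fun i j => memVar S i * memVar S j * capKernel p d (U i) (U j), fun i j => by
    beta_reduce
    rw [capKernel_comm p d (U i), mul_comm (memVar S i)]⟩

theorem condEdge_mk {n d : ℕ} (p : ℝ) (S : Set (Fin n)) (U : Fin n → Sph d) (i j : Fin n) :
    condEdge p S U s(i, j) = memVar S i * memVar S j * capKernel p d (U i) (U j) := rfl

/-- Given the community and the latent vectors, the edges are independent. -/
theorem integral_nullModel_prod_edgeVar {n d : ℕ} (p : unitInterval) (S : Set (Fin n))
    (U : Fin n → Sph d) {E : Finset (Sym2 (Fin n))} (hE : ∀ e ∈ E, ¬ e.IsDiag) :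
    ∫ H, ∏ e ∈ E, edgeVar p (plantedGraph (p : ℝ) S U H) e ∂nullModel n p =
      ∏ e ∈ E, condEdge p S U e := by
  classical
  let f : Sym2 (Fin n) → Prop → ℝ := fun e P =>
    if ∀ i ∈ e, i ∈ S then condEdge p S U e else (if P then 1 else 0) - p
  have h1 : ∀ H : SimpleGraph (Fin n), ∀ e ∈ E,
      edgeVar p (plantedGraph (p : ℝ) S U H) e = f e (e ∈ H.edgeSet) := by
    intro H e he
    have hd := hE e he
    induction e with
    | _ i j =>
      have hij : i ≠ j := by simpa using hd
      simp only [edgeVar, f, condEdge_mk, Sym2.mem_iff, forall_eq_or_imp, forall_eq,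
        SimpleGraph.mem_edgeSet, plantedGraph, memVar, capKernel, sphCap, Set.indicator,
        Set.mem_ofPred_eq]
      by_cases hi : i ∈ S <;> by_cases hj : j ∈ S <;>
        by_cases ht : tau (p : ℝ) d ≤ ⟪(U i).1, (U j).1⟫ <;> simp [hi, hj, hij, ht]
  have h2 : ∀ e ∈ E, (p : ℝ) * f e True + (1 - p) * f e False = condEdge p S U e := by
    intro e he
    induction e with
    | _ i j =>
      simp only [f, condEdge_mk, Sym2.mem_iff, forall_eq_or_imp, forall_eq, memVar]
      by_cases hi : i ∈ S <;> by_cases hj : j ∈ S <;> simp [hi, hj] <;> ring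
  rw [← Finset.prod_congr rfl h2, ← integral_nullModel_prod p hE f]
  exact integral_congr_ae (Eventually.of_forall fun H => Finset.prod_congr rfl (h1 H))

theorem integrable_plantedModel {n : ℕ} (p : unitInterval) {d : ℕ} (hd : 1 ≤ d) (k : ℝ)
    {F : SimpleGraph (Fin n) → ℝ} (hF : Measurable F) {C : ℝ} (hC : ∀ G, |F G| ≤ C) :
    Integrable F (plantedModel n p d k) := by
  have := isProbabilityMeasure_plantedModel n p hd k
  exact Integrable.of_bound hF.aestronglyMeasurable C (Eventually.of_forall hC)

/-- Products of centered edge indicators under the planted model. -/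
theorem integral_plantedModel_prod_edgeVar {n : ℕ} (p : unitInterval) {d : ℕ} (hd : 1 ≤ d) (k : ℝ)
    {E : Finset (Sym2 (Fin n))} (hE : ∀ e ∈ E, ¬ e.IsDiag) :
    ∫ G, ∏ e ∈ E, edgeVar p G e ∂plantedModel n p d k =
      ∫ S, ∫ U, ∏ e ∈ E, condEdge p S U e ∂Measure.pi (fun _ : Fin n => uniformSphere d)
        ∂setBernoulli Set.univ (Set.projIcc (0 : ℝ) 1 zero_le_one (k / n)) := by
  have := isProbabilityMeasure_uniformSphere hd
  have : IsProbabilityMeasure (nullModel n p) := by unfold nullModel; infer_instance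
  have hF : Measurable fun G : SimpleGraph (Fin n) => ∏ e ∈ E, edgeVar (p : ℝ) G e :=
    Finset.measurable_prod _ fun e _ => measurable_edgeVar _ e
  have hb : ∀ G : SimpleGraph (Fin n), |∏ e ∈ E, edgeVar (p : ℝ) G e| ≤ 1 := fun G => by
    rw [Finset.abs_prod]
    exact Finset.prod_le_one (fun _ _ => abs_nonneg _)
      fun e _ => abs_edgeVar_le p.2.1 p.2.2 G e
  have hcomp := hF.comp (measurable_plantedGraph (n := n) (d := d) (p : ℝ))
  rw [plantedModel, integral_map (measurable_plantedGraph _).aemeasurable hF.aestronglyMeasurable,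
    integral_prod]
  · refine integral_congr_ae (Eventually.of_forall fun S => ?_)
    have hS : Measurable fun y : (Fin n → Sph d) × SimpleGraph (Fin n) =>
        ∏ e ∈ E, edgeVar (p : ℝ) (plantedGraph (p : ℝ) S y.1 y.2) e := by
      have h := hcomp.comp (measurable_const.prodMk measurable_id : Measurable fun y :
        (Fin n → Sph d) × SimpleGraph (Fin n) => (S, y))
      exact h
    beta_reduce
    rw [integral_prod]
    · refine integral_congr_ae (Eventually.of_forall fun U => ?_)
      beta_reduce
      rw [← integral_nullModel_prod_edgeVar p S U hE]
    · exact Integrable.of_bound hS.aestronglyMeasurable 1 (Eventually.of_forall fun y => hb _)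
  · exact Integrable.of_bound hcomp.aestronglyMeasurable 1 (Eventually.of_forall fun y => hb _)

/-! ### Resampling latent vectors -/

/-- Replacing one coordinate of a product measure by an independent copy does not change the law. -/
theorem integral_pi_eq_integral_update {ι α : Type*} [Fintype ι] [DecidableEq ι] [MeasurableSpace α]
    (μ : Measure α) [IsProbabilityMeasure μ] (i : ι) {F : (ι → α) → ℝ} (hF : Measurable F) {C : ℝ}
    (hC : ∀ U, |F U| ≤ C) :
    ∫ U, F U ∂Measure.pi (fun _ : ι => μ) =
      ∫ U, ∫ w, F (Function.update U i w) ∂μ ∂Measure.pi (fun _ : ι => μ) := by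
  have hu : Measurable fun q : (ι → α) × α => Function.update q.1 i q.2 := by
    refine measurable_pi_iff.2 fun j => ?_
    by_cases h : j = i
    · subst h; simpa using measurable_snd
    · simp only [Function.update_of_ne h]; fun_prop
  have hmap : ((Measure.pi (fun _ : ι => μ)).prod μ).map (fun q => Function.update q.1 i q.2) =
      Measure.pi (fun _ : ι => μ) := by
    symm
    refine Measure.pi_eq fun s hs => ?_
    rw [Measure.map_apply hu (MeasurableSet.univ_pi hs)]
    have : (fun q : (ι → α) × α => Function.update q.1 i q.2) ⁻¹' Set.univ.pi s =
        (Set.univ.pi (Function.update s i Set.univ)) ×ˢ s i := by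
      ext ⟨U, w⟩
      simp only [Set.mem_preimage, Set.mem_pi, Set.mem_univ, true_implies, Set.mem_prod]
      constructor
      · intro h
        refine ⟨fun j => ?_, by simpa using h i⟩
        by_cases hj : j = i
        · subst hj; simp
        · simpa [Function.update_of_ne hj] using h j
      · rintro ⟨h1, h2⟩ j
        by_cases hj : j = i
        · subst hj; simpa using h2
        · simpa [Function.update_of_ne hj] using h1 j
    rw [this, Measure.prod_prod, Measure.pi_pi, ← Finset.mul_prod_erase _ _ (Finset.mem_univ i),
      ← Finset.mul_prod_erase _ (fun j => μ (s j)) (Finset.mem_univ i)]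
    simp only [Function.update_self, measure_univ, one_mul]
    rw [mul_comm]
    congr 1
    refine Finset.prod_congr rfl fun j hj => ?_
    rw [Function.update_of_ne (Finset.ne_of_mem_erase hj)]
  conv_lhs => rw [← hmap]
  rw [integral_map hu.aemeasurable hF.aestronglyMeasurable, integral_prod]
  exact Integrable.of_bound (hF.comp hu).aestronglyMeasurable C (Eventually.of_forall fun _ => hC _)

/-! ### Moments of products of edge kernels -/

/-- The joint law of the latent vectors. -/
noncomputable abbrev latentLaw (n d : ℕ) : Measure (Fin n → Sph d) :=
  Measure.pi fun _ : Fin n => uniformSphere d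

theorem abs_capCodegree_le_one {p : ℝ} {d : ℕ} (hd : 2 ≤ d) (hp0 : 0 < p) (hp1 : p ≤ 1)
    (u v : Sph d) : |capCodegree p d u v| ≤ 1 :=
  (abs_capCodegree_le hd hp0 hp1 u v).trans hp1

@[fun_prop]
theorem measurable_capKernel_eval {n : ℕ} (p : ℝ) (d : ℕ) (i j : Fin n) :
    Measurable fun U : Fin n → Sph d => capKernel p d (U i) (U j) :=
  measurable_capKernel_comp (measurable_pi_apply i) (measurable_pi_apply j)

theorem measurable_capCodegree_eval {n : ℕ} (p : ℝ) {d : ℕ} (hd : 1 ≤ d) (i j : Fin n) :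
    Measurable fun U : Fin n → Sph d => capCodegree p d (U i) (U j) :=
  measurable_capCodegree_comp hd (measurable_pi_apply i) (measurable_pi_apply j)

theorem abs_mul_le_of_le {a b A B : ℝ} (ha : |a| ≤ A) (hb : |b| ≤ B) : |a * b| ≤ A * B := by
  rw [abs_mul]
  exact mul_le_mul ha hb (abs_nonneg _) ((abs_nonneg _).trans ha)

/-- An edge with an end `l` of degree one makes the integral vanish, the kernel having mean zero. -/
theorem integral_capKernel_mul_eq_zero {n d : ℕ} (hd : 2 ≤ d) {p : ℝ} (hp0 : 0 < p) (hp1 : p ≤ 1)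
    {i l : Fin n} (hil : i ≠ l) {F : (Fin n → Sph d) → ℝ} (hF : Measurable F) {C : ℝ}
    (hC : ∀ U, |F U| ≤ C) (hl : ∀ U w, F (Function.update U l w) = F U) :
    ∫ U, capKernel p d (U i) (U l) * F U ∂latentLaw n d = 0 := by
  have := isProbabilityMeasure_uniformSphere (d := d) (by omega)
  rw [integral_pi_eq_integral_update (uniformSphere d) l (C := 1 * C) (by fun_prop)
    fun U => abs_mul_le_of_le (abs_capKernel_le hp0.le hp1 _ _ _) (hC U)]
  simp only [hl, Function.update_self, Function.update_of_ne hil, integral_mul_const,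
    integral_capKernel hd hp0 hp1, zero_mul, integral_zero]

/-- A triangle which meets the remaining factor in the vertex `i` only can be integrated out: given the
vector of `i`, its mean is `triMean p d`. -/
theorem integral_triangle_mul {n d : ℕ} (hd : 2 ≤ d) {p : ℝ} (hp0 : 0 < p) (hp1 : p ≤ 1)
    {i j l : Fin n} (hij : i ≠ j) (hjl : j ≠ l) (hil : i ≠ l) {F : (Fin n → Sph d) → ℝ}
    (hF : Measurable F) {C : ℝ} (hC : ∀ U, |F U| ≤ C)
    (hj : ∀ U w, F (Function.update U j w) = F U) (hl : ∀ U w, F (Function.update U l w) = F U) :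
    ∫ U, capKernel p d (U i) (U j) * capKernel p d (U j) (U l) * capKernel p d (U i) (U l) * F U
      ∂latentLaw n d = triMean p d * ∫ U, F U ∂latentLaw n d := by
  have := isProbabilityMeasure_uniformSphere (d := d) (by omega)
  have hk := fun u v : Sph d => abs_capKernel_le hp0.le hp1 d u v
  have hm := measurable_capCodegree_eval (n := n) p (d := d) (by omega) i j
  rw [integral_pi_eq_integral_update (uniformSphere d) l (C := 1 * 1 * 1 * C) (by fun_prop)
    fun U => abs_mul_le_of_le (abs_mul_le_of_le (abs_mul_le_of_le (hk _ _) (hk _ _)) (hk _ _)) (hC U)]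
  have h1 : ∀ U : Fin n → Sph d, ∫ w, capKernel p d (U i) (U j) * capKernel p d (U j) w *
      capKernel p d (U i) w * F U ∂uniformSphere d =
      capKernel p d (U i) (U j) * capCodegree p d (U i) (U j) * F U := by
    intro U
    rw [integral_mul_const, capCodegree, ← integral_const_mul]
    congr 2
    ext w
    ring
  simp only [hl, Function.update_self, Function.update_of_ne hil, Function.update_of_ne hjl, h1]
  rw [integral_pi_eq_integral_update (uniformSphere d) j (C := 1 * 1 * C) (by fun_prop)
    fun U => abs_mul_le_of_le (abs_mul_le_of_le (hk _ _) (abs_capCodegree_le_one hd hp0 hp1 _ _))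
      (hC U)]
  simp only [hj, Function.update_self, Function.update_of_ne hij, integral_mul_const,
    integral_capKernel_mul_capCodegree hd hp0 hp1, integral_const_mul]

theorem integral_triangle {n d : ℕ} (hd : 2 ≤ d) {p : ℝ} (hp0 : 0 < p) (hp1 : p ≤ 1)
    {i j l : Fin n} (hij : i ≠ j) (hjl : j ≠ l) (hil : i ≠ l) :
    ∫ U, capKernel p d (U i) (U j) * capKernel p d (U j) (U l) * capKernel p d (U i) (U l)
      ∂latentLaw n d = triMean p d := by
  have := isProbabilityMeasure_uniformSphere (d := d) (by omega)
  have h := integral_triangle_mul (n := n) hd hp0 hp1 hij hjl hil (F := fun _ => 1)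
    measurable_const (C := 1) (by simp) (by simp) (by simp)
  simpa using h

/-- Two triangles sharing the edge `ab`: the common edge kernel is squared, and each of the two other
vertices contributes a codegree. -/
theorem integral_two_triangles_le {n d : ℕ} (hd : 2 ≤ d) {p : ℝ} (hp0 : 0 < p) (hp : p ≤ 1 / 2)
    {a b i j : Fin n} (hab : a ≠ b) (hai : a ≠ i) (hbi : b ≠ i) (haj : a ≠ j) (hbj : b ≠ j)
    (hij : i ≠ j) :
    ∫ U, capKernel p d (U a) (U b) ^ 2 * (capKernel p d (U a) (U i) * capKernel p d (U b) (U i) *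
      (capKernel p d (U a) (U j) * capKernel p d (U b) (U j))) ∂latentLaw n d ≤
        5 * p * triMean p d := by
  have := isProbabilityMeasure_uniformSphere (d := d) (by omega)
  have hp1 : p ≤ 1 := by linarith
  have hk := fun u v : Sph d => abs_capKernel_le hp0.le hp1 d u v
  have hk2 : ∀ u v : Sph d, |capKernel p d u v ^ 2| ≤ 1 * 1 := fun u v => by
    rw [sq]; exact abs_mul_le_of_le (hk _ _) (hk _ _)
  have hc := fun u v : Sph d => abs_capCodegree_le_one hd hp0 hp1 u v
  have hm := measurable_capCodegree_eval (n := n) p (d := d) (by omega) a b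
  have hcod : ∀ u v : Sph d, ∫ w, capKernel p d u w * capKernel p d v w ∂uniformSphere d =
      capCodegree p d u v := fun _ _ => rfl
  rw [integral_pi_eq_integral_update (uniformSphere d) i (by fun_prop)
    fun U => abs_mul_le_of_le (hk2 _ _) (abs_mul_le_of_le (abs_mul_le_of_le (hk _ _) (hk _ _))
      (abs_mul_le_of_le (hk _ _) (hk _ _)))]
  simp only [Function.update_self, Function.update_of_ne hai, Function.update_of_ne hbi,
    Function.update_of_ne hij.symm, integral_const_mul, integral_mul_const]
  simp only [hcod]
  rw [integral_pi_eq_integral_update (uniformSphere d) j (by fun_prop)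
    fun U => abs_mul_le_of_le (hk2 _ _) (abs_mul_le_of_le (hc _ _)
      (abs_mul_le_of_le (hk _ _) (hk _ _)))]
  simp only [Function.update_self, Function.update_of_ne haj, Function.update_of_ne hbj,
    integral_const_mul]
  simp only [hcod]
  rw [integral_pi_eq_integral_update (uniformSphere d) b (by fun_prop)
    fun U => abs_mul_le_of_le (hk2 _ _) (abs_mul_le_of_le (hc _ _) (hc _ _))]
  simp only [Function.update_self, Function.update_of_ne hab, ← sq]
  calc _ ≤ ∫ U : Fin n → Sph d, 5 * p * triMean p d ∂latentLaw n d := by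
        refine integral_mono_of_nonneg (Eventually.of_forall fun U => ?_) (integrable_const _)
          (Eventually.of_forall fun U => ?_)
        · exact integral_nonneg fun w => by positivity
        · exact integral_capKernel_sq_mul_capCodegree_sq_le hd hp0 hp (U a)
    _ = _ := by simp

/-! ### Moments of signed triangles under the planted model -/

/-- The probability that a vertex belongs to the community. -/
noncomputable def memProb (n : ℕ) (k : ℝ) : unitInterval :=
  Set.projIcc (0 : ℝ) 1 zero_le_one (k / n)

/-- When the vertices covered by the edges in `E` are those of `W`, the community contributes the factor
`(k / n) ^ |W|` and the latent vectors contribute the integral of the product of kernels. -/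
theorem integral_prod_edgeVar_of_condEdge {n : ℕ} (p : unitInterval) {d : ℕ} (hd : 1 ≤ d) (k : ℝ)
    {E : Finset (Sym2 (Fin n))} (hE : ∀ e ∈ E, ¬ e.IsDiag) (W : Finset (Fin n))
    (K : (Fin n → Sph d) → ℝ)
    (h : ∀ S U, ∏ e ∈ E, condEdge (p : ℝ) S U e = (∏ i ∈ W, memVar S i) * K U) :
    ∫ G, ∏ e ∈ E, edgeVar p G e ∂plantedModel n p d k =
      (memProb n k : ℝ) ^ W.card * ∫ U, K U ∂latentLaw n d := by
  rw [integral_plantedModel_prod_edgeVar p hd k hE]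
  simp only [h, integral_const_mul, integral_mul_const]
  rw [← integral_prod_memVar (memProb n k) W]
  rfl

/-- The pairs of distinct elements of a set of vertices. -/
def pairSet {n : ℕ} (A : Finset (Fin n)) : Finset (Sym2 (Fin n)) := {e ∈ A.sym2 | ¬ e.IsDiag}

theorem not_isDiag_of_mem_pairSet {n : ℕ} {A : Finset (Fin n)} : ∀ e ∈ pairSet A, ¬ e.IsDiag :=
  fun _ he => (Finset.mem_filter.1 he).2

theorem pairSet_triple {n : ℕ} {i j l : Fin n} (hij : i ≠ j) (hjl : j ≠ l) (hil : i ≠ l) :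
    pairSet {i, j, l} = {s(i, j), s(j, l), s(i, l)} := by
  ext e
  induction e with
  | _ x y =>
    simp only [pairSet, Finset.mem_filter, Finset.mk_mem_sym2_iff, Finset.mem_insert,
      Finset.mem_singleton, Sym2.mk_isDiag_iff, Sym2.eq_iff]
    grind

/-- The product of the centered edge indicators over the pairs of vertices in `A`; for three vertices,
this is their signed triangle. -/
noncomputable def triVar {n : ℕ} (p : ℝ) (A : Finset (Fin n)) (G : SimpleGraph (Fin n)) : ℝ :=
  ∏ e ∈ pairSet A, edgeVar p G e

theorem prod_pairSet_triple {n : ℕ} {i j l : Fin n} (hij : i ≠ j) (hjl : j ≠ l) (hil : i ≠ l)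
    (f : Sym2 (Fin n) → ℝ) :
    ∏ e ∈ pairSet {i, j, l}, f e = f s(i, j) * f s(j, l) * f s(i, l) := by
  rw [pairSet_triple hij hjl hil, Finset.prod_insert, Finset.prod_insert, Finset.prod_singleton,
    mul_assoc]
  · simp; grind
  · simp; grind

theorem triVar_triple {n : ℕ} (p : ℝ) {i j l : Fin n} (hij : i ≠ j) (hjl : j ≠ l) (hil : i ≠ l)
    (G : SimpleGraph (Fin n)) : triVar p {i, j, l} G = signedTriangle p G i j l := by
  rw [triVar, prod_pairSet_triple hij hjl hil, signedTriangle]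
  simp only [centeredEdge_eq_edgeVar]

theorem prod_condEdge_triple {n d : ℕ} (p : ℝ) {i j l : Fin n} (hij : i ≠ j) (hjl : j ≠ l)
    (hil : i ≠ l) (S : Set (Fin n)) (U : Fin n → Sph d) :
    ∏ e ∈ pairSet {i, j, l}, condEdge p S U e = (∏ x ∈ {i, j, l}, memVar S x) *
      (capKernel p d (U i) (U j) * capKernel p d (U j) (U l) * capKernel p d (U i) (U l)) := by
  rw [prod_pairSet_triple hij hjl hil, Finset.prod_insert (by simp [hij, hil]),
    Finset.prod_insert (by simp [hjl]), Finset.prod_singleton]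
  simp only [condEdge_mk]
  linear_combination (capKernel p d (U i) (U j) * capKernel p d (U j) (U l) *
    capKernel p d (U i) (U l)) * (memVar S j * memVar S j * memVar S l * memVar S l *
      memVar_mul_self S i + memVar S i * memVar S l * memVar S l * memVar_mul_self S j +
      memVar S i * memVar S j * memVar_mul_self S l)

theorem prod_memVar_mul {n : ℕ} (S : Set (Fin n)) (A B : Finset (Fin n)) :
    (∏ x ∈ A, memVar S x) * ∏ x ∈ B, memVar S x = ∏ x ∈ A ∪ B, memVar S x := by
  rw [← Finset.prod_union_inter, ← Finset.prod_sdiff (Finset.inter_subset_union (s := A) (t := B)),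
    mul_assoc, ← Finset.prod_mul_distrib]
  simp only [memVar_mul_self]

theorem integral_triVar {n : ℕ} {p : unitInterval} {d : ℕ} (hd : 2 ≤ d) (k : ℝ) (hp0 : 0 < (p : ℝ))
    {A : Finset (Fin n)} (hA : A.card = 3) :
    ∫ G, triVar p A G ∂plantedModel n p d k = (memProb n k : ℝ) ^ 3 * triMean p d := by
  obtain ⟨i, j, l, hij, hil, hjl, rfl⟩ := Finset.card_eq_three.1 hA
  unfold triVar
  rw [integral_prod_edgeVar_of_condEdge p (by omega) k not_isDiag_of_mem_pairSet {i, j, l} _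
    (prod_condEdge_triple (p : ℝ) hij hjl hil), integral_triangle hd hp0 p.2.2 hij hjl hil, hA]

theorem exists_triple_of_card_inter_le_one {n : ℕ} {A B : Finset (Fin n)} (hA : A.card = 3)
    (hAB : (A ∩ B).card ≤ 1) :
    ∃ i j l, i ≠ j ∧ j ≠ l ∧ i ≠ l ∧ A = {i, j, l} ∧ j ∉ B ∧ l ∉ B := by
  obtain ⟨x, y, z, hxy, hxz, hyz, rfl⟩ := Finset.card_eq_three.1 hA
  have h := Finset.card_le_one.1 hAB
  have hx : x ∈ B → y ∉ B ∧ z ∉ B := fun hx => ⟨fun hy => hxy (h x (by simp [hx]) y (by simp [hy])),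
    fun hz => hxz (h x (by simp [hx]) z (by simp [hz]))⟩
  have hy : y ∈ B → z ∉ B := fun hy hz => hyz (h y (by simp [hy]) z (by simp [hz]))
  by_cases h1 : x ∈ B
  · exact ⟨x, y, z, hxy, hyz, hxz, rfl, hx h1⟩
  · by_cases h2 : y ∈ B
    · exact ⟨y, x, z, hxy.symm, hxz, hyz, Finset.insert_comm _ _ _, h1, hy h2⟩
    · refine ⟨z, x, y, hxz.symm, hxy, hyz.symm, ?_, h1, h2⟩
      ext; simp; tauto

/-- Signed triangles without a common edge are uncorrelated given the community. -/
theorem integral_triVar_mul_triVar {n : ℕ} {p : unitInterval} {d : ℕ} (hd : 2 ≤ d) (k : ℝ)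
    (hp0 : 0 < (p : ℝ)) {A B : Finset (Fin n)} (hA : A.card = 3) (hB : B.card = 3)
    (hAB : (A ∩ B).card ≤ 1) :
    ∫ G, triVar p A G * triVar p B G ∂plantedModel n p d k =
      (memProb n k : ℝ) ^ (A ∪ B).card * triMean p d ^ 2 := by
  have := isProbabilityMeasure_uniformSphere (d := d) (by omega)
  obtain ⟨i, j, l, hij, hjl, hil, hAe, hjB, hlB⟩ := exists_triple_of_card_inter_le_one hA hAB
  obtain ⟨a, b, c, hab, hac, hbc, hBe⟩ := Finset.card_eq_three.1 hB
  have hdisj : Disjoint (pairSet A) (pairSet B) := by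
    rw [Finset.disjoint_left]
    intro e heA heB
    induction e with
    | _ x y =>
      simp only [pairSet, Finset.mem_filter, Finset.mk_mem_sym2_iff, Sym2.mk_isDiag_iff] at heA heB
      exact heA.2 (Finset.card_le_one.1 hAB x (by simp [heA, heB]) y (by simp [heA, heB]))
  have hk := fun u v : Sph d => abs_capKernel_le hp0.le p.2.2 d u v
  unfold triVar
  simp_rw [← Finset.prod_union hdisj]
  have hja : j ≠ a ∧ j ≠ b ∧ j ≠ c := by simpa [hBe] using hjB
  have hla : l ≠ a ∧ l ≠ b ∧ l ≠ c := by simpa [hBe] using hlB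
  rw [integral_prod_edgeVar_of_condEdge p (by omega) k (fun e he => ?_) (A ∪ B)
    (fun U => capKernel p d (U i) (U j) * capKernel p d (U j) (U l) * capKernel p d (U i) (U l) *
      (capKernel p d (U a) (U b) * capKernel p d (U b) (U c) * capKernel p d (U a) (U c)))
    (fun S U => ?_)]
  · rw [integral_triangle_mul hd hp0 p.2.2 hij hjl hil (C := 1 * 1 * 1) (by fun_prop)
      (fun U => abs_mul_le_of_le (abs_mul_le_of_le (hk _ _) (hk _ _)) (hk _ _))
      (fun U w => by simp [Function.update_of_ne, hja.1.symm, hja.2.1.symm, hja.2.2.symm])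
      (fun U w => by simp [Function.update_of_ne, hla.1.symm, hla.2.1.symm, hla.2.2.symm]),
      integral_triangle hd hp0 p.2.2 hab hbc hac, sq]
  · rcases Finset.mem_union.1 he with he | he <;> exact not_isDiag_of_mem_pairSet e he
  · rw [Finset.prod_union hdisj, ← prod_memVar_mul, hAe, hBe, prod_condEdge_triple _ hij hjl hil,
      prod_condEdge_triple _ hab hbc hac]
    ring

theorem measurable_prod_edgeVar {n : ℕ} (p : ℝ) (E : Finset (Sym2 (Fin n))) :
    Measurable fun G : SimpleGraph (Fin n) => ∏ e ∈ E, edgeVar p G e :=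
  Finset.measurable_prod _ fun e _ => measurable_edgeVar p e

theorem abs_prod_edgeVar_le {n : ℕ} {p : ℝ} (hp0 : 0 ≤ p) (hp1 : p ≤ 1) (E : Finset (Sym2 (Fin n)))
    (G : SimpleGraph (Fin n)) : |∏ e ∈ E, edgeVar p G e| ≤ 1 := by
  rw [Finset.abs_prod]
  exact Finset.prod_le_one (fun _ _ => abs_nonneg _) fun e _ => abs_edgeVar_le hp0 hp1 G e

theorem integrable_prod_edgeVar {n : ℕ} (p : unitInterval) {d : ℕ} (hd : 1 ≤ d) (k : ℝ)
    (E : Finset (Sym2 (Fin n))) :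
    Integrable (fun G => ∏ e ∈ E, edgeVar p G e) (plantedModel n p d k) :=
  integrable_plantedModel p hd k (measurable_prod_edgeVar _ E)
    (abs_prod_edgeVar_le p.2.1 p.2.2 E)

theorem integral_add_add {α : Type*} [MeasurableSpace α] {μ : Measure α} {f g h : α → ℝ}
    (hf : Integrable f μ) (hg : Integrable g μ) (hh : Integrable h μ) :
    ∫ a, (f a + g a + h a) ∂μ = ∫ a, f a ∂μ + ∫ a, g a ∂μ + ∫ a, h a ∂μ := by
  have hfg : Integrable (fun a => f a + g a) μ := hf.add hg
  rw [integral_add hfg hh, integral_add hf hg]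

theorem exists_of_card_inter_eq_two {n : ℕ} {A B : Finset (Fin n)} (hA : A.card = 3)
    (hB : B.card = 3) (hAB : (A ∩ B).card = 2) :
    ∃ a b i j, a ≠ b ∧ a ≠ i ∧ b ≠ i ∧ a ≠ j ∧ b ≠ j ∧ i ≠ j ∧ A = {i, a, b} ∧ B = {j, a, b} := by
  obtain ⟨a, b, hab, h⟩ := Finset.card_eq_two.1 hAB
  have h1 : (A \ B).card = 1 := by have := Finset.card_sdiff_add_card_inter A B; omega
  have h2 : (B \ A).card = 1 := by
    have := Finset.card_sdiff_add_card_inter B A; rw [Finset.inter_comm] at this; omega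
  obtain ⟨i, hi⟩ := Finset.card_eq_one.1 h1
  obtain ⟨j, hj⟩ := Finset.card_eq_one.1 h2
  have hAe : A = {i, a, b} := by
    rw [← Finset.sdiff_union_inter A B, hi, h]; rfl
  have hBe : B = {j, a, b} := by
    rw [← Finset.sdiff_union_inter B A, hj, Finset.inter_comm, h]; rfl
  have hi' : i ∈ A \ B := by simp [hi]
  have hj' : j ∈ B \ A := by simp [hj]
  have ha : a ∈ A ∩ B := by simp [h]
  have hb : b ∈ A ∩ B := by simp [h]
  simp only [Finset.mem_sdiff, Finset.mem_inter] at hi' hj' ha hb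
  refine ⟨a, b, i, j, hab, ?_, ?_, ?_, ?_, ?_, hAe, hBe⟩ <;> rintro rfl <;> tauto

/-- The covariance of two signed triangles with a common edge. -/
theorem integral_triVar_mul_triVar_le_of_inter_eq_two {n : ℕ} {p : unitInterval} {d : ℕ}
    (hd : 2 ≤ d) (k : ℝ) (hp0 : 0 < (p : ℝ)) (hp : (p : ℝ) ≤ 1 / 2) {A B : Finset (Fin n)}
    (hA : A.card = 3) (hB : B.card = 3) (hAB : (A ∩ B).card = 2) :
    ∫ G, triVar p A G * triVar p B G ∂plantedModel n p d k ≤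
      (memProb n k : ℝ) ^ 4 * (5 * p * triMean p d) := by
  have := isProbabilityMeasure_uniformSphere (d := d) (by omega)
  obtain ⟨a, b, i, j, hab, hai, hbi, haj, hbj, hij, rfl, rfl⟩ := exists_of_card_inter_eq_two hA hB hAB
  set E : Finset (Sym2 (Fin n)) := {s(a, i), s(b, i), s(a, j), s(b, j)} with hE
  have hEprod : ∀ f : Sym2 (Fin n) → ℝ,
      ∏ e ∈ E, f e = f s(a, i) * f s(b, i) * (f s(a, j) * f s(b, j)) := by
    intro f
    rw [hE, Finset.prod_insert, Finset.prod_insert, Finset.prod_insert, Finset.prod_singleton]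
    · ring
    · simp; grind
    · simp; grind
    · simp; grind
  have hnot : s(a, b) ∉ E := by simp [hE]; grind
  have hEd : ∀ e ∈ E, ¬ e.IsDiag := by simp [hE, hai, hbi, haj, hbj]
  have hEd' : ∀ e ∈ insert s(a, b) E, ¬ e.IsDiag := by
    intro e he
    rcases Finset.mem_insert.1 he with rfl | he
    · simpa using hab
    · exact hEd e he
  have hW : ∀ S : Set (Fin n), ∏ x ∈ {a, b, i, j}, memVar S x =
      memVar S a * memVar S b * memVar S i * memVar S j := by
    intro S
    rw [Finset.prod_insert (by simp [hab, hai, haj]), Finset.prod_insert (by simp [hbi, hbj]),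
      Finset.prod_insert (by simp [hij]), Finset.prod_singleton]
    ring
  have hWc : ({a, b, i, j} : Finset (Fin n)).card = 4 := by
    rw [Finset.card_insert_of_notMem (by simp [hab, hai, haj]),
      Finset.card_insert_of_notMem (by simp [hbi, hbj]),
      Finset.card_insert_of_notMem (by simp [hij]), Finset.card_singleton]
  let K : (Fin n → Sph d) → ℝ := fun U => capKernel p d (U a) (U i) * capKernel p d (U b) (U i) *
      (capKernel p d (U a) (U j) * capKernel p d (U b) (U j))
  have hKm : Measurable K := by fun_prop
  have hk := fun u v : Sph d => abs_capKernel_le hp0.le p.2.2 d u v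
  have hKb : ∀ U, |K U| ≤ 1 * 1 * (1 * 1) := fun U =>
    abs_mul_le_of_le (abs_mul_le_of_le (hk _ _) (hk _ _)) (abs_mul_le_of_le (hk _ _) (hk _ _))
  have h1 := integral_prod_edgeVar_of_condEdge p (d := d) (by omega) k hEd {a, b, i, j} K
    (fun S U => by
      rw [hEprod, hW]
      simp only [condEdge_mk, K]
      linear_combination (capKernel p d (U a) (U i) * capKernel p d (U b) (U i) *
        (capKernel p d (U a) (U j) * capKernel p d (U b) (U j))) *
        (memVar S b * memVar S b * memVar S i * memVar S i * memVar S j * memVar S j *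
          memVar_mul_self S a + memVar S a * memVar S i * memVar S i * memVar S j * memVar S j *
          memVar_mul_self S b + memVar S a * memVar S b * memVar S j * memVar S j *
          memVar_mul_self S i + memVar S a * memVar S b * memVar S i * memVar_mul_self S j))
  have h2 := integral_prod_edgeVar_of_condEdge p (d := d) (by omega) k hEd' {a, b, i, j}
    (fun U => capKernel p d (U a) (U b) * K U)
    (fun S U => by
      rw [Finset.prod_insert hnot, hEprod, hW]
      simp only [condEdge_mk, K]
      by_cases ha : a ∈ S <;> by_cases hb : b ∈ S <;> by_cases hi : i ∈ S <;>
        by_cases hj : j ∈ S <;> simp [memVar, ha, hb, hi, hj])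
  have hT : ∀ G : SimpleGraph (Fin n), triVar p {i, a, b} G * triVar p {j, a, b} G =
      p * (1 - p) * (∏ e ∈ E, edgeVar (p : ℝ) G e) +
        (1 - 2 * p) * ∏ e ∈ insert s(a, b) E, edgeVar (p : ℝ) G e := by
    intro G
    rw [triVar, triVar, prod_pairSet_triple hai.symm hab hbi.symm,
      prod_pairSet_triple haj.symm hab hbj.symm, Finset.prod_insert hnot, hEprod,
      Sym2.eq_swap (a := i) (b := a), Sym2.eq_swap (a := i) (b := b),
      Sym2.eq_swap (a := j) (b := a), Sym2.eq_swap (a := j) (b := b)]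
    linear_combination (edgeVar (p : ℝ) G s(a, i) * edgeVar (p : ℝ) G s(b, i) *
      (edgeVar (p : ℝ) G s(a, j) * edgeVar (p : ℝ) G s(b, j))) * edgeVar_sq (p : ℝ) G s(a, b)
  have i1 := integrable_prod_edgeVar p (d := d) (by omega) k E
  have i2 := integrable_prod_edgeVar p (d := d) (by omega) k (insert s(a, b) E)
  simp_rw [hT]
  rw [integral_add (i1.const_mul _) (i2.const_mul _), integral_const_mul, integral_const_mul, h1, h2,
    hWc]
  have j1 : Integrable K (latentLaw n d) :=
    Integrable.of_bound hKm.aestronglyMeasurable _ (Eventually.of_forall hKb)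
  have j2 : Integrable (fun U => capKernel p d (U a) (U b) * K U) (latentLaw n d) :=
    Integrable.of_bound (by fun_prop) _ (Eventually.of_forall fun U =>
      abs_mul_le_of_le (hk (U a) (U b)) (hKb U))
  have h3 : ∀ U : Fin n → Sph d, capKernel p d (U a) (U b) ^ 2 * K U =
      p * (1 - p) * K U + (1 - 2 * p) * (capKernel p d (U a) (U b) * K U) := by
    intro U
    have : capKernel p d (U a) (U b) ^ 2 =
        p * (1 - p) + (1 - 2 * p) * capKernel p d (U a) (U b) := by
      unfold capKernel
      by_cases h : U b ∈ sphCap (tau p d) (U a) <;> simp [h] <;> ring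
    rw [this]; ring
  have h4 := integral_two_triangles_le (n := n) hd hp0 hp hab hai hbi haj hbj hij
  change ∫ U, capKernel p d (U a) (U b) ^ 2 * K U ∂latentLaw n d ≤ _ at h4
  simp_rw [h3] at h4
  rw [integral_add (j1.const_mul _) (j2.const_mul _), integral_const_mul, integral_const_mul] at h4
  have h5 := mul_le_mul_of_nonneg_left h4 (pow_nonneg (memProb n k).2.1 4)
  linarith

/-- The second moment of a signed triangle. -/
theorem integral_triVar_sq_le {n : ℕ} {p : unitInterval} {d : ℕ} (hd : 2 ≤ d) (k : ℝ)
    (hp0 : 0 < (p : ℝ)) (hp : (p : ℝ) ≤ 1 / 2) (hT0 : 0 ≤ triMean p d) {A : Finset (Fin n)}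
    (hA : A.card = 3) :
    ∫ G, triVar p A G * triVar p A G ∂plantedModel n p d k ≤
      (p : ℝ) ^ 3 + (memProb n k : ℝ) ^ 3 * triMean p d := by
  have := isProbabilityMeasure_uniformSphere (d := d) (by omega)
  have := isProbabilityMeasure_plantedModel n p (d := d) (by omega) k
  have h3 := integral_triVar hd k hp0 hA
  obtain ⟨i, j, l, hij, hil, hjl, rfl⟩ := Finset.card_eq_three.1 hA
  have e1 : ∀ {x y : Fin n}, x ≠ y → ∫ G, edgeVar (p : ℝ) G s(x, y) ∂plantedModel n p d k = 0 := by
    intro x y hxy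
    have h := integral_prod_edgeVar_of_condEdge p (d := d) (by omega) k (E := {s(x, y)})
      (by simpa using hxy) {x, y} (fun U => capKernel p d (U x) (U y) * 1) (fun S U => by
        rw [Finset.prod_singleton, Finset.prod_pair hxy, condEdge_mk, mul_one])
    rw [integral_capKernel_mul_eq_zero hd hp0 p.2.2 hxy measurable_const (C := 1) (by simp)
      (by simp)] at h
    simpa using h
  have e2 : ∀ {x y z : Fin n}, x ≠ y → y ≠ z → x ≠ z →
      ∫ G, edgeVar (p : ℝ) G s(x, y) * edgeVar (p : ℝ) G s(y, z) ∂plantedModel n p d k = 0 := by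
    intro x y z hxy hyz hxz
    have hne : s(x, y) ≠ s(y, z) := by simp; grind
    have h := integral_prod_edgeVar_of_condEdge p (d := d) (by omega) k (E := {s(x, y), s(y, z)})
      (by simp [hxy, hyz]) {x, y, z}
      (fun U => capKernel p d (U y) (U z) * capKernel p d (U x) (U y)) (fun S U => by
        rw [Finset.prod_pair hne, Finset.prod_insert (by simp [hxy, hxz]), Finset.prod_pair hyz,
          condEdge_mk, condEdge_mk]
        linear_combination (capKernel p d (U y) (U z) * capKernel p d (U x) (U y)) *
          memVar S x * memVar S z * memVar_mul_self S y)
    rw [integral_capKernel_mul_eq_zero hd hp0 p.2.2 hyz (by fun_prop)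
      (fun U => abs_capKernel_le hp0.le p.2.2 d (U x) (U y))
      (fun U w => by rw [Function.update_of_ne hxz, Function.update_of_ne hyz])] at h
    simpa [Finset.prod_pair hne] using h
  have hx := fun G : SimpleGraph (Fin n) => edgeVar_sq (p : ℝ) G s(i, j)
  have hy := fun G : SimpleGraph (Fin n) => edgeVar_sq (p : ℝ) G s(j, l)
  have hz := fun G : SimpleGraph (Fin n) => edgeVar_sq (p : ℝ) G s(i, l)
  set c : ℝ := p * (1 - p) with hc
  set r : ℝ := 1 - 2 * p with hr
  let X : SimpleGraph (Fin n) → ℝ := fun G => edgeVar (p : ℝ) G s(i, j)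
  let Y : SimpleGraph (Fin n) → ℝ := fun G => edgeVar (p : ℝ) G s(j, l)
  let Z : SimpleGraph (Fin n) → ℝ := fun G => edgeVar (p : ℝ) G s(i, l)
  have hT : ∀ G : SimpleGraph (Fin n), triVar p {i, j, l} G = X G * Y G * Z G := fun G =>
    prod_pairSet_triple hij hjl hil _
  have hsq : ∀ G, triVar p {i, j, l} G * triVar p {i, j, l} G =
      c ^ 3 + c ^ 2 * r * (X G + Y G + Z G) + c * r ^ 2 * (X G * Y G + Y G * Z G + Z G * X G) +
        r ^ 3 * triVar p {i, j, l} G := by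
    intro G
    rw [hT]
    have hx : X G ^ 2 = c + r * X G := hx G
    have hy : Y G ^ 2 = c + r * Y G := hy G
    have hz : Z G ^ 2 = c + r * Z G := hz G
    calc _ = X G ^ 2 * Y G ^ 2 * Z G ^ 2 := by ring
      _ = _ := by rw [hx, hy, hz]; ring
  have iX : ∀ e, Integrable (fun G => edgeVar (p : ℝ) G e) (plantedModel n p d k) := fun e =>
    integrable_plantedModel p (by omega) k (measurable_edgeVar _ e) (abs_edgeVar_le p.2.1 p.2.2 · e)
  have iXY : ∀ e f, Integrable (fun G => edgeVar (p : ℝ) G e * edgeVar (p : ℝ) G f)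
      (plantedModel n p d k) := fun e f =>
    integrable_plantedModel p (by omega) k ((measurable_edgeVar _ e).mul (measurable_edgeVar _ f))
      fun G => abs_mul_le_of_le (abs_edgeVar_le p.2.1 p.2.2 G e) (abs_edgeVar_le p.2.1 p.2.2 G f)
  have iT : Integrable (triVar (p : ℝ) {i, j, l}) (plantedModel n p d k) :=
    integrable_prod_edgeVar p (by omega) k _
  have i1 : Integrable (fun G => X G + Y G + Z G) (plantedModel n p d k) :=
    ((iX _).add (iX _)).add (iX _)
  have i2 : Integrable (fun G => X G * Y G + Y G * Z G + Z G * X G) (plantedModel n p d k) :=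
    ((iXY _ _).add (iXY _ _)).add (iXY _ _)
  have v1 : ∫ G, (X G + Y G + Z G) ∂plantedModel n p d k = 0 := by
    rw [integral_add_add (iX _) (iX _) (iX _), e1 hij, e1 hjl, e1 hil]
    simp
  have v2 : ∫ G, (X G * Y G + Y G * Z G + Z G * X G) ∂plantedModel n p d k = 0 := by
    have a1 := e2 hij hjl hil
    have a2 := e2 hjl hil.symm hij.symm
    have a3 := e2 hil.symm hij hjl.symm
    rw [Sym2.eq_swap (a := l) (b := i)] at a2 a3
    rw [integral_add_add (iXY _ _) (iXY _ _) (iXY _ _), a1, a2, a3]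
    simp
  have i3 : Integrable (fun G => c ^ 3 + c ^ 2 * r * (X G + Y G + Z G)) (plantedModel n p d k) :=
    (integrable_const _).add (i1.const_mul _)
  simp_rw [hsq]
  rw [integral_add_add i3 (i2.const_mul _) (iT.const_mul _),
    integral_add (integrable_const _) (i1.const_mul _), integral_const_mul, integral_const_mul,
    integral_const_mul, v1, v2, h3]
  have hq : 0 ≤ (memProb n k : ℝ) ^ 3 * triMean p d :=
    mul_nonneg (pow_nonneg (memProb n k).2.1 3) hT0
  have hr0 : 0 ≤ r := by rw [hr]; linarith
  have hr1 : r ^ 3 ≤ 1 := pow_le_one₀ hr0 (by rw [hr]; linarith)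
  have hc3 : c ^ 3 ≤ (p : ℝ) ^ 3 := pow_le_pow_left₀ (by rw [hc]; nlinarith) (by rw [hc]; nlinarith) 3
  have := mul_le_mul_of_nonneg_right hr1 hq
  simp only [integral_const, probReal_univ, one_smul, mul_zero, add_zero]
  linarith

/-! ### The variance of the signed triangle count -/

theorem fTri_eq_sum_triVar {n : ℕ} (p : ℝ) (G : SimpleGraph (Fin n)) :
    fTri p G = ∑ A ∈ Finset.powersetCard 3 Finset.univ, triVar p A G := by
  unfold fTri
  rw [Finset.sum_sigma', Finset.sum_sigma']
  refine Finset.sum_nbij (fun y => {y.1.1, y.1.2, y.2}) ?_ ?_ ?_ ?_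
  · rintro ⟨⟨i, j⟩, l⟩ h
    simp only [Finset.mem_sigma, Finset.mem_univ, Finset.mem_Ioi, true_and] at h
    simp only [Finset.mem_powersetCard, Finset.subset_univ, true_and]
    exact Finset.card_eq_three.2 ⟨i, j, l, h.1.ne, (h.1.trans h.2).ne, h.2.ne, rfl⟩
  · rintro ⟨⟨i, j⟩, l⟩ h ⟨⟨a, b⟩, c⟩ h' heq
    simp only [Finset.coe_sigma, Set.mem_sigma_iff, Finset.coe_univ, Set.mem_univ, Finset.coe_Ioi,
      Set.mem_Ioi, true_and] at h h'
    have hm : ∀ x, x = i ∨ x = j ∨ x = l ↔ x = a ∨ x = b ∨ x = c := fun x => by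
      have := Finset.ext_iff.1 heq x
      simpa using this
    have h1 := (hm i).1 (by simp)
    have h2 := (hm j).1 (by simp)
    have h3 := (hm l).1 (by simp)
    have h4 := (hm a).2 (by simp)
    have h5 := (hm b).2 (by simp)
    have h6 := (hm c).2 (by simp)
    have key : i = a ∧ j = b ∧ l = c := by omega
    obtain ⟨rfl, rfl, rfl⟩ := key
    rfl
  · intro A hA
    have hA3 : A.card = 3 := (Finset.mem_powersetCard.1 hA).2
    have hmono := (A.orderEmbOfFin hA3).strictMono
    refine ⟨⟨⟨A.orderEmbOfFin hA3 0, A.orderEmbOfFin hA3 1⟩, A.orderEmbOfFin hA3 2⟩, ?_, ?_⟩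
    · simp only [Finset.coe_sigma, Set.mem_sigma_iff, Finset.coe_univ, Set.mem_univ, Finset.coe_Ioi,
        Set.mem_Ioi, true_and]
      exact ⟨hmono (by decide), hmono (by decide)⟩
    · ext x
      have := Set.ext_iff.1 (A.range_orderEmbOfFin hA3) x
      simp only [Set.mem_range, Fin.exists_fin_succ, Finset.mem_coe] at this
      rw [← this]
      simp [eq_comm]
  · rintro ⟨⟨i, j⟩, l⟩ h
    simp only [Finset.mem_sigma, Finset.mem_univ, Finset.mem_Ioi, true_and] at h
    exact (triVar_triple p h.1.ne h.2.ne (h.1.trans h.2).ne G).symm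

/-- A set `B` is determined by `A ∩ B` and `B \ A`. -/
theorem card_filter_inter_card_le {n : ℕ} {A : Finset (Fin n)} (hA : A.card = 3) {m r : ℕ}
    (hmr : m + r = 3) :
    ((Finset.powersetCard 3 Finset.univ).filter fun B => (A ∩ B).card = m).card ≤
      Nat.choose 3 m * n ^ r := by
  calc _ ≤ (Finset.powersetCard m A ×ˢ Finset.powersetCard r (Finset.univ : Finset (Fin n))).card := by
        refine Finset.card_le_card_of_injOn (fun B => (A ∩ B, B \ A)) ?_ ?_
        · intro B hB
          simp only [Finset.coe_filter, Set.mem_ofPred_eq, Finset.mem_powersetCard] at hB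
          simp only [Finset.coe_product, Set.mem_prod, Finset.mem_coe, Finset.mem_powersetCard]
          refine ⟨⟨Finset.inter_subset_left, hB.2⟩, Finset.subset_univ _, ?_⟩
          have := Finset.card_sdiff_add_card_inter B A
          rw [Finset.inter_comm] at this
          omega
        · intro B _ B' _ h
          simp only [Prod.mk.injEq] at h
          rw [← Finset.sdiff_union_inter B A, ← Finset.sdiff_union_inter B' A, h.2,
            Finset.inter_comm, h.1, Finset.inter_comm]
    _ ≤ _ := by
        rw [Finset.card_product, Finset.card_powersetCard, Finset.card_powersetCard, hA,
          Finset.card_univ, Fintype.card_fin]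
        exact Nat.mul_le_mul_left _ (Nat.choose_le_pow n r)

theorem measurable_fTri {n : ℕ} (p : ℝ) : Measurable (fTri (n := n) p) := by
  have : fTri (n := n) p = fun G => ∑ A ∈ Finset.powersetCard 3 Finset.univ, triVar p A G :=
    funext (fTri_eq_sum_triVar p)
  rw [this]
  exact Finset.measurable_sum _ fun A _ => measurable_prod_edgeVar p (pairSet A)

theorem integrable_triVar {n : ℕ} (p : unitInterval) {d : ℕ} (hd : 1 ≤ d) (k : ℝ)
    (A : Finset (Fin n)) : Integrable (triVar (p : ℝ) A) (plantedModel n p d k) :=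
  integrable_prod_edgeVar p hd k _

theorem integrable_triVar_mul {n : ℕ} (p : unitInterval) {d : ℕ} (hd : 1 ≤ d) (k : ℝ)
    (A B : Finset (Fin n)) :
    Integrable (fun G => triVar (p : ℝ) A G * triVar (p : ℝ) B G) (plantedModel n p d k) :=
  integrable_plantedModel p hd k
    ((measurable_prod_edgeVar _ (pairSet A)).mul (measurable_prod_edgeVar _ (pairSet B)))
    fun G => abs_mul_le_of_le (abs_prod_edgeVar_le p.2.1 p.2.2 _ G)
      (abs_prod_edgeVar_le p.2.1 p.2.2 _ G)

theorem memLp_fTri {n : ℕ} (p : unitInterval) {d : ℕ} (hd : 1 ≤ d) (k : ℝ) :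
    MemLp (fTri (p : ℝ)) 2 (plantedModel n p d k) := by
  have := isProbabilityMeasure_plantedModel n p hd k
  refine MemLp.of_bound (measurable_fTri _).aestronglyMeasurable
    (∑ A ∈ Finset.powersetCard 3 (Finset.univ : Finset (Fin n)), 1) (Eventually.of_forall fun G => ?_)
  rw [fTri_eq_sum_triVar, Real.norm_eq_abs]
  exact (Finset.abs_sum_le_sum_abs _ _).trans
    (Finset.sum_le_sum fun A _ => abs_prod_edgeVar_le p.2.1 p.2.2 _ G)

theorem plantedMean_eq {n : ℕ} {p : unitInterval} {d : ℕ} (hd : 2 ≤ d) (k : ℝ)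
    (hp0 : 0 < (p : ℝ)) :
    plantedMean n p d k = n.choose 3 * ((memProb n k : ℝ) ^ 3 * triMean p d) := by
  unfold plantedMean
  simp_rw [fTri_eq_sum_triVar]
  rw [integral_finsetSum _ fun A _ => integrable_triVar p (by omega) k A,
    Finset.sum_congr rfl fun A hA => integral_triVar hd k hp0 (Finset.mem_powersetCard.1 hA).2,
    Finset.sum_const, Finset.card_powersetCard, Finset.card_univ, Fintype.card_fin, nsmul_eq_mul]

/-- The three terms collect the pairs of triples that share one, two and three vertices; triples without a
common vertex are uncorrelated. -/
theorem variance_fTri_le {n : ℕ} {p : unitInterval} {d : ℕ} (hd : 2 ≤ d) (k : ℝ)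
    (hp0 : 0 < (p : ℝ)) (hp : (p : ℝ) ≤ 1 / 2) (hT0 : 0 ≤ triMean p d) :
    variance (fTri (p : ℝ)) (plantedModel n p d k) ≤
      (n : ℝ) ^ 3 * (3 * (n : ℝ) ^ 2 * (memProb n k : ℝ) ^ 5 * triMean p d ^ 2 +
        15 * n * (memProb n k : ℝ) ^ 4 * p * triMean p d +
        (p ^ 3 + (memProb n k : ℝ) ^ 3 * triMean p d)) := by
  have := isProbabilityMeasure_plantedModel n p (d := d) (by omega) k
  set q : ℝ := (memProb n k : ℝ) with hq
  have hq0 : 0 ≤ q := (memProb n k).2.1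
  set μ := triMean (p : ℝ) d with hμ
  set 𝒜 := Finset.powersetCard 3 (Finset.univ : Finset (Fin n)) with h𝒜
  have h𝒜c : 𝒜.card = n.choose 3 := by
    rw [h𝒜, Finset.card_powersetCard, Finset.card_univ, Fintype.card_fin]
  have hmean : ∫ G, fTri (p : ℝ) G ∂plantedModel n p d k = 𝒜.card * (q ^ 3 * μ) := by
    rw [h𝒜c]; exact plantedMean_eq hd k hp0
  have hsq : ∫ G, fTri (p : ℝ) G ^ 2 ∂plantedModel n p d k =
      ∑ A ∈ 𝒜, ∑ B ∈ 𝒜, ∫ G, triVar p A G * triVar p B G ∂plantedModel n p d k := by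
    simp_rw [fTri_eq_sum_triVar, sq, Finset.sum_mul_sum]
    rw [integral_finsetSum _ fun A _ => integrable_finsetSum _ fun B _ =>
      integrable_triVar_mul p (by omega) k A B]
    exact Finset.sum_congr rfl fun A _ =>
      integral_finsetSum _ fun B _ => integrable_triVar_mul p (by omega) k A B
  have hpair : ∀ A ∈ 𝒜, ∀ B ∈ 𝒜, ∫ G, triVar p A G * triVar p B G ∂plantedModel n p d k -
      q ^ 6 * μ ^ 2 ≤ (if (A ∩ B).card = 1 then q ^ 5 * μ ^ 2 else 0) +
        (if (A ∩ B).card = 2 then q ^ 4 * (5 * p * μ) else 0) +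
        (if (A ∩ B).card = 3 then p ^ 3 + q ^ 3 * μ else 0) := by
    intro A hA B hB
    have hA3 : A.card = 3 := (Finset.mem_powersetCard.1 hA).2
    have hB3 : B.card = 3 := (Finset.mem_powersetCard.1 hB).2
    have hle : (A ∩ B).card ≤ 3 := hA3 ▸ Finset.card_le_card Finset.inter_subset_left
    have hu := Finset.card_union_add_card_inter A B
    have h6 : 0 ≤ q ^ 6 * μ ^ 2 := by positivity
    obtain h | h | h | h : (A ∩ B).card = 0 ∨ (A ∩ B).card = 1 ∨ (A ∩ B).card = 2 ∨
      (A ∩ B).card = 3 := by omega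
    · rw [integral_triVar_mul_triVar hd k hp0 hA3 hB3 (by omega),
        show (A ∪ B).card = 6 by omega]
      simp [h, hq, hμ]
    · rw [integral_triVar_mul_triVar hd k hp0 hA3 hB3 (by omega),
        show (A ∪ B).card = 5 by omega]
      simp [h, hq, hμ]
      positivity
    · have := integral_triVar_mul_triVar_le_of_inter_eq_two hd k hp0 hp hA3 hB3 h
      simp only [h]
      norm_num
      linarith
    · have hAB : A = B := by
        have h1 := Finset.eq_of_subset_of_card_le (Finset.inter_subset_left (s₁ := A) (s₂ := B))
          (by omega)
        have h2 := Finset.eq_of_subset_of_card_le (Finset.inter_subset_right (s₁ := A) (s₂ := B))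
          (by omega)
        exact h1.symm.trans h2
      have := integral_triVar_sq_le hd k hp0 hp hT0 hA3
      simp only [h]
      norm_num
      rw [← hAB]
      linarith
  have hcount : ∀ A ∈ 𝒜, ∀ (m r : ℕ), m + r = 3 → ∀ c : ℝ, 0 ≤ c →
      ∑ B ∈ 𝒜, (if (A ∩ B).card = m then c else 0) ≤ (Nat.choose 3 m * n ^ r : ℕ) * c := by
    intro A hA m r hmr c hc
    rw [← Finset.sum_filter, Finset.sum_const, nsmul_eq_mul]
    refine mul_le_mul_of_nonneg_right ?_ hc
    exact_mod_cast card_filter_inter_card_le (Finset.mem_powersetCard.1 hA).2 hmr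
  set R : ℝ := 3 * (n : ℝ) ^ 2 * q ^ 5 * μ ^ 2 + 15 * n * q ^ 4 * p * μ + (p ^ 3 + q ^ 3 * μ) with hR
  have hR0 : 0 ≤ R := by positivity
  have hrow : ∀ A ∈ 𝒜, ∑ B ∈ 𝒜, (∫ G, triVar p A G * triVar p B G ∂plantedModel n p d k -
      q ^ 6 * μ ^ 2) ≤ R := by
    intro A hA
    refine (Finset.sum_le_sum (hpair A hA)).trans ?_
    rw [Finset.sum_add_distrib, Finset.sum_add_distrib]
    have c1 := hcount A hA 1 2 rfl (q ^ 5 * μ ^ 2) (by positivity)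
    have c2 := hcount A hA 2 1 rfl (q ^ 4 * (5 * p * μ)) (by positivity)
    have c3 := hcount A hA 3 0 rfl (p ^ 3 + q ^ 3 * μ) (by positivity)
    norm_num [Nat.choose] at c1 c2 c3
    rw [hR]
    linarith
  have hN : (𝒜.card : ℝ) ≤ (n : ℝ) ^ 3 := by
    rw [h𝒜c]; exact_mod_cast Nat.choose_le_pow n 3
  have hvar : variance (fTri (p : ℝ)) (plantedModel n p d k) =
      ∑ A ∈ 𝒜, ∑ B ∈ 𝒜, (∫ G, triVar p A G * triVar p B G ∂plantedModel n p d k -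
      q ^ 6 * μ ^ 2) := by
    rw [variance_eq_sub (memLp_fTri p (by omega) k), hmean]
    simp only [Pi.pow_apply, Finset.sum_sub_distrib, Finset.sum_const, nsmul_eq_mul]
    rw [hsq]
    ring
  rw [hvar]
  calc _ ≤ ∑ A ∈ 𝒜, R := Finset.sum_le_sum hrow
    _ = 𝒜.card * R := by rw [Finset.sum_const, nsmul_eq_mul]
    _ ≤ _ := mul_le_mul_of_nonneg_right hN hR0

/-- Without a community, the planted model is the null model. -/
theorem plantedModel_zero (n : ℕ) (p : unitInterval) {d : ℕ} (hd : 1 ≤ d) :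
    plantedModel n p d 0 = nullModel n p := by
  have := isProbabilityMeasure_uniformSphere hd
  have : IsProbabilityMeasure (nullModel n p) := by unfold nullModel; infer_instance
  have h0 : Set.projIcc (0 : ℝ) 1 zero_le_one (0 / n) = 0 := by
    rw [zero_div]; exact Set.projIcc_left (zero_le_one' ℝ)
  have hm : Measurable fun y : (Fin n → Sph d) × SimpleGraph (Fin n) =>
      ((∅ : Set (Fin n)), y) := measurable_const.prodMk measurable_id
  rw [plantedModel, h0, setBernoulli_zero, Measure.dirac_prod,
    Measure.map_map (measurable_plantedGraph _) hm]
  have h1 : (fun x : Set (Fin n) × (Fin n → Sph d) × SimpleGraph (Fin n) =>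
      plantedGraph (p : ℝ) x.1 x.2.1 x.2.2) ∘ (fun y => ((∅ : Set (Fin n)), y)) = Prod.snd := by
    funext y
    ext i j
    simp only [plantedGraph, Function.comp_apply, Set.mem_empty_iff_false, false_and, not_false_eq_true,
      true_and, false_or]
    exact ⟨fun h => h.2, fun h => ⟨h.ne, h⟩⟩
  rw [h1, Measure.map_snd_prod]
  simp

theorem memProb_zero (n : ℕ) : memProb n 0 = 0 := by
  rw [memProb, zero_div]; exact Set.projIcc_left (zero_le_one' ℝ)

theorem coe_memProb {n : ℕ} {k : ℝ} (hk0 : 0 ≤ k) (hkn : k ≤ n) : (memProb n k : ℝ) = k / n := by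
  rw [memProb, Set.projIcc_of_mem zero_le_one ⟨by positivity, div_le_one_of_le₀ hkn (by positivity)⟩]

/-- Chebyshev's inequality under both models, the null model being the planted model with `k = 0`. -/
theorem testingError_le {n : ℕ} {p : unitInterval} {d : ℕ} (hd : 2 ≤ d) (k : ℝ)
    (hp0 : 0 < (p : ℝ)) (hp : (p : ℝ) ≤ 1 / 2) (hT0 : 0 ≤ triMean p d)
    (hM : 0 < plantedMean n p d k) {θ : ℝ} (hθ0 : 0 < θ) (hθ1 : θ < 1) :
    testingError n p d k (θ * plantedMean n p d k) ≤
      (n : ℝ) ^ 3 * p ^ 3 / (θ * plantedMean n p d k) ^ 2 +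
      variance (fTri (p : ℝ)) (plantedModel n p d k) / ((1 - θ) * plantedMean n p d k) ^ 2 := by
  have := isProbabilityMeasure_plantedModel n p (d := d) (by omega) k
  have := isProbabilityMeasure_plantedModel n p (d := d) (by omega) 0
  set M := plantedMean n p d k with hMdef
  have hcheb : ∀ k' c : ℝ, 0 < c → (plantedModel n p d k').real
      {G | c ≤ |fTri (p : ℝ) G - ∫ G, fTri (p : ℝ) G ∂plantedModel n p d k'|} ≤
        variance (fTri (p : ℝ)) (plantedModel n p d k') / c ^ 2 := by
    intro k' c hc
    have := isProbabilityMeasure_plantedModel n p (d := d) (by omega) k'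
    have h := meas_ge_le_variance_div_sq (memLp_fTri (n := n) p (d := d) (by omega) k') hc
    exact ENNReal.toReal_le_of_le_ofReal (div_nonneg (variance_nonneg _ _) (sq_nonneg c)) h
  refine add_le_add ?_ ?_
  · have h0 : ∫ G, fTri (p : ℝ) G ∂plantedModel n p d 0 = 0 := by
      have := plantedMean_eq (n := n) hd 0 hp0
      rw [memProb_zero] at this
      simpa [plantedMean] using this
    have hv := variance_fTri_le (n := n) hd 0 hp0 hp hT0
    rw [memProb_zero] at hv
    have hv : variance (fTri (p : ℝ)) (plantedModel n p d 0) ≤ (n : ℝ) ^ 3 * (p : ℝ) ^ 3 := by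
      simpa using hv
    have h1 := hcheb 0 (θ * M) (by positivity)
    rw [h0] at h1
    simp only [sub_zero] at h1
    rw [← plantedModel_zero n p (d := d) (by omega)]
    calc _ ≤ _ := measureReal_mono fun G hG => ?_
      _ ≤ _ := h1
      _ ≤ _ := div_le_div_of_nonneg_right hv (by positivity)
    have hG : fTri (p : ℝ) G > θ * M := hG
    change θ * M ≤ |fTri (p : ℝ) G|
    exact hG.le.trans (le_abs_self _)
  · refine le_trans (measureReal_mono fun G hG => ?_)
      (hcheb k ((1 - θ) * M) (mul_pos (by linarith) hM))
    have hG : fTri (p : ℝ) G ≤ θ * M := hG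
    change (1 - θ) * M ≤ |fTri (p : ℝ) G - M|
    rw [abs_sub_comm]
    exact le_trans (by linarith) (le_abs_self _)

/-! ### Asymptotics of the testing error -/

/-- The quantity `n³ p³ / (k⁶ μ²)`, with `μ` the mean of a signed triangle inside the community, is
the square of the ratio between the null standard deviation and the planted mean of the signed
triangle count, up to constants. It governs the error of the test. -/
noncomputable def noiseRatio (n : ℕ) (p : ℝ) (d : ℕ) (k : ℝ) : ℝ :=
  (n : ℝ) ^ 3 * p ^ 3 / (k ^ 6 * triMean p d ^ 2)

theorem cube_div_le_choose_three {n : ℕ} (hn : 4 ≤ n) : (n : ℝ) ^ 3 / 24 ≤ n.choose 3 := by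
  obtain ⟨m, rfl⟩ := Nat.exists_eq_add_of_le hn
  have h : (((4 + m).choose 3 : ℕ) : ℝ) = (4 + m) * (3 + m) * (2 + m) / 6 := by
    rw [Nat.cast_choose_eq_descPochhammer_div]
    simp [descPochhammer_succ_right, Nat.factorial]
    ring
  rw [h]
  push_cast
  have : (0 : ℝ) ≤ m := by positivity
  nlinarith [mul_nonneg this this, mul_nonneg this (mul_nonneg this this)]

/-- The bounds for the variance and the mean, combined. The condition `1 / k ≤ p` makes the terms from
pairs of triples with two or three common vertices at most the square root of the noise ratio, up to
constants. -/
theorem testingError_le_noiseRatio {n : ℕ} (hn : 4 ≤ n) {p : unitInterval} {d : ℕ} (hd : 2 ≤ d)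
    {k : ℝ} (hk0 : 0 < k) (hkn : k ≤ n) (hkp : 1 / k ≤ p) (hp : (p : ℝ) ≤ 1 / 2)
    (hT0 : 0 < triMean p d) {θ : ℝ} (hθ0 : 0 < θ) (hθ1 : θ < 1) :
    testingError n p d k (θ * plantedMean n p d k) ≤
      576 * noiseRatio n p d k / θ ^ 2 +
        (1728 / k + 9216 * √(noiseRatio n p d k) + 576 * noiseRatio n p d k) / (1 - θ) ^ 2 := by
  have hp0 : 0 < (p : ℝ) := lt_of_lt_of_le (by positivity) hkp
  have hn0 : (0 : ℝ) < n := by positivity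
  have hkp1 : 1 ≤ (p : ℝ) * k := by rwa [div_le_iff₀ hk0] at hkp
  have hq := coe_memProb hk0.le hkn
  have hM := plantedMean_eq (n := n) hd k hp0
  have hvar := variance_fTri_le (n := n) hd k hp0 hp hT0.le
  rw [hq] at hM hvar
  set μ := triMean (p : ℝ) d with hμ
  set M := plantedMean n p d k with hMdef
  set z := noiseRatio n p d k with hz
  have hMlow : k ^ 3 * μ / 24 ≤ M := by
    have h := mul_le_mul_of_nonneg_right (cube_div_le_choose_three hn)
      (show 0 ≤ (k / n) ^ 3 * μ by positivity)
    calc k ^ 3 * μ / 24 = (n : ℝ) ^ 3 / 24 * ((k / n) ^ 3 * μ) := by field_simp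
      _ ≤ _ := h
      _ = M := hM.symm
  have hM0 : 0 < M := lt_of_lt_of_le (by positivity) hMlow
  have hMsq : (k ^ 3 * μ / 24) ^ 2 ≤ M ^ 2 := by gcongr
  have hvar' : ProbabilityTheory.variance (fTri (p : ℝ)) (plantedModel n p d k) ≤
      3 * k ^ 5 * μ ^ 2 + 15 * k ^ 4 * p * μ + n ^ 3 * p ^ 3 + k ^ 3 * μ := by
    refine hvar.trans (le_of_eq ?_)
    field_simp
    ring
  have hz0 : 0 ≤ z := by
    rw [hz, noiseRatio]; positivity
  have hnp : 1 ≤ (n : ℝ) * p := by nlinarith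
  -- `1 / (k³ μ) ≤ √z` because `n p ≥ 1`
  have h1 : 1 / (k ^ 3 * μ) ≤ √z := by
    refine Real.le_sqrt_of_sq_le ?_
    rw [hz, noiseRatio, ← hμ, div_pow, one_pow, mul_pow, ← pow_mul, ← mul_pow]
    gcongr
    exact one_le_pow₀ hnp
  -- `p / (k² μ) ≤ √z` because `k² ≤ n³ p`
  have h2 : (p : ℝ) / (k ^ 2 * μ) ≤ √z := by
    refine Real.le_sqrt_of_sq_le ?_
    rw [hz, noiseRatio, ← hμ, div_pow, div_le_div_iff₀ (by positivity) (by positivity)]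
    have h3 : k ^ 2 ≤ (n : ℝ) ^ 3 * p := by
      calc k ^ 2 ≤ (n : ℝ) ^ 2 * 1 := by rw [mul_one]; gcongr
        _ ≤ (n : ℝ) ^ 2 * (n * p) := by gcongr
        _ = _ := by ring
    calc (p : ℝ) ^ 2 * (k ^ 6 * μ ^ 2) = (p ^ 2 * k ^ 4 * μ ^ 2) * k ^ 2 := by ring
      _ ≤ (p ^ 2 * k ^ 4 * μ ^ 2) * ((n : ℝ) ^ 3 * p) := by gcongr
      _ = _ := by ring
  refine (testingError_le hd k hp0 hp hT0.le hM0 hθ0 hθ1).trans (add_le_add ?_ ?_)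
  · rw [← hMdef, mul_pow]
    calc (n : ℝ) ^ 3 * p ^ 3 / (θ ^ 2 * M ^ 2)
        ≤ (n : ℝ) ^ 3 * p ^ 3 / (θ ^ 2 * (k ^ 3 * μ / 24) ^ 2) := by gcongr
      _ = _ := by
        rw [hz, noiseRatio, ← hμ]
        field_simp
        ring
  · rw [← hMdef, mul_pow]
    have hθ2 : 0 < (1 - θ) ^ 2 := pow_pos (by linarith) 2
    calc _ ≤ (3 * k ^ 5 * μ ^ 2 + 15 * k ^ 4 * p * μ + n ^ 3 * p ^ 3 + k ^ 3 * μ) /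
          ((1 - θ) ^ 2 * (k ^ 3 * μ / 24) ^ 2) := by gcongr
      _ = (1728 / k + 8640 * (p / (k ^ 2 * μ)) + 576 * (1 / (k ^ 3 * μ)) + 576 * z) /
          (1 - θ) ^ 2 := by
        rw [hz, noiseRatio, ← hμ]
        have : (1 - θ) ≠ 0 := by linarith
        field_simp
        ring
      _ ≤ _ := div_le_div_of_nonneg_right (by linarith) hθ2.le

theorem noiseRatio_le {n : ℕ} (hn : 0 < n) {p : ℝ} {d : ℕ} (hd : 20 ≤ d) {k : ℝ} (hk0 : 0 < k)
    (hp0 : 0 < p) (hp : p ≤ 1 / 2) (hL : (5 * Real.log (1 / p)) ^ 4 ≤ d) :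
    noiseRatio n p d k ≤
      1600 * 64 ^ 3 * (d / (k ^ 6 * p ^ 3 / n ^ 3 * Real.log (1 / p) ^ 3)) := by
  obtain ⟨hμ0, hμ⟩ := le_mul_triMean_sq hd hp0 hp hL
  have hn0 : (0 : ℝ) < n := by positivity
  have hlog : 0 < Real.log (1 / p) := Real.log_pos (by rw [lt_div_iff₀ hp0]; linarith)
  rw [noiseRatio]
  generalize Real.log (1 / p) = L at *
  rw [div_le_iff₀ (by positivity)] at hμ ⊢
  have h1 : (1600 : ℝ) * 64 ^ 3 * (d / (k ^ 6 * p ^ 3 / n ^ 3 * L ^ 3)) *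
      (k ^ 6 * triMean p d ^ 2) =
      (n : ℝ) ^ 3 / (p ^ 3 * L ^ 3) * (d * triMean p d ^ 2 * (1600 * 64 ^ 3)) := by
    field_simp
  rw [h1]
  calc (n : ℝ) ^ 3 * p ^ 3 = (n : ℝ) ^ 3 / (p ^ 3 * L ^ 3) * (p ^ 6 * L ^ 3) := by field_simp
    _ ≤ _ := by gcongr

theorem tendsto_testingError {k : ℕ → ℝ} {p : ℕ → unitInterval} {d : ℕ → ℕ}
    (hk : Tendsto k atTop atTop) (hkn : ∀ᶠ n : ℕ in atTop, k n ≤ n)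
    (hp : ∀ᶠ n : ℕ in atTop, 1 / k n ≤ p n ∧ (p n : ℝ) ≤ 1 / 2)
    (hd : ∀ᶠ n : ℕ in atTop, max 20 ((5 * Real.log (1 / p n)) ^ 4) ≤ (d n : ℝ))
    (hdo : (fun n : ℕ => (d n : ℝ)) =o[atTop]
      fun n : ℕ => k n ^ 6 * (p n : ℝ) ^ 3 / (n : ℝ) ^ 3 * Real.log (1 / p n) ^ 3)
    {θ : ℝ} (hθ0 : 0 < θ) (hθ1 : θ < 1) :
    Tendsto (fun n : ℕ => testingError n (p n) (d n) (k n)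
      (θ * plantedMean n (p n) (d n) (k n))) atTop (𝓝 0) := by
  have hev : ∀ᶠ n : ℕ in atTop, 4 ≤ n ∧ 0 < k n ∧ k n ≤ n ∧ 1 / k n ≤ p n ∧ 0 < (p n : ℝ) ∧
      (p n : ℝ) ≤ 1 / 2 ∧ 20 ≤ d n ∧ (5 * Real.log (1 / p n)) ^ 4 ≤ (d n : ℝ) := by
    filter_upwards [eventually_ge_atTop 4, hk.eventually_gt_atTop 0, hkn, hp, hd]
      with n h1 h2 h3 h4 h5
    exact ⟨h1, h2, h3, h4.1, (one_div_pos.2 h2).trans_le h4.1, h4.2,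
      by exact_mod_cast (le_max_left _ _).trans h5, (le_max_right _ _).trans h5⟩
  have hz : Tendsto (fun n => noiseRatio n (p n) (d n) (k n)) atTop (𝓝 0) := by
    have hlim := hdo.tendsto_div_nhds_zero.const_mul (1600 * 64 ^ 3 : ℝ)
    rw [mul_zero] at hlim
    refine squeeze_zero' ?_ ?_ hlim
    · filter_upwards [hev] with n ⟨_, h2, _, _, h5, _⟩
      rw [noiseRatio]
      positivity
    · filter_upwards [hev] with n ⟨h1, h2, _, _, h5, h6, h7, h8⟩
      exact noiseRatio_le (by omega) h7 h2 h5 h6 h8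
  have hbound : Tendsto (fun n => 576 * noiseRatio n (p n) (d n) (k n) / θ ^ 2 +
      (1728 / k n + 9216 * √(noiseRatio n (p n) (d n) (k n)) +
        576 * noiseRatio n (p n) (d n) (k n)) / (1 - θ) ^ 2) atTop (𝓝 0) := by
    have h1 : Tendsto (fun n => 1728 / k n) atTop (𝓝 0) := hk.const_div_atTop 1728
    have h2 := (Real.continuous_sqrt.tendsto 0).comp hz
    rw [Real.sqrt_zero] at h2
    have h3 := ((hz.const_mul 576).div_const (θ ^ 2)).add
      (((h1.add (h2.const_mul 9216)).add (hz.const_mul 576)).div_const ((1 - θ) ^ 2))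
    simpa using h3
  refine squeeze_zero' (Eventually.of_forall fun n => ?_) ?_ hbound
  · exact add_nonneg measureReal_nonneg measureReal_nonneg
  · filter_upwards [hev] with n ⟨h1, h2, h3, h4, h5, h6, h7, h8⟩
    exact testingError_le_noiseRatio h1 (by omega) h2 h3 h4 h6
      (le_mul_triMean_sq h7 h5 h6 h8).1 hθ0 hθ1

theorem plantedMean_eq_fullModel {n : ℕ} {p : unitInterval} {d : ℕ} (hd : 2 ≤ d) {k : ℝ}
    (hk0 : 0 ≤ k) (hkn : k ≤ n) (hp0 : 0 < (p : ℝ)) {i j l : Fin n} (hij : i ≠ j) (hjl : j ≠ l)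
    (hil : i ≠ l) :
    plantedMean n p d k =
      n.choose 3 * (k / n) ^ 3 * ∫ G, signedTriangle (p : ℝ) G i j l ∂fullModel n p d := by
  have hn : (0 : ℝ) < n := by exact_mod_cast i.pos
  have h : ∫ G, signedTriangle (p : ℝ) G i j l ∂fullModel n p d = triMean p d := by
    rw [fullModel]
    simp_rw [← triVar_triple (p : ℝ) hij hjl hil]
    rw [integral_triVar hd n hp0 (Finset.card_eq_three.2 ⟨i, j, l, hij, hil, hjl, rfl⟩),
      coe_memProb hn.le le_rfl, div_self hn.ne', one_pow, one_mul]
  rw [plantedMean_eq hd k hp0, coe_memProb hk0 hkn, h, mul_assoc]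

end LocalGeometry

theorem theorem2p1 :
    ∃ C : ℝ, 0 < C ∧
      ∀ (k : ℕ → ℝ) (p : ℕ → unitInterval) (d : ℕ → ℕ),
        Tendsto k atTop atTop →
        (∀ᶠ n : ℕ in atTop, k n ≤ n) →
        (∀ᶠ n : ℕ in atTop, 1 / k n ≤ p n ∧ (p n : ℝ) ≤ 1 / 2) →
        (∀ᶠ n : ℕ in atTop, max C ((5 * Real.log (1 / p n)) ^ 4) ≤ d n) →
        ((fun n : ℕ => (d n : ℝ)) =o[atTop]
          fun n : ℕ => k n ^ 6 * (p n : ℝ) ^ 3 / (n : ℝ) ^ 3 * Real.log (1 / p n) ^ 3) →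
        -- the test with threshold `γ_tri = (1 / 2) 𝔼_𝒫[f_tri]` has vanishing error
        Tendsto (fun n : ℕ => LocalGeometry.testingError n (p n) (d n) (k n)
            (1 / 2 * LocalGeometry.plantedMean n (p n) (d n) (k n))) atTop (𝓝 0) ∧
        -- the second expression for `γ_tri`, through the full model
        (∀ᶠ n : ℕ in atTop, ∀ i j l : Fin n, i ≠ j → j ≠ l → i ≠ l →
          1 / 2 * LocalGeometry.plantedMean n (p n) (d n) (k n) =
            1 / 2 * (n.choose 3 : ℝ) * (k n / n) ^ 3 *
              ∫ G, LocalGeometry.signedTriangle (p n : ℝ) G i j l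
                ∂LocalGeometry.fullModel n (p n) (d n)) ∧
        -- the factor `1 / 2` may be replaced by any fixed constant in `(0, 1)`
        (∀ θ : ℝ, 0 < θ → θ < 1 →
          Tendsto (fun n : ℕ => LocalGeometry.testingError n (p n) (d n) (k n)
            (θ * LocalGeometry.plantedMean n (p n) (d n) (k n))) atTop (𝓝 0)) := by
  refine ⟨20, by norm_num, fun k p d hk hkn hp hd hdo => ⟨?_, ?_, fun θ hθ0 hθ1 => ?_⟩⟩
  · exact LocalGeometry.tendsto_testingError hk hkn hp hd hdo (by norm_num) (by norm_num)
  · filter_upwards [hk.eventually_gt_atTop 0, hkn, hp, hd] with n hk0 hkn hp hd i j l hij hjl hil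
    have h20 : 20 ≤ d n := by exact_mod_cast (le_max_left _ _).trans hd
    rw [LocalGeometry.plantedMean_eq_fullModel (by omega) hk0.le hkn
      ((one_div_pos.2 hk0).trans_le hp.1) hij hjl hil]
    ring
  · exact LocalGeometry.tendsto_testingError hk hkn hp hd hdo hθ0 hθ1
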